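/- Let $k$ be a commutative ring; all algebras are associative unital $k$-algebras and all maps are $k$-linear. Let $\mathcal H=(\mathcal H_L,\mathcal H_R,S)$ be a Hopf algebroid with total algebra $H$: a left bialgebroid $(H,L,s_L,t_L,\gamma_L,\pi_L)$ and a right bialgebroid $(H,R,s_R,t_R,\gamma_R,\pi_R)$ on the same algebra $H$, with compatible source and target maps, with $(\gamma_L\otimes_R H)\gamma_R=(H\otimes_L\gamma_R)\gamma_L$ and $(\gamma_R\otimes_L H)\gamma_L=(H\otimes_R\gamma_L)\gamma_R$, and with an antipode $S$. Here $H$ is an $L$-coring via $l\cdot h\cdot l'=s_L(l)t_L(l')h$ and an $R$-coring via $r\cdot h\cdot r'=h\,s_R(r')t_R(r)$; it is also regarded as an $L$-$R$ and an $R$-$L$ bimodule through these actions. An $L$-coring $\mathcal D$ is a *right extension* of an $A$-coring $\mathcal C$ if $\mathcal C$ is a $\mathcal C$-$\mathcal D$ bicomodule via its coproduct $c\mapsto c^{(1)}\otimes_A c^{(2)}$ and some right $\mathcal D$-coaction $\tau_{\mathcal C}\colon c\mapsto c_{[0]}\otimes_L c_{[1]}$. A right $\mathcal C$-comodule $(M,\varrho\colon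 m\mapsto m^{[0]}\otimes_A m^{[1]})$ is then a right $L$-module via $ml=m^{[0]}\epsilon_{\mathcal C}(m^{[1]}l)$. The extension is *pure* if, for every right $\mathcal C$-comodule $(M,\varrho)$, the equaliser $M\to M\otimes_A\mathcal C\rightrightarrows M\otimes_A\mathcal C\otimes_A\mathcal C$ of $\varrho\otimes_A\mathcal C$ and $M\otimes_A\Delta_{\mathcal C}$ in right $L$-modules is preserved by $-\otimes_L\mathcal D\otimes_L\mathcal D$; in this case there is a unique map $\tau_M\colon M\to M\otimes_L\mathcal D$ with $(\varrho\otimes_L\mathcal D)\tau_M=(M\otimes_A\tau_{\mathcal C})\varrho$, and $M$ is a right $\mathcal D$-comodule via $\tau_M$. The Hopf algebroid $\mathcal H$ is *pure* if the coring of $\mathcal H_L$, as a right extension (via $\gamma_L$) of the coring of $\mathcal H_R$, and the coring of $\mathcal H_R$, as a right extension (via $\gamma_R$) of the coring of $\mathcal H_L$, are both pure. An $L$-$\mathcal C$ bicomodule $\Sigma$ (an $L$-$A$ bimodule and right $\mathcal C$-comodule with left $L$-linear coaction) for a pure right extension $\mathcal D$ of $\mathcal C$ is *cleft* if there are * a left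 $L$-linear right $\mathcal D$-colinear map $j\colon\mathcal D\to\Sigma$, and * an $A$-$L$ bilinear map $\tilde\jmath\colon\mathcal C\to\mathrm{Hom}_A(\Sigma,A)$ with $c^{(1)}\tilde\jmath(c^{(2)})(x)=\tilde\jmath(c)(x^{[0]})x^{[1]}$ for all $c\in\mathcal C$, $x\in\Sigma$, such that $c^{(1)}\,\tilde\jmath\big({c^{(2)}}_{[0]}\big)\big(j({c^{(2)}}_{[1]})\big)=c$ for all $c\in\mathcal C$ and $j(d)^{[0]}\,\tilde\jmath\big(j(d)^{[1]}\big)(x)=\epsilon_{\mathcal D}(d)x$ for all $d\in\mathcal D$, $x\in\Sigma$. Let $A$ be a right $\mathcal H_R$-comodule algebra, i.e. an algebra in the monoidal category of right $\mathcal H_R$-comodules, with $R$-ring structure $\eta_R\colon R\to A$ and coaction $a\mapsto a^{[0]}\otimes_R a^{[1]}$, and let $T=\{t\in A\mid t^{[0]}\otimes_R t^{[1]}=t\otimes_R 1_H\}$ be its coinvariant subalgebra. $A$ is an *$\mathcal H$-cleft extension* of $T$ if * $A$ is an $L$-ring with unit map an algebra map $\eta_L\colon L\to A$, and $T$ is an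 $L$-subring, i.e. $\eta_L(L)\subseteq T$; * there are a left $L$-linear right $\mathcal H_R$-colinear map $\lambda\colon H\to A$ and a left $R$-linear right $L$-linear map $\bar\lambda\colon H\to A$ such that $\mu_A(\lambda\otimes_R\bar\lambda)\gamma_R=\eta_L\pi_L$ and $\mu_A(\bar\lambda\otimes_L\lambda)\gamma_L=\eta_R\pi_R$. Let $\mathcal C=A\otimes_R H$ be the associated $A$-coring, with $a(b\otimes h)a'=ab\,a'^{[0]}\otimes h\,a'^{[1]}$, coproduct $A\otimes_R\gamma_R$ and counit $A\otimes_R\pi_R$; the coring of $\mathcal H_L$ is a right extension of $\mathcal C$ via the coaction $A\otimes_R\gamma_L$. **Proposition.** Let $\mathcal H$ be a pure Hopf algebroid and $A$ a right $\mathcal H_R$-comodule algebra. Then $A$ is an $\mathcal H$-cleft extension of its $\mathcal H_R$-coinvariant subalgebra if and only if 1. $A$ is an $L$-ring, with some unit map $\eta_L\colon L\to A$, and 2. $A$, with the left $L$-module structure given by $\eta_L$, the right regular $A$-module structure and the given $\mathcal H_R$-coaction, is an $L$-$\mathcal C$ bicomodule, the coring extension $\mathcal H_L$ of $\mathcal C$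 is pure, and this bicomodule is cleft for it. More precisely, for each given $L$-ring structure $\eta_L$ of $A$, the conditions for an $\mathcal H$-cleft extension hold with $\eta_L$ if and only if (2) holds with $\eta_L$. -/

import Mathlib

open scoped TensorProduct
open MulOpposite (op)

universe u

namespace NC

/-- A `k`-linear `B`-`C` bimodule structure on the `k`-module `M`: `l b m` is the left action
`b m` and `r c m` is the right action `m c`. -/
structure Bimod (k B C M : Type u) [CommRing k] [Ring B] [Algebra k B] [Ring C] [Algebra k C]
    [AddCommGroup M] [Module k M] where
  l : B →ₗ[k] M →ₗ[k] M
  r : C →ₗ[k] M →ₗ[k] M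
  l_one : ∀ m, l 1 m = m
  l_mul : ∀ b b' m, l (b * b') m = l b (l b' m)
  r_one : ∀ m, r 1 m = m
  r_mul : ∀ c c' m, r (c * c') m = r c' (r c m)
  lr : ∀ b c m, l b (r c m) = r c (l b m)

section Balanced

variable {k C M N M' N' P : Type u} [CommRing k] [Ring C] [Algebra k C]
  [AddCommGroup M] [Module k M] [AddCommGroup N] [Module k N]
  [AddCommGroup M'] [Module k M'] [AddCommGroup N'] [Module k N']
  [AddCommGroup P] [Module k P]

/-- The submodule of `M ⊗[k] N` generated by the elements `m c ⊗ n - m ⊗ c n`, for a right action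
`ρ` of `C` on `M` and a left action `lam` of `C` on `N`. -/
def BT.rel (ρ : C →ₗ[k] M →ₗ[k] M) (lam : C →ₗ[k] N →ₗ[k] N) : Submodule k (M ⊗[k] N) :=
  Submodule.span k {z | ∃ m c n, z = ρ c m ⊗ₜ[k] n - m ⊗ₜ[k] lam c n}

/-- The balanced tensor product `M ⊗_C N` over the (not necessarily commutative) algebra `C`, for a
right action `ρ` of `C` on `M` and a left action `lam` of `C` on `N`. -/
def BT (ρ : C →ₗ[k] M →ₗ[k] M) (lam : C →ₗ[k] N →ₗ[k] N) : Type u :=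
  (M ⊗[k] N) ⧸ BT.rel ρ lam

namespace BT

variable (ρ : C →ₗ[k] M →ₗ[k] M) (lam : C →ₗ[k] N →ₗ[k] N)

noncomputable instance : AddCommGroup (BT ρ lam) :=
  inferInstanceAs (AddCommGroup ((M ⊗[k] N) ⧸ BT.rel ρ lam))

noncomputable instance : Module k (BT ρ lam) :=
  inferInstanceAs (Module k ((M ⊗[k] N) ⧸ BT.rel ρ lam))

/-- The canonical projection `M ⊗[k] N → M ⊗_C N`. -/
noncomputable def mk : M ⊗[k] N →ₗ[k] BT ρ lam := (BT.rel ρ lam).mkQ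

/-- The canonical bilinear map `(m, n) ↦ m ⊗_C n`. -/
noncomputable def t : M →ₗ[k] N →ₗ[k] BT ρ lam := (TensorProduct.mk k M N).compr₂ (mk ρ lam)

theorem mk_tmul (m : M) (n : N) : mk ρ lam (m ⊗ₜ[k] n) = t ρ lam m n := rfl

theorem mk_surjective : Function.Surjective (mk ρ lam) := Submodule.mkQ_surjective _

variable {ρ lam}

theorem t_bal (c : C) (m : M) (n : N) : t ρ lam (ρ c m) n = t ρ lam m (lam c n) := by
  rw [← mk_tmul, ← mk_tmul, ← sub_eq_zero, ← map_sub]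
  exact (Submodule.Quotient.mk_eq_zero _).2 (Submodule.subset_span ⟨m, c, n, rfl⟩)

theorem ind {motive : BT ρ lam → Prop} (z : BT ρ lam)
    (ht : ∀ m n, motive (t ρ lam m n)) (hadd : ∀ x y, motive x → motive y → motive (x + y)) :
    motive z := by
  obtain ⟨u, rfl⟩ := mk_surjective ρ lam z
  induction u using TensorProduct.induction_on with
  | zero => simpa using ht 0 0
  | tmul m n => exact ht m n
  | add x y hx hy => rw [map_add]; exact hadd _ _ hx hy

theorem ext {f g : BT ρ lam →ₗ[k] P} (h : ∀ m n, f (t ρ lam m n) = g (t ρ lam m n)) : f = g := by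
  ext z
  induction z using ind with
  | ht m n => exact h m n
  | hadd x y hx hy => rw [map_add, map_add, hx, hy]

/-- The linear map out of `M ⊗_C N` defined by a `C`-balanced bilinear map. -/
noncomputable def lift (f : M →ₗ[k] N →ₗ[k] P) (hf : ∀ c m n, f (ρ c m) n = f m (lam c n)) :
    BT ρ lam →ₗ[k] P :=
  (BT.rel ρ lam).liftQ (TensorProduct.lift f) (by
    refine Submodule.span_le.2 ?_
    rintro z ⟨m, c, n, rfl⟩
    simp [hf])

@[simp] theorem lift_t (f : M →ₗ[k] N →ₗ[k] P) (hf : ∀ c m n, f (ρ c m) n = f m (lam c n))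
    (m : M) (n : N) : lift f hf (t ρ lam m n) = f m n := by
  exact (Submodule.liftQ_apply _ _ _).trans (TensorProduct.lift.tmul _ _)

variable {ρ' : C →ₗ[k] M' →ₗ[k] M'} {lam' : C →ₗ[k] N' →ₗ[k] N'}

/-- The map `f ⊗_C g`, for `f` right `C`-linear and `g` left `C`-linear. -/
noncomputable def map (f : M →ₗ[k] M') (g : N →ₗ[k] N') (hf : ∀ c m, f (ρ c m) = ρ' c (f m))
    (hg : ∀ c n, g (lam c n) = lam' c (g n)) : BT ρ lam →ₗ[k] BT ρ' lam' :=
  lift ((t ρ' lam').compl₁₂ f g) (by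
    intro c m n
    simp only [LinearMap.compl₁₂_apply]
    rw [hf, hg, t_bal])

@[simp] theorem map_t (f : M →ₗ[k] M') (g : N →ₗ[k] N') (hf : ∀ c m, f (ρ c m) = ρ' c (f m))
    (hg : ∀ c n, g (lam c n) = lam' c (g n)) (m : M) (n : N) :
    map f g hf hg (t ρ lam m n) = t ρ' lam' (f m) (g n) := by
  simp [map]

end BT

end Balanced

section Actions

variable {k B C D M N P : Type u} [CommRing k] [Ring B] [Algebra k B] [Ring C] [Algebra k C]
  [Ring D] [Algebra k D] [AddCommGroup M] [Module k M] [AddCommGroup N] [Module k N]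
  [AddCommGroup P] [Module k P]

/-- The left action of `B` on `M ⊗_C N`, for a `B`-`C` bimodule `M`. -/
noncomputable def BT.lact (X : Bimod k B C M) (lam : C →ₗ[k] N →ₗ[k] N) :
    B →ₗ[k] BT X.r lam →ₗ[k] BT X.r lam where
  toFun b := BT.map (X.l b) LinearMap.id (fun c m => X.lr b c m) (fun _ _ => rfl)
  map_add' b b' := BT.ext (by simp)
  map_smul' a b := BT.ext (by simp)

@[simp] theorem BT.lact_t (X : Bimod k B C M) (lam : C →ₗ[k] N →ₗ[k] N) (b : B) (m : M) (n : N) :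
    BT.lact X lam b (BT.t X.r lam m n) = BT.t X.r lam (X.l b m) n := by
  simp [BT.lact]

/-- The right action of `D` on `M ⊗_C N`, for a `C`-`D` bimodule `N`. -/
noncomputable def BT.ract (ρ : C →ₗ[k] M →ₗ[k] M) (Y : Bimod k C D N) :
    D →ₗ[k] BT ρ Y.l →ₗ[k] BT ρ Y.l where
  toFun d := BT.map LinearMap.id (Y.r d) (fun _ _ => rfl) (fun c n => (Y.lr c d n).symm)
  map_add' b b' := BT.ext (by simp)
  map_smul' a b := BT.ext (by simp)

@[simp] theorem BT.ract_t (ρ : C →ₗ[k] M →ₗ[k] M) (Y : Bimod k C D N) (d : D) (m : M) (n : N) :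
    BT.ract ρ Y d (BT.t ρ Y.l m n) = BT.t ρ Y.l m (Y.r d n) := by
  simp [BT.ract]

/-- The tensor product of bimodules. -/
@[reducible] noncomputable def Bimod.tensor (X : Bimod k B C M) (Y : Bimod k C D N) :
    Bimod k B D (BT X.r Y.l) where
  l := BT.lact X Y.l
  r := BT.ract X.r Y
  l_one z := by
    induction z using BT.ind with
    | ht m n => simp [X.l_one]
    | hadd x y hx hy => rw [map_add, hx, hy]
  l_mul b b' z := by
    induction z using BT.ind with
    | ht m n => simp [X.l_mul]
    | hadd x y hx hy => simp only [map_add, hx, hy]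
  r_one z := by
    induction z using BT.ind with
    | ht m n => simp [Y.r_one]
    | hadd x y hx hy => rw [map_add, hx, hy]
  r_mul b b' z := by
    induction z using BT.ind with
    | ht m n => simp [Y.r_mul]
    | hadd x y hx hy => simp only [map_add, hx, hy]
  lr b d z := by
    induction z using BT.ind with
    | ht m n => simp
    | hadd x y hx hy => simp only [map_add, hx, hy]

theorem BT.ract_tensor_t {Q : Type u} [AddCommGroup Q] [Module k Q]
    (ρ : B →ₗ[k] Q →ₗ[k] Q) (X : Bimod k B C M)
    (Y : Bimod k C D N) (d : D) (m : Q) (z : BT X.r Y.l) :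
    BT.ract ρ (X.tensor Y) d (BT.t ρ (BT.lact X Y.l) m z)
      = BT.t ρ (BT.lact X Y.l) m (BT.ract X.r Y d z) :=
  BT.ract_t ρ (X.tensor Y) d m z

/-- The associativity map `(M ⊗_C N) ⊗_D P → M ⊗_C (N ⊗_D P)`. -/
noncomputable def BT.assoc (ρ : C →ₗ[k] M →ₗ[k] M) (Y : Bimod k C D N)
    (mu : D →ₗ[k] P →ₗ[k] P) :
    BT (BT.ract ρ Y) mu →ₗ[k] BT ρ (BT.lact Y mu) :=
  BT.lift
    (BT.lift
      (LinearMap.mk₂ k (fun m n => (BT.t ρ (BT.lact Y mu) m).comp (BT.t Y.r mu n))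
        (by intros; ext; simp) (by intros; ext; simp) (by intros; ext; simp)
        (by intros; ext; simp))
      (by
        intro c m n
        ext p
        simp only [LinearMap.mk₂_apply, LinearMap.comp_apply]
        rw [BT.t_bal, BT.lact_t]))
    (by
      intro d z p
      induction z using BT.ind with
      | ht m n => simp [BT.t_bal]
      | hadd x y hx hy => simp only [map_add, LinearMap.add_apply, hx, hy])

@[simp] theorem BT.assoc_t (ρ : C →ₗ[k] M →ₗ[k] M) (Y : Bimod k C D N)
    (mu : D →ₗ[k] P →ₗ[k] P) (m : M) (n : N) (p : P) :
    BT.assoc ρ Y mu (BT.t _ mu (BT.t ρ Y.l m n) p)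
      = BT.t ρ (BT.lact Y mu) m (BT.t Y.r mu n p) := by
  simp [BT.assoc]

/-- The map `N ⊗_D P → (M ⊗_C N) ⊗_D P`, `n ⊗ p ↦ (m ⊗ n) ⊗ p`. -/
noncomputable def BT.assocInvAux (ρ : C →ₗ[k] M →ₗ[k] M) (Y : Bimod k C D N)
    (mu : D →ₗ[k] P →ₗ[k] P) (m : M) : BT Y.r mu →ₗ[k] BT (BT.ract ρ Y) mu :=
  BT.map (BT.t ρ Y.l m) LinearMap.id
    (fun d n => (BT.ract_t ρ Y d m n).symm) (fun _ _ => rfl)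

@[simp] theorem BT.assocInvAux_t (ρ : C →ₗ[k] M →ₗ[k] M) (Y : Bimod k C D N)
    (mu : D →ₗ[k] P →ₗ[k] P) (m : M) (n : N) (p : P) :
    BT.assocInvAux ρ Y mu m (BT.t Y.r mu n p) = BT.t _ mu (BT.t ρ Y.l m n) p := by
  simp [BT.assocInvAux]

/-- The associativity map `M ⊗_C (N ⊗_D P) → (M ⊗_C N) ⊗_D P`. -/
noncomputable def BT.assocInv (ρ : C →ₗ[k] M →ₗ[k] M) (Y : Bimod k C D N)
    (mu : D →ₗ[k] P →ₗ[k] P) :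
    BT ρ (BT.lact Y mu) →ₗ[k] BT (BT.ract ρ Y) mu :=
  BT.lift
    { toFun := BT.assocInvAux ρ Y mu
      map_add' := fun m m' => BT.ext (by simp)
      map_smul' := fun a m => BT.ext (by simp) }
    (by
      intro c m z
      simp only [LinearMap.coe_mk, AddHom.coe_mk]
      induction z using BT.ind with
      | ht n p => rw [BT.lact_t, BT.assocInvAux_t, BT.assocInvAux_t, BT.t_bal]
      | hadd x y hx hy => rw [map_add, hx, hy, map_add, map_add])

@[simp] theorem BT.assocInv_t (ρ : C →ₗ[k] M →ₗ[k] M) (Y : Bimod k C D N)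
    (mu : D →ₗ[k] P →ₗ[k] P) (m : M) (n : N) (p : P) :
    BT.assocInv ρ Y mu (BT.t ρ (BT.lact Y mu) m (BT.t Y.r mu n p))
      = BT.t _ mu (BT.t ρ Y.l m n) p := by
  simp [BT.assocInv]

theorem BT.assocInv_assoc (ρ : C →ₗ[k] M →ₗ[k] M) (Y : Bimod k C D N)
    (mu : D →ₗ[k] P →ₗ[k] P) (z : BT (BT.ract ρ Y) mu) :
    BT.assocInv ρ Y mu (BT.assoc ρ Y mu z) = z := by
  induction z using BT.ind with
  | ht w p =>
    induction w using BT.ind with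
    | ht m n => simp
    | hadd x y hx hy => simp only [map_add, LinearMap.add_apply, hx, hy]
  | hadd x y hx hy => simp only [map_add, hx, hy]

theorem BT.assoc_assocInv (ρ : C →ₗ[k] M →ₗ[k] M) (Y : Bimod k C D N)
    (mu : D →ₗ[k] P →ₗ[k] P) (z : BT ρ (BT.lact Y mu)) :
    BT.assoc ρ Y mu (BT.assocInv ρ Y mu z) = z := by
  induction z using BT.ind with
  | ht m w =>
    induction w using BT.ind with
    | ht n p => simp
    | hadd x y hx hy => simp only [map_add, hx, hy]
  | hadd x y hx hy => simp only [map_add, hx, hy]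

/-- For a right `C`-module `M` and a left `C`-linear map `f : N → C`, the map
`M ⊗_C N → M`, `m ⊗ n ↦ m f(n)`. -/
noncomputable def BT.contrR (ρ : C →ₗ[k] M →ₗ[k] M) (lam : C →ₗ[k] N →ₗ[k] N)
    (hρ : ∀ c c' m, ρ (c * c') m = ρ c' (ρ c m)) (f : N →ₗ[k] C)
    (hf : ∀ c n, f (lam c n) = c * f n) : BT ρ lam →ₗ[k] M :=
  BT.lift (LinearMap.mk₂ k (fun m n => ρ (f n) m) (by simp) (by simp) (by simp) (by simp)) (by
    intro c m n
    simp [hf, hρ])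

@[simp] theorem BT.contrR_t (ρ : C →ₗ[k] M →ₗ[k] M) (lam : C →ₗ[k] N →ₗ[k] N)
    (hρ : ∀ c c' m, ρ (c * c') m = ρ c' (ρ c m)) (f : N →ₗ[k] C)
    (hf : ∀ c n, f (lam c n) = c * f n) (m : M) (n : N) :
    BT.contrR ρ lam hρ f hf (BT.t ρ lam m n) = ρ (f n) m := by
  exact BT.lift_t _ _ m n

/-- For a left `C`-module `N` and a right `C`-linear map `f : M → C`, the map
`M ⊗_C N → N`, `m ⊗ n ↦ f(m) n`. -/
noncomputable def BT.contrL (ρ : C →ₗ[k] M →ₗ[k] M) (lam : C →ₗ[k] N →ₗ[k] N)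
    (hlam : ∀ c c' n, lam (c * c') n = lam c (lam c' n)) (f : M →ₗ[k] C)
    (hf : ∀ c m, f (ρ c m) = f m * c) : BT ρ lam →ₗ[k] N :=
  BT.lift (LinearMap.mk₂ k (fun m n => lam (f m) n) (by simp) (by simp) (by simp) (by simp)) (by
    intro c m n
    simp [hf, hlam])

@[simp] theorem BT.contrL_t (ρ : C →ₗ[k] M →ₗ[k] M) (lam : C →ₗ[k] N →ₗ[k] N)
    (hlam : ∀ c c' n, lam (c * c') n = lam c (lam c' n)) (f : M →ₗ[k] C)
    (hf : ∀ c m, f (ρ c m) = f m * c) (m : M) (n : N) :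
    BT.contrL ρ lam hlam f hf (BT.t ρ lam m n) = lam (f m) n := by
  exact BT.lift_t _ _ m n

end Actions

section Corings

variable {k A L C D M : Type u} [CommRing k] [Ring A] [Algebra k A] [Ring L] [Algebra k L]
  [AddCommGroup C] [Module k C] [AddCommGroup D] [Module k D] [AddCommGroup M] [Module k M]

variable (k A C) in
/-- An `A`-coring structure on `C`: a comonoid in the monoidal category of `A`-`A` bimodules. -/
structure Coring extends Bimod k A A C where
  comul : C →ₗ[k] BT r l
  comul_l : ∀ a c, comul (l a c) = BT.lact toBimod l a (comul c)
  comul_r : ∀ a c, comul (r a c) = BT.ract r toBimod a (comul c)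
  counit : C →ₗ[k] A
  counit_l : ∀ a c, counit (l a c) = a * counit c
  counit_r : ∀ a c, counit (r a c) = counit c * a
  coassoc : ∀ c, BT.assoc r toBimod l
      (BT.map comul LinearMap.id comul_r (fun _ _ => rfl) (comul c))
    = BT.map LinearMap.id comul (fun _ _ => rfl) comul_l (comul c)
  counit_comul : ∀ c, BT.contrL r l l_mul counit counit_r (comul c) = c
  comul_counit : ∀ c, BT.contrR r l r_mul counit counit_l (comul c) = c

/-- A right comodule structure on `M` over the `A`-coring `𝒞` (including the right `A`-module
structure of `M`). -/
structure RightComodule (𝒞 : Coring k A C) (M : Type u) [AddCommGroup M] [Module k M] where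
  ract : A →ₗ[k] M →ₗ[k] M
  ract_one : ∀ m, ract 1 m = m
  ract_mul : ∀ a a' m, ract (a * a') m = ract a' (ract a m)
  coact : M →ₗ[k] BT ract 𝒞.l
  coact_r : ∀ a m, coact (ract a m) = BT.ract ract 𝒞.toBimod a (coact m)
  coassoc : ∀ m, BT.assoc ract 𝒞.toBimod 𝒞.l
      (BT.map coact LinearMap.id coact_r (fun _ _ => rfl) (coact m))
    = BT.map LinearMap.id 𝒞.comul (fun _ _ => rfl) 𝒞.comul_l (coact m)
  counit : ∀ m, BT.contrR ract 𝒞.l ract_mul 𝒞.counit 𝒞.counit_l (coact m) = m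

/-- The data of a right coring extension: the `L`-coring `𝒟` is a right extension of the `A`-coring
`𝒞` if `𝒞` is a `𝒞`-`𝒟` bicomodule with the left regular `𝒞`-coaction and some right
`𝒟`-coaction. -/
structure RightExtension (𝒞 : Coring k A C) (𝒟 : Coring k L D) extends RightComodule 𝒟 C where
  lr : ∀ a l c, 𝒞.l a (ract l c) = ract l (𝒞.l a c)
  coact_l : ∀ a c, coact (𝒞.l a c)
    = BT.lact ⟨𝒞.l, ract, 𝒞.l_one, 𝒞.l_mul, ract_one, ract_mul, lr⟩ 𝒟.l a (coact c)
  comul_ract : ∀ l c, 𝒞.comul (ract l c)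
    = BT.ract 𝒞.r ⟨𝒞.l, ract, 𝒞.l_one, 𝒞.l_mul, ract_one, ract_mul, lr⟩ l (𝒞.comul c)
  colinear : ∀ c,
    BT.assoc 𝒞.r ⟨𝒞.l, ract, 𝒞.l_one, 𝒞.l_mul, ract_one, ract_mul, lr⟩ 𝒟.l
      (BT.map 𝒞.comul LinearMap.id comul_ract (fun _ _ => rfl) (coact c))
    = BT.map LinearMap.id coact (fun _ _ => rfl) coact_l (𝒞.comul c)

namespace RightExtension

variable {𝒞 : Coring k A C} {𝒟 : Coring k L D}

/-- The `A`-`L` bimodule structure of `𝒞`. -/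
@[reducible] def bimod (E : RightExtension 𝒞 𝒟) : Bimod k A L C :=
  ⟨𝒞.l, E.ract, 𝒞.l_one, 𝒞.l_mul, E.ract_one, E.ract_mul, E.lr⟩

/-- The map `c ↦ ε(c l)`, which is left `A`-linear. -/
noncomputable def counitAct (E : RightExtension 𝒞 𝒟) : L →ₗ[k] C →ₗ[k] A :=
  E.ract.compr₂ 𝒞.counit

theorem counitAct_l (E : RightExtension 𝒞 𝒟) (l : L) (a : A) (c : C) :
    E.counitAct l (𝒞.l a c) = a * E.counitAct l c := by
  simp [counitAct, ← E.lr, 𝒞.counit_l]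

/-- The right `L`-action `m l = m^[0] ε(m^[1] l)` on a right `𝒞`-comodule. -/
noncomputable def indAct (E : RightExtension 𝒞 𝒟) (S : RightComodule 𝒞 M) :
    L →ₗ[k] M →ₗ[k] M where
  toFun l := (BT.contrR S.ract 𝒞.l S.ract_mul (E.counitAct l) (E.counitAct_l l)).comp S.coact
  map_add' l l' := by
    rw [← LinearMap.add_comp]
    congr 1
    exact BT.ext (by simp)
  map_smul' a l := by
    rw [RingHom.id_apply, ← LinearMap.smul_comp]
    congr 1
    exact BT.ext (by simp)

theorem indAct_apply (E : RightExtension 𝒞 𝒟) (S : RightComodule 𝒞 M) (l : L) (m : M) :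
    E.indAct S l m
      = BT.contrR S.ract 𝒞.l S.ract_mul (E.counitAct l) (E.counitAct_l l) (S.coact m) := rfl

theorem contr_comul (E : RightExtension 𝒞 𝒟) (l : L) (c : C) :
    BT.contrR 𝒞.r 𝒞.l 𝒞.r_mul (E.counitAct l) (E.counitAct_l l) (𝒞.comul c) = E.ract l c := by
  rw [← 𝒞.comul_counit (E.ract l c), E.comul_ract]
  generalize 𝒞.comul c = z
  induction z using BT.ind with
  | ht x y =>
    rw [BT.contrR_t, BT.ract_t, BT.contrR_t]
    rfl
  | hadd x y hx hy => rw [map_add, hx, hy, map_add, map_add]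

/-- The `𝒞`-coaction is right `L`-linear. -/
theorem coact_indAct (E : RightExtension 𝒞 𝒟) (S : RightComodule 𝒞 M) (l : L) (m : M) :
    S.coact (E.indAct S l m) = BT.ract S.ract E.bimod l (S.coact m) := by
  have h1 : ∀ z : BT S.ract 𝒞.l,
      S.coact (BT.contrR S.ract 𝒞.l S.ract_mul (E.counitAct l) (E.counitAct_l l) z)
      = BT.map (ρ' := S.ract) (lam' := 𝒞.l) LinearMap.id
          (BT.contrR 𝒞.r 𝒞.l 𝒞.r_mul (E.counitAct l) (E.counitAct_l l))
          (fun _ _ => rfl) (by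
            intro a z
            induction z using BT.ind with
            | ht x y => simp [𝒞.lr]
            | hadd x y hx hy => simp only [map_add, hx, hy])
        (BT.assoc S.ract 𝒞.toBimod 𝒞.l
          (BT.map S.coact LinearMap.id S.coact_r (fun _ _ => rfl) z)) := by
    intro z
    induction z using BT.ind with
    | ht x y =>
      rw [BT.contrR_t, S.coact_r, BT.map_t]
      generalize S.coact x = w
      induction w using BT.ind with
      | ht x c => simp
      | hadd x y hx hy => simp only [map_add, LinearMap.add_apply, hx, hy]
    | hadd x y hx hy => simp only [map_add, hx, hy]
  rw [indAct_apply, h1, S.coassoc]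
  generalize S.coact m = w
  induction w using BT.ind with
  | ht x c => simp [contr_comul]
  | hadd x y hx hy => simp only [map_add, hx, hy]

/-- The map `m ⊗ c ↦ m^[0] ⊗ m^[1] ⊗ c`, that is `ϱ ⊗_A 𝒞`. -/
noncomputable def coactTensor (S : RightComodule 𝒞 M) :
    BT S.ract 𝒞.l →ₗ[k] BT S.ract (BT.lact 𝒞.toBimod 𝒞.l) :=
  (BT.assoc S.ract 𝒞.toBimod 𝒞.l).comp
    (BT.map S.coact LinearMap.id S.coact_r (fun _ _ => rfl))

/-- The map `m ⊗ c ↦ m ⊗ c^(1) ⊗ c^(2)`, that is `M ⊗_A Δ`. -/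
noncomputable def tensorComul (S : RightComodule 𝒞 M) :
    BT S.ract 𝒞.l →ₗ[k] BT S.ract (BT.lact 𝒞.toBimod 𝒞.l) :=
  BT.map LinearMap.id 𝒞.comul (fun _ _ => rfl) 𝒞.comul_l

theorem coactTensor_ract (E : RightExtension 𝒞 𝒟) (S : RightComodule 𝒞 M) (l : L)
    (z : BT S.ract 𝒞.l) :
    coactTensor S (BT.ract S.ract E.bimod l z)
      = BT.ract S.ract (𝒞.toBimod.tensor E.bimod) l (coactTensor S z) := by
  induction z using BT.ind with
  | ht x c =>
    rw [BT.ract_t]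
    simp only [coactTensor, LinearMap.comp_apply, BT.map_t, LinearMap.id_apply]
    generalize S.coact x = w
    induction w using BT.ind with
    | ht x c' =>
      rw [BT.assoc_t, BT.assoc_t, BT.ract_tensor_t, BT.ract_t]
    | hadd x y hx hy => simp only [map_add, LinearMap.add_apply, hx, hy]
  | hadd x y hx hy => simp only [map_add, hx, hy]

theorem tensorComul_ract (E : RightExtension 𝒞 𝒟) (S : RightComodule 𝒞 M) (l : L)
    (z : BT S.ract 𝒞.l) :
    tensorComul S (BT.ract S.ract E.bimod l z)
      = BT.ract S.ract (𝒞.toBimod.tensor E.bimod) l (tensorComul S z) := by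
  induction z using BT.ind with
  | ht x c =>
    rw [BT.ract_t]
    simp only [tensorComul, BT.map_t, LinearMap.id_apply]
    rw [E.comul_ract, BT.ract_tensor_t]
  | hadd x y hx hy => simp only [map_add, hx, hy]

end RightExtension
end Corings

section Cleft

variable {k A L C D M : Type u} [CommRing k] [Ring A] [Algebra k A] [Ring L] [Algebra k L]
  [AddCommGroup C] [Module k C] [AddCommGroup D] [Module k D] [AddCommGroup M] [Module k M]
  {𝒞 : Coring k A C} {𝒟 : Coring k L D}

namespace RightExtension

section Functor

variable {N : Type u} [AddCommGroup N] [Module k N]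

/-- The image of the coaction `ϱ : M → M ⊗_A 𝒞` under the functor `- ⊗_L N`. -/
noncomputable def coactMap (E : RightExtension 𝒞 𝒟) (S : RightComodule 𝒞 M)
    (lam : L →ₗ[k] N →ₗ[k] N) :
    BT (E.indAct S) lam →ₗ[k] BT (BT.ract S.ract E.bimod) lam :=
  BT.map S.coact LinearMap.id (E.coact_indAct S) (fun _ _ => rfl)

/-- The image of `ϱ ⊗_A 𝒞 : M ⊗_A 𝒞 → M ⊗_A 𝒞 ⊗_A 𝒞` under the functor `- ⊗_L N`. -/
noncomputable def coactTensorMap (E : RightExtension 𝒞 𝒟) (S : RightComodule 𝒞 M)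
    (lam : L →ₗ[k] N →ₗ[k] N) :
    BT (BT.ract S.ract E.bimod) lam
      →ₗ[k] BT (BT.ract S.ract (𝒞.toBimod.tensor E.bimod)) lam :=
  BT.map (coactTensor S) LinearMap.id (E.coactTensor_ract S) (fun _ _ => rfl)

/-- The image of `M ⊗_A Δ : M ⊗_A 𝒞 → M ⊗_A 𝒞 ⊗_A 𝒞` under the functor `- ⊗_L N`. -/
noncomputable def tensorComulMap (E : RightExtension 𝒞 𝒟) (S : RightComodule 𝒞 M)
    (lam : L →ₗ[k] N →ₗ[k] N) :
    BT (BT.ract S.ract E.bimod) lam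
      →ₗ[k] BT (BT.ract S.ract (𝒞.toBimod.tensor E.bimod)) lam :=
  BT.map (tensorComul S) LinearMap.id (E.tensorComul_ract S) (fun _ _ => rfl)

end Functor

/-- Purity of the right coring extension `𝒟` of `𝒞`: for every right `𝒞`-comodule `M`, the
equaliser `M → M ⊗_A 𝒞 ⇉ M ⊗_A 𝒞 ⊗_A 𝒞` of right `L`-modules is preserved by the functor
`- ⊗_L 𝒟 ⊗_L 𝒟`. -/
def IsPure (E : RightExtension 𝒞 𝒟) : Prop :=
  ∀ (M : Type u) [AddCommGroup M] [Module k M] (S : RightComodule 𝒞 M),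
    Function.Injective (E.coactMap S (BT.lact 𝒟.toBimod 𝒟.l)) ∧
    ∀ z, E.coactTensorMap S (BT.lact 𝒟.toBimod 𝒟.l) z
        = E.tensorComulMap S (BT.lact 𝒟.toBimod 𝒟.l) z →
      ∃ w, E.coactMap S (BT.lact 𝒟.toBimod 𝒟.l) w = z

section Induced

variable (E : RightExtension 𝒞 𝒟) (S : RightComodule 𝒞 M)

/-- The map `X ⊗_L 𝒟 → X ⊗_L 𝒟 ⊗_L 𝒟` given by the coproduct of `𝒟`. -/
noncomputable def up {X : Type u} [AddCommGroup X] [Module k X] (ρ : L →ₗ[k] X →ₗ[k] X)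
    (𝒟 : Coring k L D) : BT ρ 𝒟.l →ₗ[k] BT ρ (BT.lact 𝒟.toBimod 𝒟.l) :=
  BT.map LinearMap.id 𝒟.comul (fun _ _ => rfl) 𝒟.comul_l

theorem contrL_l (𝒟 : Coring k L D) (l : L) (z : BT 𝒟.r 𝒟.l) :
    BT.contrL 𝒟.r 𝒟.l 𝒟.l_mul 𝒟.counit 𝒟.counit_r (BT.lact 𝒟.toBimod 𝒟.l l z)
      = 𝒟.l l (BT.contrL 𝒟.r 𝒟.l 𝒟.l_mul 𝒟.counit 𝒟.counit_r z) := by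
  induction z using BT.ind with
  | ht x y => simp [𝒟.counit_l, 𝒟.l_mul]
  | hadd x y hx hy => simp only [map_add, hx, hy]

/-- The map `X ⊗_L 𝒟 ⊗_L 𝒟 → X ⊗_L 𝒟` given by the counit of `𝒟`. -/
noncomputable def down {X : Type u} [AddCommGroup X] [Module k X] (ρ : L →ₗ[k] X →ₗ[k] X)
    (𝒟 : Coring k L D) : BT ρ (BT.lact 𝒟.toBimod 𝒟.l) →ₗ[k] BT ρ 𝒟.l :=
  BT.map LinearMap.id (BT.contrL 𝒟.r 𝒟.l 𝒟.l_mul 𝒟.counit 𝒟.counit_r) (fun _ _ => rfl)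
    (contrL_l 𝒟)

theorem down_up {X : Type u} [AddCommGroup X] [Module k X] (ρ : L →ₗ[k] X →ₗ[k] X)
    (𝒟 : Coring k L D) (z : BT ρ 𝒟.l) : down ρ 𝒟 (up ρ 𝒟 z) = z := by
  induction z using BT.ind with
  | ht x y => simp [up, down, 𝒟.counit_comul]
  | hadd x y hx hy => simp only [map_add, hx, hy]

theorem coactMap_up (z : BT (E.indAct S) 𝒟.l) :
    E.coactMap S (BT.lact 𝒟.toBimod 𝒟.l) (up _ 𝒟 z) = up _ 𝒟 (E.coactMap S 𝒟.l z) := by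
  induction z using BT.ind with
  | ht x y => simp [up, coactMap]
  | hadd x y hx hy => simp only [map_add, hx, hy]

theorem coactMap_down (z : BT (E.indAct S) (BT.lact 𝒟.toBimod 𝒟.l)) :
    E.coactMap S 𝒟.l (down _ 𝒟 z)
      = down _ 𝒟 (E.coactMap S (BT.lact 𝒟.toBimod 𝒟.l) z) := by
  induction z using BT.ind with
  | ht x y => simp [down, coactMap]
  | hadd x y hx hy => simp only [map_add, hx, hy]

theorem coactTensorMap_up (z : BT (BT.ract S.ract E.bimod) 𝒟.l) :
    E.coactTensorMap S (BT.lact 𝒟.toBimod 𝒟.l) (up _ 𝒟 z)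
      = up _ 𝒟 (E.coactTensorMap S 𝒟.l z) := by
  induction z using BT.ind with
  | ht x y => simp [up, coactTensorMap]
  | hadd x y hx hy => simp only [map_add, hx, hy]

theorem tensorComulMap_up (z : BT (BT.ract S.ract E.bimod) 𝒟.l) :
    E.tensorComulMap S (BT.lact 𝒟.toBimod 𝒟.l) (up _ 𝒟 z)
      = up _ 𝒟 (E.tensorComulMap S 𝒟.l z) := by
  induction z using BT.ind with
  | ht x y => simp [up, tensorComulMap]
  | hadd x y hx hy => simp only [map_add, hx, hy]

variable {E} in
theorem IsPure.injective (hE : E.IsPure) : Function.Injective (E.coactMap S 𝒟.l) := by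
  intro z w h
  rw [← down_up _ 𝒟 z, ← down_up _ 𝒟 w]
  congr 1
  apply (hE M S).1
  rw [coactMap_up, coactMap_up, h]

variable {E} in
theorem IsPure.exists_of_eq (hE : E.IsPure) (z : BT (BT.ract S.ract E.bimod) 𝒟.l)
    (hz : E.coactTensorMap S 𝒟.l z = E.tensorComulMap S 𝒟.l z) :
    ∃ w, E.coactMap S 𝒟.l w = z := by
  obtain ⟨w, hw⟩ := (hE M S).2 (up _ 𝒟 z) (by rw [coactTensorMap_up, tensorComulMap_up, hz])
  exact ⟨down _ 𝒟 w, by rw [coactMap_down, hw, down_up]⟩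

/-- The map `m ↦ m^[0] ⊗ (m^[1])_[0] ⊗ (m^[1])_[1]`, that is `(M ⊗_A τ_𝒞) ∘ ϱ`. -/
noncomputable def coactCoact : M →ₗ[k] BT (BT.ract S.ract E.bimod) 𝒟.l :=
  (BT.assocInv S.ract E.bimod 𝒟.l).comp
    ((BT.map LinearMap.id E.coact (fun _ _ => rfl) E.coact_l).comp S.coact)

/-- The map `m ⊗ c ⊗ c' ↦ m ⊗ c ⊗ c'_[0] ⊗ c'_[1]`. -/
noncomputable def phi : BT S.ract (BT.lact 𝒞.toBimod 𝒞.l)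
    →ₗ[k] BT (BT.ract S.ract (𝒞.toBimod.tensor E.bimod)) 𝒟.l :=
  (BT.assocInv S.ract (𝒞.toBimod.tensor E.bimod) 𝒟.l).comp
    (BT.map (lam' := BT.lact (𝒞.toBimod.tensor E.bimod) 𝒟.l) LinearMap.id
      ((BT.assocInv 𝒞.r E.bimod 𝒟.l).comp
        (BT.map LinearMap.id E.coact (fun _ _ => rfl) E.coact_l)) (fun _ _ => rfl) (by
          intro a z
          induction z using BT.ind with
          | ht c c' =>
            simp only [BT.lact_t, BT.map_t, LinearMap.comp_apply, LinearMap.id_apply]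
            generalize E.coact c' = w
            induction w using BT.ind with
            | ht x d => rw [BT.assocInv_t, BT.assocInv_t, BT.lact_t, BT.lact_t]
            | hadd x y hx hy => simp only [map_add, hx, hy]
          | hadd x y hx hy => simp only [map_add, hx, hy]))

theorem assoc_t_ract (w : BT S.ract 𝒞.l) (l : L) (c : C) :
    BT.assoc S.ract 𝒞.toBimod 𝒞.l (BT.t _ _ w (E.ract l c))
      = BT.ract S.ract (𝒞.toBimod.tensor E.bimod) l
          (BT.assoc S.ract 𝒞.toBimod 𝒞.l (BT.t _ _ w c)) := by
  induction w using BT.ind with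
  | ht x c' => rw [BT.assoc_t, BT.assoc_t, BT.ract_tensor_t, BT.ract_t]
  | hadd x y hx hy => simp only [map_add, LinearMap.add_apply, hx, hy]

/-- For `w = m ⊗ c`, the map `x ⊗ d ↦ m ⊗ c ⊗ x ⊗ d`. -/
noncomputable def psi (w : BT S.ract 𝒞.l) : BT E.ract 𝒟.l
    →ₗ[k] BT (BT.ract S.ract (𝒞.toBimod.tensor E.bimod)) 𝒟.l :=
  BT.map ((BT.assoc S.ract 𝒞.toBimod 𝒞.l).comp (BT.t _ _ w)) LinearMap.id
    (E.assoc_t_ract S w) (fun _ _ => rfl)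

theorem psi_add (w w' : BT S.ract 𝒞.l) : E.psi S (w + w') = E.psi S w + E.psi S w' :=
  BT.ext (by simp [psi])

theorem phi_assoc (w : BT S.ract 𝒞.l) (c : C) :
    E.phi S (BT.assoc S.ract 𝒞.toBimod 𝒞.l (BT.t _ _ w c)) = E.psi S w (E.coact c) := by
  induction w using BT.ind with
  | ht m' c' =>
    rw [BT.assoc_t]
    simp only [phi, BT.map_t, LinearMap.comp_apply, LinearMap.id_apply]
    generalize E.coact c = v
    induction v using BT.ind with
    | ht x d =>
      rw [psi, BT.map_t, LinearMap.comp_apply, BT.assoc_t]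
      refine (congrArg _ (congrArg _ (BT.assocInv_t 𝒞.r E.bimod 𝒟.l c' x d))).trans ?_
      exact BT.assocInv_t S.ract (𝒞.toBimod.tensor E.bimod) 𝒟.l m' (BT.t _ _ c' x) d
    | hadd x y hx hy => simp only [map_add, hx, hy]
  | hadd x y hx hy => rw [psi_add, LinearMap.add_apply, ← hx, ← hy, map_add, LinearMap.add_apply,
      map_add, map_add]

theorem coactTensorMap_assocInv (z : BT S.ract 𝒞.l) :
    E.coactTensorMap S 𝒟.l (BT.assocInv S.ract E.bimod 𝒟.l
      (BT.map LinearMap.id E.coact (fun _ _ => rfl) E.coact_l z)) = E.phi S (coactTensor S z) := by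
  induction z using BT.ind with
  | ht m c =>
    have h : coactTensor S (BT.t _ _ m c)
        = BT.assoc S.ract 𝒞.toBimod 𝒞.l (BT.t _ _ (S.coact m) c) := by
      simp [coactTensor]
    rw [h, phi_assoc, BT.map_t, LinearMap.id_apply]
    generalize E.coact c = v
    induction v using BT.ind with
    | ht x d =>
      refine (congrArg _ (BT.assocInv_t S.ract E.bimod 𝒟.l m x d)).trans ?_
      rw [coactTensorMap, BT.map_t, psi, BT.map_t]
      simp [coactTensor]
    | hadd x y hx hy => simp only [map_add, hx, hy]
  | hadd x y hx hy => simp only [map_add, hx, hy]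

theorem tensorComulMap_assocInv (z : BT S.ract 𝒞.l) :
    E.tensorComulMap S 𝒟.l (BT.assocInv S.ract E.bimod 𝒟.l
      (BT.map LinearMap.id E.coact (fun _ _ => rfl) E.coact_l z)) = E.phi S (tensorComul S z) := by
  induction z using BT.ind with
  | ht m c =>
    simp only [tensorComul, phi, BT.map_t, LinearMap.comp_apply, LinearMap.id_apply]
    rw [← E.colinear, BT.assocInv_assoc]
    generalize E.coact c = w
    induction w using BT.ind with
    | ht x d =>
      rw [BT.map_t, LinearMap.id_apply]
      refine (congrArg _ (BT.assocInv_t S.ract E.bimod 𝒟.l m x d)).trans ?_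
      rw [tensorComulMap, BT.map_t, tensorComul, BT.map_t]
      exact (BT.assocInv_t S.ract (𝒞.toBimod.tensor E.bimod) 𝒟.l m (𝒞.comul x) d).symm
    | hadd x y hx hy => simp only [map_add, hx, hy]
  | hadd x y hx hy => simp only [map_add, hx, hy]

theorem coactCoact_equalizes (m : M) :
    E.coactTensorMap S 𝒟.l (E.coactCoact S m) = E.tensorComulMap S 𝒟.l (E.coactCoact S m) := by
  simp only [coactCoact, LinearMap.comp_apply]
  rw [coactTensorMap_assocInv, tensorComulMap_assocInv]
  congr 1
  exact S.coassoc m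

variable {E} in
theorem IsPure.existsUnique_coaction (hE : E.IsPure) :
    ∃! τ : M →ₗ[k] BT (E.indAct S) 𝒟.l, ∀ m, E.coactMap S 𝒟.l (τ m) = E.coactCoact S m := by
  choose τ hτ using fun m => hE.exists_of_eq S _ (E.coactCoact_equalizes S m)
  have hinj := hE.injective S
  refine ⟨⟨⟨τ, ?_⟩, ?_⟩, hτ, ?_⟩
  · intro m m'
    apply hinj
    rw [map_add, hτ, hτ, hτ, map_add]
  · intro a m
    apply hinj
    simp only [map_smul, hτ, RingHom.id_apply]
  · intro τ' hτ'
    ext m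
    apply hinj
    rw [hτ']
    exact (hτ m).symm

variable {E} in
/-- The right `𝒟`-coaction `τ_M` on a right `𝒞`-comodule `M` which is induced by a pure right coring
extension `𝒟` of `𝒞` (via `M ≅ M □_𝒞 𝒞`): the unique map `τ_M : M → M ⊗_L 𝒟` such that
`(ϱ ⊗_L 𝒟) ∘ τ_M = (M ⊗_A τ_𝒞) ∘ ϱ`. -/
noncomputable def IsPure.coaction (hE : E.IsPure) : M →ₗ[k] BT (E.indAct S) 𝒟.l :=
  (hE.existsUnique_coaction S).choose

variable {E} in
theorem IsPure.coactMap_coaction (hE : E.IsPure) (m : M) :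
    E.coactMap S 𝒟.l (hE.coaction S m) = E.coactCoact S m :=
  (hE.existsUnique_coaction S).choose_spec.1 m

end Induced

end RightExtension

variable (k L) in
/-- An `L`-`𝒞` bicomodule structure on `M`: a right `𝒞`-comodule with a left `L`-module structure
such that `M` is an `L`-`A` bimodule and the `𝒞`-coaction is left `L`-linear. -/
structure Bicomodule (𝒞 : Coring k A C) (M : Type u) [AddCommGroup M] [Module k M] extends
    RightComodule 𝒞 M where
  lact : L →ₗ[k] M →ₗ[k] M
  lact_one : ∀ m, lact 1 m = m
  lact_mul : ∀ l l' m, lact (l * l') m = lact l (lact l' m)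
  lr : ∀ l a m, lact l (ract a m) = ract a (lact l m)
  coact_lact : ∀ l m, coact (lact l m)
    = BT.lact ⟨lact, ract, lact_one, lact_mul, ract_one, ract_mul, lr⟩ 𝒞.l l (coact m)

namespace Bicomodule

/-- The `k`-module `_L Hom^𝒟(𝒟, M)` of left `L`-linear and right `𝒟`-colinear maps `𝒟 → M`, for an
`L`-`𝒞` bicomodule `M` and a pure right extension `𝒟` of `𝒞`. -/
structure HomD {E : RightExtension 𝒞 𝒟} (hE : E.IsPure) (S : Bicomodule k L 𝒞 M) where
  toFun : D →ₗ[k] M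
  map_l : ∀ l d, toFun (𝒟.l l d) = S.lact l (toFun d)
  map_r : ∀ l d, toFun (𝒟.r l d) = E.indAct S.toRightComodule l (toFun d)
  colinear : ∀ d, hE.coaction S.toRightComodule (toFun d)
    = BT.map toFun LinearMap.id map_r (fun _ _ => rfl) (𝒟.comul d)

/-- The `k`-module `Q̃` of `A`-`L` bilinear maps `q : 𝒞 → Hom_A(M, A)` such that
`c^(1) q(c^(2))(x) = q(c)(x^[0]) x^[1]`. -/
structure Q (E : RightExtension 𝒞 𝒟) (S : Bicomodule k L 𝒞 M) where
  toFun : C →ₗ[k] M →ₗ[k] A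
  apply_r : ∀ c a x, toFun c (S.ract a x) = toFun c x * a
  map_l : ∀ a c x, toFun (𝒞.l a c) x = a * toFun c x
  map_r : ∀ l c x, toFun (E.ract l c) x = toFun c (S.lact l x)
  compat : ∀ c x,
    BT.contrR 𝒞.r 𝒞.l 𝒞.r_mul (toFun.flip x) (fun a c => map_l a c x) (𝒞.comul c)
      = BT.contrL S.ract 𝒞.l 𝒞.l_mul (toFun c) (apply_r c) (S.coact x)

variable {E : RightExtension 𝒞 𝒟} {hE : E.IsPure} {S : Bicomodule k L 𝒞 M}

/-- The map `c ↦ q(c_[0])(p(c_[1]))`. -/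
noncomputable def evalCoact (q : Q E S) (p : HomD hE S) : C →ₗ[k] A :=
  (BT.lift (q.toFun.compl₂ p.toFun) (by
    intro l c d
    simp only [LinearMap.compl₂_apply]
    rw [q.map_r, p.map_l])).comp E.coact

theorem evalCoact_l (q : Q E S) (p : HomD hE S) (a : A) (c : C) :
    evalCoact q p (𝒞.l a c) = a * evalCoact q p c := by
  simp only [evalCoact, LinearMap.comp_apply]
  rw [E.coact_l]
  generalize E.coact c = z
  induction z using BT.ind with
  | ht x d =>
    rw [BT.lact_t, BT.lift_t, BT.lift_t]
    simp only [LinearMap.compl₂_apply]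
    exact q.map_l a x _
  | hadd x y hx hy => simp only [map_add, hx, hy, mul_add]

/-- The connecting map `(q ⧫ p)(c) = c^(1) q((c^(2))_[0])(p((c^(2))_[1]))`. -/
noncomputable def blackDiamond (q : Q E S) (p : HomD hE S) : C →ₗ[k] C :=
  (BT.contrR 𝒞.r 𝒞.l 𝒞.r_mul (evalCoact q p) (evalCoact_l q p)).comp 𝒞.comul

/-- The connecting map `(p ◇ q)(d) = p(d)^[0] q(p(d)^[1])(-)`, an endomorphism of `M` for each
`d`. -/
noncomputable def diamond (p : HomD hE S) (q : Q E S) (d : D) (x : M) : M :=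
  BT.contrR S.ract 𝒞.l S.ract_mul (q.toFun.flip x) (fun a c => q.map_l a c x)
    (S.coact (p.toFun d))

/-- Cleftness of an `L`-`𝒞` bicomodule `M` for the pure right coring extension `E` of `𝒞` by the
`L`-coring `𝒟`: there are `j ∈ _L Hom^𝒟(𝒟, M)` and `j' ∈ Q̃` such that `j' ⧫ j` is the identity map
of `𝒞`, and `j ◇ j'` is `d ↦ ε_𝒟(d) 1_T`, where the unit map of the `L`-ring `T = End^𝒞(M)` sends
`l` to the map `x ↦ l x`. -/
def IsCleft (E : RightExtension 𝒞 𝒟) (S : Bicomodule k L 𝒞 M) : Prop :=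
  ∃ (hE : E.IsPure) (j : HomD hE S) (j' : Q E S),
    (∀ c, blackDiamond j' j c = c) ∧ ∀ d x, diamond j j' d x = S.lact (𝒟.counit d) x

end Bicomodule
end Cleft

section HopfAlgebroids

variable (k L R H : Type u) [CommRing k] [Ring L] [Algebra k L] [Ring R] [Algebra k R]
  [Ring H] [Algebra k H]

/-- A left bialgebroid over `L` with total algebra `H`: source map `s`, target map `t`, and an
`L`-coring structure on `H` for the bimodule structure `l h l' = s(l) t(l') h`, such that the
coproduct `h ↦ h_(1) ⊗ h_(2)` corestricts to a unital algebra map into the Takeuchi product (a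
subspace of `H ⊗_L H` on which factorwise multiplication is well defined), and the counit is a left
character. Equations involving `h_(1) ⊗ h_(2)` are stated for all lifts of this element from
`H ⊗_L H` to `H ⊗ H`. -/
structure LeftBialgebroid where
  s : L →ₐ[k] H
  t : Lᵐᵒᵖ →ₐ[k] H
  s_mul_t : ∀ l l', s l * t (op l') = t (op l') * s l
  coring : Coring k L H
  l_eq : ∀ l h, coring.l l h = s l * h
  r_eq : ∀ l h, coring.r l h = t (op l) * h
  takeuchi : ∀ l h (v : H ⊗[k] H), BT.mk coring.r coring.l v = coring.comul h →
    BT.mk coring.r coring.l (v * (t (op l) ⊗ₜ[k] 1))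
      = BT.mk coring.r coring.l (v * (1 ⊗ₜ[k] s l))
  comul_one : coring.comul 1 = BT.t coring.r coring.l 1 1
  comul_mul : ∀ h h' (v v' : H ⊗[k] H), BT.mk coring.r coring.l v = coring.comul h →
    BT.mk coring.r coring.l v' = coring.comul h' →
    coring.comul (h * h') = BT.mk coring.r coring.l (v * v')
  counit_one : coring.counit 1 = 1
  counit_mul_s : ∀ h h', coring.counit (h * s (coring.counit h')) = coring.counit (h * h')
  counit_mul_t : ∀ h h', coring.counit (h * t (op (coring.counit h'))) = coring.counit (h * h')

/-- A right bialgebroid over `R` with total algebra `H`: source map `s`, target map `t`, and an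
`R`-coring structure on `H` for the bimodule structure `r h r' = h s(r') t(r)`, such that the
coproduct `h ↦ h^(1) ⊗ h^(2)` corestricts to a unital algebra map into the Takeuchi product, and the
counit is a right character. -/
structure RightBialgebroid where
  s : R →ₐ[k] H
  t : Rᵐᵒᵖ →ₐ[k] H
  s_mul_t : ∀ r r', s r * t (op r') = t (op r') * s r
  coring : Coring k R H
  l_eq : ∀ r h, coring.l r h = h * t (op r)
  r_eq : ∀ r h, coring.r r h = h * s r
  takeuchi : ∀ r h (v : H ⊗[k] H), BT.mk coring.r coring.l v = coring.comul h →
    BT.mk coring.r coring.l ((s r ⊗ₜ[k] 1) * v)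
      = BT.mk coring.r coring.l ((1 ⊗ₜ[k] t (op r)) * v)
  comul_one : coring.comul 1 = BT.t coring.r coring.l 1 1
  comul_mul : ∀ h h' (v v' : H ⊗[k] H), BT.mk coring.r coring.l v = coring.comul h →
    BT.mk coring.r coring.l v' = coring.comul h' →
    coring.comul (h * h') = BT.mk coring.r coring.l (v * v')
  counit_one : coring.counit 1 = 1
  counit_s_mul : ∀ h h', coring.counit (s (coring.counit h) * h') = coring.counit (h * h')
  counit_t_mul : ∀ h h', coring.counit (t (op (coring.counit h)) * h') = coring.counit (h * h')

/-- A left and a right bialgebroid on the same total algebra with compatible source and target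
maps. -/
structure BialgebroidPair where
  left : LeftBialgebroid k L H
  right : RightBialgebroid k R H
  sL_tR : ∀ r, left.s (left.coring.counit (right.t (op r))) = right.t (op r)
  tL_sR : ∀ r, left.t (op (left.coring.counit (right.s r))) = right.s r
  sR_tL : ∀ l, right.s (right.coring.counit (left.t (op l))) = left.t (op l)
  tR_sL : ∀ l, right.t (op (right.coring.counit (left.s l))) = left.s l

variable {k L R H}

namespace BialgebroidPair

variable (𝓗 : BialgebroidPair k L R H)

/-- The `L`-`R` bimodule `H`, with actions `l h r = s_L(l) h s_R(r)`. -/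
@[reducible] def bimodLR : Bimod k L R H :=
  ⟨𝓗.left.coring.l, 𝓗.right.coring.r, 𝓗.left.coring.l_one, 𝓗.left.coring.l_mul,
    𝓗.right.coring.r_one, 𝓗.right.coring.r_mul, fun l r h => by
      simp only [𝓗.left.l_eq, 𝓗.right.r_eq, mul_assoc]⟩

/-- The `R`-`L` bimodule `H`, with actions `r h l = t_L(l) h t_R(r)`. -/
@[reducible] def bimodRL : Bimod k R L H :=
  ⟨𝓗.right.coring.l, 𝓗.left.coring.r, 𝓗.right.coring.l_one, 𝓗.right.coring.l_mul,
    𝓗.left.coring.r_one, 𝓗.left.coring.r_mul, fun r l h => by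
      simp only [𝓗.right.l_eq, 𝓗.left.r_eq, mul_assoc]⟩

theorem comulL_s (l : L) (h : H) : ∀ v, BT.mk _ _ v = 𝓗.left.coring.comul h →
    𝓗.left.coring.comul (h * 𝓗.left.s l)
      = BT.mk 𝓗.left.coring.r 𝓗.left.coring.l (v * (𝓗.left.s l ⊗ₜ[k] 1)) := by
  intro v hv
  refine 𝓗.left.comul_mul h _ v _ hv ?_
  have := 𝓗.left.coring.comul_l l 1
  rw [𝓗.left.l_eq, mul_one, 𝓗.left.comul_one, BT.lact_t, 𝓗.left.l_eq, mul_one] at this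
  rw [this]
  rfl

theorem comulL_t (l : L) (h : H) : ∀ v, BT.mk _ _ v = 𝓗.left.coring.comul h →
    𝓗.left.coring.comul (h * 𝓗.left.t (op l))
      = BT.mk 𝓗.left.coring.r 𝓗.left.coring.l (v * (1 ⊗ₜ[k] 𝓗.left.t (op l))) := by
  intro v hv
  refine 𝓗.left.comul_mul h _ v _ hv ?_
  have := 𝓗.left.coring.comul_r l 1
  rw [𝓗.left.r_eq, mul_one, 𝓗.left.comul_one, BT.ract_t, 𝓗.left.r_eq, mul_one] at this
  rw [this]
  rfl

theorem comulR_s (r : R) (h : H) : ∀ v, BT.mk _ _ v = 𝓗.right.coring.comul h →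
    𝓗.right.coring.comul (𝓗.right.s r * h)
      = BT.mk 𝓗.right.coring.r 𝓗.right.coring.l ((1 ⊗ₜ[k] 𝓗.right.s r) * v) := by
  intro v hv
  refine 𝓗.right.comul_mul _ h _ v ?_ hv
  have := 𝓗.right.coring.comul_r r 1
  rw [𝓗.right.r_eq, one_mul, 𝓗.right.comul_one, BT.ract_t, 𝓗.right.r_eq, one_mul] at this
  rw [this]
  rfl

theorem comulR_t (r : R) (h : H) : ∀ v, BT.mk _ _ v = 𝓗.right.coring.comul h →
    𝓗.right.coring.comul (𝓗.right.t (op r) * h)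
      = BT.mk 𝓗.right.coring.r 𝓗.right.coring.l ((𝓗.right.t (op r) ⊗ₜ[k] 1) * v) := by
  intro v hv
  refine 𝓗.right.comul_mul _ h _ v ?_ hv
  have := 𝓗.right.coring.comul_l r 1
  rw [𝓗.right.l_eq, one_mul, 𝓗.right.comul_one, BT.lact_t, 𝓗.right.l_eq, one_mul] at this
  rw [this]
  rfl

/-- The coproduct of the left bialgebroid is left `R`-linear. -/
theorem comulL_l (r : R) (h : H) : 𝓗.left.coring.comul (𝓗.right.coring.l r h)
    = BT.lact 𝓗.bimodRL 𝓗.left.coring.l r (𝓗.left.coring.comul h) := by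
  obtain ⟨v, hv⟩ := BT.mk_surjective _ _ (𝓗.left.coring.comul h)
  rw [𝓗.right.l_eq, ← 𝓗.sL_tR, comulL_s 𝓗 _ _ v hv, ← hv, 𝓗.sL_tR]
  clear hv
  induction v using TensorProduct.induction_on with
  | zero => simp
  | tmul x y =>
    rw [Algebra.TensorProduct.tmul_mul_tmul, mul_one, BT.mk_tmul, BT.mk_tmul]
    refine ((BT.lact_t 𝓗.bimodRL _ r x y).trans ?_).symm
    rw [𝓗.right.l_eq]
  | add x y hx hy => rw [add_mul, map_add, map_add, map_add, hx, hy]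

/-- The coproduct of the left bialgebroid is right `R`-linear. -/
theorem comulL_r (r : R) (h : H) : 𝓗.left.coring.comul (𝓗.right.coring.r r h)
    = BT.ract 𝓗.left.coring.r 𝓗.bimodLR r (𝓗.left.coring.comul h) := by
  obtain ⟨v, hv⟩ := BT.mk_surjective _ _ (𝓗.left.coring.comul h)
  rw [𝓗.right.r_eq, ← 𝓗.tL_sR, comulL_t 𝓗 _ _ v hv, ← hv, 𝓗.tL_sR]
  clear hv
  induction v using TensorProduct.induction_on with
  | zero => simp
  | tmul x y =>
    rw [Algebra.TensorProduct.tmul_mul_tmul, mul_one, BT.mk_tmul, BT.mk_tmul]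
    refine ((BT.ract_t _ 𝓗.bimodLR r x y).trans ?_).symm
    rw [𝓗.right.r_eq]
  | add x y hx hy => rw [add_mul, map_add, map_add, map_add, hx, hy]

/-- The coproduct of the right bialgebroid is left `L`-linear. -/
theorem comulR_l (l : L) (h : H) : 𝓗.right.coring.comul (𝓗.left.coring.l l h)
    = BT.lact 𝓗.bimodLR 𝓗.right.coring.l l (𝓗.right.coring.comul h) := by
  obtain ⟨v, hv⟩ := BT.mk_surjective _ _ (𝓗.right.coring.comul h)
  rw [𝓗.left.l_eq, ← 𝓗.tR_sL, comulR_t 𝓗 _ _ v hv, ← hv, 𝓗.tR_sL]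
  clear hv
  induction v using TensorProduct.induction_on with
  | zero => simp
  | tmul x y =>
    rw [Algebra.TensorProduct.tmul_mul_tmul, one_mul, BT.mk_tmul, BT.mk_tmul]
    refine ((BT.lact_t 𝓗.bimodLR _ l x y).trans ?_).symm
    rw [𝓗.left.l_eq]
  | add x y hx hy => rw [mul_add, map_add, map_add, map_add, hx, hy]

/-- The coproduct of the right bialgebroid is right `L`-linear. -/
theorem comulR_r (l : L) (h : H) : 𝓗.right.coring.comul (𝓗.left.coring.r l h)
    = BT.ract 𝓗.right.coring.r 𝓗.bimodRL l (𝓗.right.coring.comul h) := by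
  obtain ⟨v, hv⟩ := BT.mk_surjective _ _ (𝓗.right.coring.comul h)
  rw [𝓗.left.r_eq, ← 𝓗.sR_tL, comulR_s 𝓗 _ _ v hv, ← hv, 𝓗.sR_tL]
  clear hv
  induction v using TensorProduct.induction_on with
  | zero => simp
  | tmul x y =>
    rw [Algebra.TensorProduct.tmul_mul_tmul, one_mul, BT.mk_tmul, BT.mk_tmul]
    refine ((BT.ract_t _ 𝓗.bimodRL l x y).trans ?_).symm
    rw [𝓗.left.r_eq]
  | add x y hx hy => rw [mul_add, map_add, map_add, map_add, hx, hy]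

end BialgebroidPair

variable (k L R H) in
/-- A Hopf algebroid: a left bialgebroid over `L` and a right bialgebroid over `R` on the same total
algebra `H`, with compatible source and target maps, coproducts `γ_L`, `γ_R` satisfying
`(γ_L ⊗_R H) γ_R = (H ⊗_L γ_R) γ_L` and `(γ_R ⊗_L H) γ_L = (H ⊗_R γ_L) γ_R`, and an antipode. -/
structure HopfAlgebroid extends BialgebroidPair k L R H where
  coassoc_LR : ∀ h,
    BT.assoc left.coring.r toBialgebroidPair.bimodLR right.coring.l
      (BT.map left.coring.comul LinearMap.id toBialgebroidPair.comulL_r (fun _ _ => rfl)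
        (right.coring.comul h))
    = BT.map LinearMap.id right.coring.comul (fun _ _ => rfl) toBialgebroidPair.comulR_l
        (left.coring.comul h)
  coassoc_RL : ∀ h,
    BT.assoc right.coring.r toBialgebroidPair.bimodRL left.coring.l
      (BT.map right.coring.comul LinearMap.id toBialgebroidPair.comulR_r (fun _ _ => rfl)
        (left.coring.comul h))
    = BT.map LinearMap.id left.coring.comul (fun _ _ => rfl) toBialgebroidPair.comulL_l
        (right.coring.comul h)
  antipode : H →ₗ[k] H
  antipode_bilinear : ∀ l r h, antipode (left.t (op l) * h * right.t (op r))
    = right.s r * antipode h * left.s l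
  antipode_mul_id : ∀ h (v : H ⊗[k] H),
    BT.mk left.coring.r left.coring.l v = left.coring.comul h →
    LinearMap.mul' k H (TensorProduct.map antipode LinearMap.id v) = right.s (right.coring.counit h)
  id_mul_antipode : ∀ h (v : H ⊗[k] H),
    BT.mk right.coring.r right.coring.l v = right.coring.comul h →
    LinearMap.mul' k H (TensorProduct.map LinearMap.id antipode v) = left.s (left.coring.counit h)

namespace HopfAlgebroid

variable (𝓗 : HopfAlgebroid k L R H)

/-- The `L`-coring underlying the left bialgebroid is a right extension of the `R`-coring underlying
the right bialgebroid, via the coproduct of the left bialgebroid. -/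
@[reducible] def extensionL : RightExtension 𝓗.right.coring 𝓗.left.coring where
  ract := 𝓗.left.coring.r
  ract_one := 𝓗.left.coring.r_one
  ract_mul := 𝓗.left.coring.r_mul
  coact := 𝓗.left.coring.comul
  coact_r := 𝓗.left.coring.comul_r
  coassoc := 𝓗.left.coring.coassoc
  counit := 𝓗.left.coring.comul_counit
  lr := 𝓗.bimodRL.lr
  coact_l := 𝓗.comulL_l
  comul_ract := 𝓗.comulR_r
  colinear := 𝓗.coassoc_RL

/-- The `R`-coring underlying the right bialgebroid is a right extension of the `L`-coring underlying
the left bialgebroid, via the coproduct of the right bialgebroid. -/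
@[reducible] def extensionR : RightExtension 𝓗.left.coring 𝓗.right.coring where
  ract := 𝓗.right.coring.r
  ract_one := 𝓗.right.coring.r_one
  ract_mul := 𝓗.right.coring.r_mul
  coact := 𝓗.right.coring.comul
  coact_r := 𝓗.right.coring.comul_r
  coassoc := 𝓗.right.coring.coassoc
  counit := 𝓗.right.coring.comul_counit
  lr := 𝓗.bimodLR.lr
  coact_l := 𝓗.comulR_l
  comul_ract := 𝓗.comulL_r
  colinear := 𝓗.coassoc_LR

/-- A Hopf algebroid is pure if both of these coring extensions are pure. -/
def IsPure : Prop := 𝓗.extensionL.IsPure ∧ 𝓗.extensionR.IsPure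

end HopfAlgebroid

end HopfAlgebroids

section ComoduleAlgebras

variable {k L R H A : Type u} [CommRing k] [Ring L] [Algebra k L] [Ring R] [Algebra k R]
  [Ring H] [Algebra k H] [Ring A] [Algebra k A]

/-- A right comodule algebra `A` over a right bialgebroid: an `R`-ring `A` with unit map `η`, which
is a right comodule over the underlying `R`-coring, such that the coaction
`a ↦ a^[0] ⊗ a^[1]` corestricts to a unital algebra map into the Takeuchi product in `A ⊗_R H`. -/
structure ComoduleAlgebra (𝓑 : RightBialgebroid k R H) (A : Type u) [Ring A] [Algebra k A] where
  η : R →ₐ[k] A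
  comodule : RightComodule 𝓑.coring A
  ract_eq : ∀ r a, comodule.ract r a = a * η r
  takeuchi : ∀ r a (v : A ⊗[k] H), BT.mk comodule.ract 𝓑.coring.l v = comodule.coact a →
    BT.mk comodule.ract 𝓑.coring.l ((η r ⊗ₜ[k] 1) * v)
      = BT.mk comodule.ract 𝓑.coring.l ((1 ⊗ₜ[k] 𝓑.t (op r)) * v)
  coact_one : comodule.coact 1 = BT.t comodule.ract 𝓑.coring.l 1 1
  coact_mul : ∀ a a' (v v' : A ⊗[k] H),
    BT.mk comodule.ract 𝓑.coring.l v = comodule.coact a →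
    BT.mk comodule.ract 𝓑.coring.l v' = comodule.coact a' →
    comodule.coact (a * a') = BT.mk comodule.ract 𝓑.coring.l (v * v')

namespace ComoduleAlgebra

variable {𝓑 : RightBialgebroid k R H} (𝓐 : ComoduleAlgebra 𝓑 A)

/-- The balanced tensor product `A ⊗_R H`. -/
abbrev AH : Type u := BT 𝓐.comodule.ract 𝓑.coring.l

/-- The map `b ⊗ y ↦ a b ⊗ h y`. -/
noncomputable def mulAH : A →ₗ[k] H →ₗ[k] 𝓐.AH →ₗ[k] 𝓐.AH :=
  LinearMap.mk₂ k
    (fun a h => BT.map (LinearMap.mulLeft k a) (LinearMap.mulLeft k h)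
      (fun r b => by simp [𝓐.ract_eq, mul_assoc]) (fun r y => by simp [𝓑.l_eq, mul_assoc]))
    (fun a a' h => BT.ext (by simp [add_mul]))
    (fun x a h => BT.ext (by simp))
    (fun a h h' => BT.ext (by simp [add_mul]))
    (fun x a h => BT.ext (by simp))

theorem mulAH_t (a b : A) (h y : H) : 𝓐.mulAH a h (BT.t _ _ b y) = BT.t _ _ (a * b) (h * y) := by
  simp [mulAH]

theorem mulAH_mk (a : A) (h : H) (v : A ⊗[k] H) :
    𝓐.mulAH a h (BT.mk _ _ v) = BT.mk _ _ ((a ⊗ₜ[k] h) * v) := by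
  induction v using TensorProduct.induction_on with
  | zero => simp
  | tmul b y => rw [BT.mk_tmul, mulAH_t, Algebra.TensorProduct.tmul_mul_tmul, BT.mk_tmul]
  | add x y hx hy => rw [map_add, map_add, hx, hy, mul_add, map_add]

theorem mulAH_bal (r : R) (a : A) (h : H) (b : A) :
    𝓐.mulAH (𝓐.comodule.ract r a) h (𝓐.comodule.coact b)
      = 𝓐.mulAH a (𝓑.coring.l r h) (𝓐.comodule.coact b) := by
  obtain ⟨v, hv⟩ := BT.mk_surjective _ _ (𝓐.comodule.coact b)
  have h1 : 𝓐.comodule.ract r a ⊗ₜ[k] h = (a ⊗ₜ[k] h) * (𝓐.η r ⊗ₜ[k] 1) := by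
    rw [Algebra.TensorProduct.tmul_mul_tmul, mul_one, 𝓐.ract_eq]
  have h2 : a ⊗ₜ[k] 𝓑.coring.l r h = (a ⊗ₜ[k] h) * (1 ⊗ₜ[k] 𝓑.t (op r)) := by
    rw [Algebra.TensorProduct.tmul_mul_tmul, mul_one, 𝓑.l_eq]
  rw [← hv, mulAH_mk, mulAH_mk, h1, h2, mul_assoc, mul_assoc, ← mulAH_mk,
    𝓐.takeuchi r b v hv, mulAH_mk]

/-- The right `A`-action `(b ⊗ h) a = b a^[0] ⊗ h a^[1]` on `A ⊗_R H`. -/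
noncomputable def ractAH : A →ₗ[k] 𝓐.AH →ₗ[k] 𝓐.AH where
  toFun a := BT.lift (LinearMap.mk₂ k (fun b h => 𝓐.mulAH b h (𝓐.comodule.coact a))
      (by simp) (by simp) (by simp) (by simp)) (by
    intro r b h
    simp only [LinearMap.mk₂_apply]
    exact 𝓐.mulAH_bal r b h a)
  map_add' a a' := BT.ext (by simp)
  map_smul' x a := BT.ext (by simp)

theorem ractAH_t (a b : A) (h : H) :
    𝓐.ractAH a (BT.t _ _ b h) = 𝓐.mulAH b h (𝓐.comodule.coact a) := by
  simp [ractAH]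

theorem ractAH_mk (a : A) (v w : A ⊗[k] H) (hv : BT.mk _ _ v = 𝓐.comodule.coact a) :
    𝓐.ractAH a (BT.mk _ _ w) = BT.mk _ _ (w * v) := by
  induction w using TensorProduct.induction_on with
  | zero => simp
  | tmul b y => rw [BT.mk_tmul, ractAH_t, ← hv, mulAH_mk]
  | add x y hx hy => rw [map_add, map_add, hx, hy, add_mul, map_add]

theorem coact_mul' (a a' : A) : 𝓐.comodule.coact (a * a') = 𝓐.ractAH a' (𝓐.comodule.coact a) := by
  obtain ⟨v, hv⟩ := BT.mk_surjective _ _ (𝓐.comodule.coact a)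
  obtain ⟨v', hv'⟩ := BT.mk_surjective _ _ (𝓐.comodule.coact a')
  rw [𝓐.coact_mul a a' v v' hv hv', ← hv, 𝓐.ractAH_mk a' v' v hv']

/-- The `A`-`A` bimodule structure of `A ⊗_R H`. -/
noncomputable def bimodAH : Bimod k A A 𝓐.AH where
  l := 𝓐.mulAH.flip 1
  r := 𝓐.ractAH
  l_one z := by
    induction z using BT.ind with
    | ht b h => simp [mulAH_t]
    | hadd x y hx hy => rw [map_add, hx, hy]
  l_mul a a' z := by
    induction z using BT.ind with
    | ht b h => simp [mulAH_t, mul_assoc]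
    | hadd x y hx hy => rw [map_add, hx, hy, map_add, map_add]
  r_one z := by
    obtain ⟨w, rfl⟩ := BT.mk_surjective _ _ z
    rw [𝓐.ractAH_mk 1 1 w 𝓐.coact_one.symm, mul_one]
  r_mul a a' z := by
    obtain ⟨w, rfl⟩ := BT.mk_surjective _ _ z
    obtain ⟨v, hv⟩ := BT.mk_surjective _ _ (𝓐.comodule.coact a)
    obtain ⟨v', hv'⟩ := BT.mk_surjective _ _ (𝓐.comodule.coact a')
    rw [𝓐.ractAH_mk a v w hv, 𝓐.ractAH_mk a' v' _ hv',
      𝓐.ractAH_mk (a * a') (v * v') w (𝓐.coact_mul a a' v v' hv hv').symm, mul_assoc]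
  lr a a' z := by
    obtain ⟨w, rfl⟩ := BT.mk_surjective _ _ z
    obtain ⟨v, hv⟩ := BT.mk_surjective _ _ (𝓐.comodule.coact a')
    simp only [LinearMap.flip_apply]
    rw [𝓐.ractAH_mk a' v w hv, 𝓐.mulAH_mk, 𝓐.mulAH_mk, 𝓐.ractAH_mk a' v _ hv, mul_assoc]

theorem bimodAH_l_t (a b : A) (h : H) :
    𝓐.bimodAH.l a (BT.t _ _ b h) = BT.t _ _ (a * b) h := by
  change 𝓐.mulAH a 1 _ = _
  rw [mulAH_t, one_mul]

theorem coact_η (r : R) : 𝓐.comodule.coact (𝓐.η r) = BT.t _ _ 1 (𝓑.s r) := by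
  have := 𝓐.comodule.coact_r r 1
  rw [𝓐.ract_eq, one_mul, 𝓐.coact_one, BT.ract_t, 𝓑.r_eq, one_mul] at this
  exact this

theorem bimodAH_r_η (r : R) (b : A) (h : H) :
    𝓐.bimodAH.r (𝓐.η r) (BT.t _ _ b h) = BT.t _ _ b (𝓑.coring.r r h) := by
  change 𝓐.ractAH _ _ = _
  rw [ractAH_t, coact_η, mulAH_t, mul_one, 𝓑.r_eq]

theorem tens_bal (b : A) (r : R) (h y : H) :
    BT.t 𝓐.bimodAH.r 𝓐.bimodAH.l (BT.t _ _ b (𝓑.coring.r r h)) (BT.t _ _ 1 y)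
      = BT.t 𝓐.bimodAH.r 𝓐.bimodAH.l (BT.t _ _ b h) (BT.t _ _ 1 (𝓑.coring.l r y)) := by
  rw [← bimodAH_r_η, BT.t_bal, bimodAH_l_t, mul_one, ← BT.t_bal, 𝓐.ract_eq, one_mul]

/-- The map `y ⊗ y' ↦ (a ⊗ y) ⊗ (1 ⊗ y')`. -/
noncomputable def kappaAux (a : A) :
    BT 𝓑.coring.r 𝓑.coring.l →ₗ[k] BT 𝓐.bimodAH.r 𝓐.bimodAH.l :=
  BT.lift ((BT.t 𝓐.bimodAH.r 𝓐.bimodAH.l).compl₁₂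
    (BT.t 𝓐.comodule.ract 𝓑.coring.l a) (BT.t 𝓐.comodule.ract 𝓑.coring.l 1))
    (by
      intro r h y
      simp only [LinearMap.compl₁₂_apply]
      exact 𝓐.tens_bal a r h y)

theorem kappaAux_t (a : A) (y y' : H) : 𝓐.kappaAux a (BT.t _ _ y y')
    = BT.t 𝓐.bimodAH.r 𝓐.bimodAH.l (BT.t _ _ a y) (BT.t _ _ 1 y') := by
  exact BT.lift_t _ _ y y'

/-- The map `A ⊗_R H ⊗_R H → (A ⊗_R H) ⊗_A (A ⊗_R H)`, `a ⊗ y ⊗ y' ↦ (a ⊗ y) ⊗ (1 ⊗ y')`. -/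
noncomputable def kappa : BT 𝓐.comodule.ract (BT.lact 𝓑.coring.toBimod 𝓑.coring.l)
    →ₗ[k] BT 𝓐.bimodAH.r 𝓐.bimodAH.l :=
  BT.lift
    { toFun := 𝓐.kappaAux
      map_add' := fun a a' => BT.ext (by simp [kappaAux_t])
      map_smul' := fun x a => BT.ext (by simp [kappaAux_t]) }
    (by
      intro r a z
      simp only [LinearMap.coe_mk, AddHom.coe_mk]
      induction z using BT.ind with
      | ht y y' => rw [BT.lact_t, kappaAux_t, kappaAux_t, BT.t_bal]
      | hadd x y hx hy => rw [map_add, hx, hy, map_add, map_add])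

theorem kappa_t (a : A) (z : BT 𝓑.coring.r 𝓑.coring.l) :
    𝓐.kappa (BT.t _ _ a z) = 𝓐.kappaAux a z := by
  exact BT.lift_t _ _ a z

/-- The coproduct `a ⊗ h ↦ (a ⊗ h^(1)) ⊗ (1 ⊗ h^(2))` of `A ⊗_R H`. -/
noncomputable def comulAH : 𝓐.AH →ₗ[k] BT 𝓐.bimodAH.r 𝓐.bimodAH.l :=
  𝓐.kappa.comp (BT.map LinearMap.id 𝓑.coring.comul (fun _ _ => rfl) 𝓑.coring.comul_l)

theorem comulAH_t (a : A) (h : H) :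
    𝓐.comulAH (BT.t _ _ a h) = 𝓐.kappaAux a (𝓑.coring.comul h) := by
  rw [comulAH, LinearMap.comp_apply, BT.map_t, kappa_t]; rfl

/-- The counit `a ⊗ h ↦ a η(π_R(h))` of `A ⊗_R H`. -/
noncomputable def counitAH : 𝓐.AH →ₗ[k] A :=
  BT.contrR 𝓐.comodule.ract 𝓑.coring.l 𝓐.comodule.ract_mul 𝓑.coring.counit 𝓑.coring.counit_l

theorem counitAH_t (a : A) (h : H) :
    𝓐.counitAH (BT.t _ _ a h) = a * 𝓐.η (𝓑.coring.counit h) := by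
  rw [counitAH, BT.contrR_t, 𝓐.ract_eq]

theorem comulAH_l (a : A) (z : 𝓐.AH) :
    𝓐.comulAH (𝓐.bimodAH.l a z) = BT.lact 𝓐.bimodAH 𝓐.bimodAH.l a (𝓐.comulAH z) := by
  induction z using BT.ind with
  | ht b h =>
    rw [bimodAH_l_t, comulAH_t, comulAH_t]
    generalize 𝓑.coring.comul h = w
    induction w using BT.ind with
    | ht y y' => rw [kappaAux_t, kappaAux_t, BT.lact_t, bimodAH_l_t]
    | hadd x y hx hy => simp only [map_add, hx, hy]
  | hadd x y hx hy => simp only [map_add, hx, hy]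

/-- The map `x ⊗ x' ↦ y x ⊗ y' x'`. -/
noncomputable def mulHH (𝓑 : RightBialgebroid k R H) : H →ₗ[k] H →ₗ[k]
    BT 𝓑.coring.r 𝓑.coring.l →ₗ[k] BT 𝓑.coring.r 𝓑.coring.l :=
  LinearMap.mk₂ k
    (fun y y' => BT.map (LinearMap.mulLeft k y) (LinearMap.mulLeft k y')
      (fun r x => by simp [𝓑.r_eq, mul_assoc]) (fun r x => by simp [𝓑.l_eq, mul_assoc]))
    (fun a a' h => BT.ext (by simp [add_mul]))
    (fun x a h => BT.ext (by simp))
    (fun a h h' => BT.ext (by simp [add_mul]))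
    (fun x a h => BT.ext (by simp))

theorem mulHH_t (y y' x x' : H) :
    mulHH 𝓑 y y' (BT.t _ _ x x') = BT.t _ _ (y * x) (y' * x') := by
  simp [mulHH]

theorem mulHH_mk (y y' : H) (v : H ⊗[k] H) :
    mulHH 𝓑 y y' (BT.mk _ _ v) = BT.mk _ _ ((y ⊗ₜ[k] y') * v) := by
  induction v using TensorProduct.induction_on with
  | zero => simp
  | tmul b y => rw [BT.mk_tmul, mulHH_t, Algebra.TensorProduct.tmul_mul_tmul, BT.mk_tmul]
  | add x y hx hy => rw [map_add, map_add, hx, hy, mul_add, map_add]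

theorem mulHH_l (y y' : H) (r : R) (z : BT 𝓑.coring.r 𝓑.coring.l) :
    mulHH 𝓑 y y' (BT.lact 𝓑.coring.toBimod 𝓑.coring.l r z)
      = BT.lact 𝓑.coring.toBimod 𝓑.coring.l r (mulHH 𝓑 y y' z) := by
  induction z using BT.ind with
  | ht x x' => simp [mulHH_t, 𝓑.l_eq, mul_assoc]
  | hadd x y hx hy => simp only [map_add, hx, hy]

/-- The map `x ⊗ z ↦ b x ⊗ (y ⊗ y') z`. -/
noncomputable def mulAHH (b : A) (y y' : H) :
    BT 𝓐.comodule.ract (BT.lact 𝓑.coring.toBimod 𝓑.coring.l)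
      →ₗ[k] BT 𝓐.comodule.ract (BT.lact 𝓑.coring.toBimod 𝓑.coring.l) :=
  BT.map (LinearMap.mulLeft k b) (mulHH 𝓑 y y')
    (fun r x => by simp [𝓐.ract_eq, mul_assoc]) (fun r z => mulHH_l y y' r z)

theorem mulAHH_t (b x : A) (y y' : H) (z : BT 𝓑.coring.r 𝓑.coring.l) :
    𝓐.mulAHH b y y' (BT.t _ _ x z) = BT.t _ _ (b * x) (mulHH 𝓑 y y' z) := by
  simp [mulAHH]

/-- The map `mulAHH` as a linear map on `H ⊗ H`. -/
noncomputable def mulAHHL (b : A) : H ⊗[k] H →ₗ[k]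
    BT 𝓐.comodule.ract (BT.lact 𝓑.coring.toBimod 𝓑.coring.l)
      →ₗ[k] BT 𝓐.comodule.ract (BT.lact 𝓑.coring.toBimod 𝓑.coring.l) :=
  TensorProduct.lift (LinearMap.mk₂ k (𝓐.mulAHH b)
    (fun y y' h => BT.ext (by simp [mulAHH_t]))
    (fun c y h => BT.ext (by simp [mulAHH_t]))
    (fun y h h' => BT.ext (by simp [mulAHH_t]))
    (fun c y h => BT.ext (by simp [mulAHH_t])))

theorem mulAHHL_tmul (b : A) (y y' : H) : 𝓐.mulAHHL b (y ⊗ₜ[k] y') = 𝓐.mulAHH b y y' := by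
  simp [mulAHHL]

theorem mulAHHL_t (b x : A) (g v : H ⊗[k] H) :
    𝓐.mulAHHL b g (BT.t _ _ x (BT.mk _ _ v)) = BT.t _ _ (b * x) (BT.mk _ _ (g * v)) := by
  induction g using TensorProduct.induction_on with
  | zero => simp
  | tmul y y' => rw [mulAHHL_tmul, mulAHH_t, mulHH_mk]
  | add g g' h h' => rw [map_add, LinearMap.add_apply, h, h', add_mul, map_add, map_add]

theorem map_comul_mulAH (b : A) (h : H) (g : H ⊗[k] H)
    (hg : BT.mk _ _ g = 𝓑.coring.comul h) (w : 𝓐.AH) :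
    BT.map LinearMap.id 𝓑.coring.comul (fun _ _ => rfl) 𝓑.coring.comul_l (𝓐.mulAH b h w)
      = 𝓐.mulAHHL b g
        (BT.map LinearMap.id 𝓑.coring.comul (fun _ _ => rfl) 𝓑.coring.comul_l w) := by
  induction w using BT.ind with
  | ht x y =>
    obtain ⟨v, hv⟩ := BT.mk_surjective _ _ (𝓑.coring.comul y)
    rw [mulAH_t, BT.map_t, BT.map_t, ← hv, 𝓑.comul_mul h y g v hg hv, LinearMap.id_apply,
      LinearMap.id_apply, mulAHHL_t]
  | hadd x y hx hy => simp only [map_add, hx, hy]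

theorem mulAHH_assoc (b : A) (h h' : H) (z : 𝓐.AH) (y' : H) :
    𝓐.mulAHH b h h' (BT.assoc _ 𝓑.coring.toBimod 𝓑.coring.l (BT.t _ _ z y'))
      = BT.assoc _ 𝓑.coring.toBimod 𝓑.coring.l (BT.t _ _ (𝓐.mulAH b h z) (h' * y')) := by
  induction z using BT.ind with
  | ht x y => rw [BT.assoc_t, mulAHH_t, mulHH_t, mulAH_t, BT.assoc_t]
  | hadd x y hx hy => simp only [map_add, LinearMap.add_apply, hx, hy]

theorem kappa_assoc (z : 𝓐.AH) (y : H) :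
    𝓐.kappa (BT.assoc _ 𝓑.coring.toBimod 𝓑.coring.l (BT.t _ _ z y))
      = BT.t 𝓐.bimodAH.r 𝓐.bimodAH.l z (BT.t _ _ 1 y) := by
  induction z using BT.ind with
  | ht a x => rw [BT.assoc_t, kappa_t, kappaAux_t]
  | hadd x y hx hy => simp only [map_add, LinearMap.add_apply, hx, hy]

theorem ract_kappa (a b : A) (h h' : H) :
    BT.t 𝓐.bimodAH.r 𝓐.bimodAH.l (BT.t _ _ b h) (𝓐.bimodAH.r a (BT.t _ _ 1 h'))
      = 𝓐.kappa (𝓐.mulAHH b h h'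
        (BT.map LinearMap.id 𝓑.coring.comul (fun _ _ => rfl) 𝓑.coring.comul_l
          (𝓐.comodule.coact a))) := by
  have h1 : 𝓐.bimodAH.r a (BT.t _ _ 1 h') = 𝓐.mulAH 1 h' (𝓐.comodule.coact a) :=
    𝓐.ractAH_t a 1 h'
  rw [h1, ← 𝓐.comodule.coassoc]
  generalize 𝓐.comodule.coact a = w
  induction w using BT.ind with
  | ht x y =>
    rw [mulAH_t, one_mul, BT.map_t, LinearMap.id_apply, mulAHH_assoc, kappa_assoc]
    have h2 : BT.t 𝓐.comodule.ract 𝓑.coring.l x (h' * y)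
        = 𝓐.bimodAH.l x (BT.t _ _ 1 (h' * y)) := by rw [bimodAH_l_t, mul_one]
    rw [h2, ← BT.t_bal]
    congr 2
  | hadd x y hx hy => simp only [map_add, hx, hy]

theorem comulAH_r (a : A) (z : 𝓐.AH) :
    𝓐.comulAH (𝓐.bimodAH.r a z) = BT.ract 𝓐.bimodAH.r 𝓐.bimodAH a (𝓐.comulAH z) := by
  induction z using BT.ind with
  | ht b h =>
    have h1 : 𝓐.bimodAH.r a (BT.t _ _ b h) = 𝓐.mulAH b h (𝓐.comodule.coact a) :=
      𝓐.ractAH_t a b h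
    obtain ⟨g, hg⟩ := BT.mk_surjective _ _ (𝓑.coring.comul h)
    rw [h1, comulAH_t, comulAH, LinearMap.comp_apply, map_comul_mulAH 𝓐 b h g hg, ← hg]
    clear hg
    induction g using TensorProduct.induction_on with
    | zero => simp
    | tmul y y' => rw [BT.mk_tmul, kappaAux_t, BT.ract_t, ract_kappa, mulAHHL_tmul]
    | add x y hx hy => simp only [map_add, LinearMap.add_apply, hx, hy]
  | hadd x y hx hy => simp only [map_add, hx, hy]

theorem counitAH_l (a : A) (z : 𝓐.AH) : 𝓐.counitAH (𝓐.bimodAH.l a z) = a * 𝓐.counitAH z := by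
  induction z using BT.ind with
  | ht b h => rw [bimodAH_l_t, counitAH_t, counitAH_t, mul_assoc]
  | hadd x y hx hy => rw [map_add, map_add, hx, hy, map_add, mul_add]

theorem counitAH_mulAH (b : A) (h : H) (z : 𝓐.AH) :
    𝓐.counitAH (𝓐.mulAH b h z)
      = b * 𝓐.counitAH (𝓐.mulAH 1 (𝓑.s (𝓑.coring.counit h)) z) := by
  induction z using BT.ind with
  | ht x y =>
    rw [mulAH_t, mulAH_t, counitAH_t, counitAH_t, one_mul, 𝓑.counit_s_mul, mul_assoc]
  | hadd x y hx hy => simp only [map_add, hx, hy, mul_add]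

theorem counitAH_coact (a : A) : 𝓐.counitAH (𝓐.comodule.coact a) = a := 𝓐.comodule.counit a

theorem counitAH_r (a : A) (z : 𝓐.AH) : 𝓐.counitAH (𝓐.bimodAH.r a z) = 𝓐.counitAH z * a := by
  induction z using BT.ind with
  | ht b h =>
    have h1 : 𝓐.bimodAH.r a (BT.t _ _ b h) = 𝓐.mulAH b h (𝓐.comodule.coact a) :=
      𝓐.ractAH_t a b h
    have h2 : 𝓐.comodule.coact (𝓐.η (𝓑.coring.counit h) * a)
        = 𝓐.mulAH 1 (𝓑.s (𝓑.coring.counit h)) (𝓐.comodule.coact a) := by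
      rw [coact_mul', coact_η, ractAH_t]
    rw [h1, counitAH_mulAH, ← h2, counitAH_coact, counitAH_t, mul_assoc]
  | hadd x y hx hy => rw [map_add, map_add, hx, hy, map_add, add_mul]

/-- The map `x ⊗ z ↦ (a ⊗ x) ⊗ kappa(1 ⊗ z)`. -/
noncomputable def kappa3 (a : A) : BT 𝓑.coring.r (BT.lact 𝓑.coring.toBimod 𝓑.coring.l)
    →ₗ[k] BT 𝓐.bimodAH.r (BT.lact 𝓐.bimodAH 𝓐.bimodAH.l) :=
  BT.lift ((BT.t 𝓐.bimodAH.r (BT.lact 𝓐.bimodAH 𝓐.bimodAH.l)).compl₁₂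
    (BT.t 𝓐.comodule.ract 𝓑.coring.l a) (𝓐.kappaAux 1)) (by
      intro r x z
      simp only [LinearMap.compl₁₂_apply]
      rw [← bimodAH_r_η, BT.t_bal]
      congr 1
      induction z using BT.ind with
      | ht y y' =>
        rw [BT.lact_t, kappaAux_t, kappaAux_t, BT.lact_t, bimodAH_l_t, mul_one, ← BT.t_bal,
          𝓐.ract_eq, one_mul]
      | hadd x y hx hy => simp only [map_add, hx, hy])

theorem kappa3_t (a : A) (x : H) (z : BT 𝓑.coring.r 𝓑.coring.l) :
    𝓐.kappa3 a (BT.t _ _ x z)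
      = BT.t 𝓐.bimodAH.r (BT.lact 𝓐.bimodAH 𝓐.bimodAH.l) (BT.t _ _ a x) (𝓐.kappaAux 1 z) := by
  exact BT.lift_t _ _ x z

/-- The `A`-coring `A ⊗_R H` associated to a right comodule algebra `A`. -/
@[reducible] noncomputable def coring : Coring k A 𝓐.AH where
  toBimod := 𝓐.bimodAH
  comul := 𝓐.comulAH
  comul_l := 𝓐.comulAH_l
  comul_r := 𝓐.comulAH_r
  counit := 𝓐.counitAH
  counit_l := 𝓐.counitAH_l
  counit_r := 𝓐.counitAH_r
  coassoc z := by
    induction z using BT.ind with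
    | ht a h =>
      have h1 : ∀ w, BT.assoc 𝓐.bimodAH.r 𝓐.bimodAH 𝓐.bimodAH.l
          (BT.map 𝓐.comulAH LinearMap.id 𝓐.comulAH_r (fun _ _ => rfl) (𝓐.kappaAux a w))
          = 𝓐.kappa3 a (BT.assoc 𝓑.coring.r 𝓑.coring.toBimod 𝓑.coring.l
            (BT.map 𝓑.coring.comul LinearMap.id 𝓑.coring.comul_r (fun _ _ => rfl) w)) := by
        intro w
        induction w using BT.ind with
        | ht y y' =>
          rw [kappaAux_t, BT.map_t, BT.map_t, comulAH_t]
          generalize 𝓑.coring.comul y = v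
          induction v using BT.ind with
          | ht x x' =>
            rw [kappaAux_t, BT.assoc_t, BT.assoc_t, kappa3_t, kappaAux_t]
            rfl
          | hadd x y hx hy => simp only [map_add, LinearMap.add_apply, hx, hy]
        | hadd x y hx hy => simp only [map_add, hx, hy]
      have h2 : ∀ w,
          BT.map LinearMap.id 𝓐.comulAH (fun _ _ => rfl) 𝓐.comulAH_l (𝓐.kappaAux a w)
          = 𝓐.kappa3 a (BT.map LinearMap.id 𝓑.coring.comul (fun _ _ => rfl)
            𝓑.coring.comul_l w) := by
        intro w
        induction w using BT.ind with
        | ht y y' =>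
          rw [kappaAux_t, BT.map_t, BT.map_t, comulAH_t, kappa3_t]
          rfl
        | hadd x y hx hy => simp only [map_add, hx, hy]
      rw [comulAH_t, h1, h2, 𝓑.coring.coassoc]
    | hadd x y hx hy => simp only [map_add, hx, hy]
  counit_comul z := by
    induction z using BT.ind with
    | ht a h =>
      rw [comulAH_t]
      have h1 : ∀ w, BT.contrL 𝓐.bimodAH.r 𝓐.bimodAH.l 𝓐.bimodAH.l_mul 𝓐.counitAH 𝓐.counitAH_r
          (𝓐.kappaAux a w) = BT.t _ _ a (BT.contrL 𝓑.coring.r 𝓑.coring.l 𝓑.coring.l_mul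
            𝓑.coring.counit 𝓑.coring.counit_r w) := by
        intro w
        induction w using BT.ind with
        | ht y y' =>
          rw [kappaAux_t, BT.contrL_t, BT.contrL_t, counitAH_t, bimodAH_l_t, mul_one,
            ← 𝓐.ract_eq, BT.t_bal]
        | hadd x y hx hy => simp only [map_add, hx, hy]
      rw [h1, 𝓑.coring.counit_comul]
    | hadd x y hx hy => simp only [map_add, hx, hy]
  comul_counit z := by
    induction z using BT.ind with
    | ht a h =>
      rw [comulAH_t]
      have h1 : ∀ w, BT.contrR 𝓐.bimodAH.r 𝓐.bimodAH.l 𝓐.bimodAH.r_mul 𝓐.counitAH 𝓐.counitAH_l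
          (𝓐.kappaAux a w) = BT.t _ _ a (BT.contrR 𝓑.coring.r 𝓑.coring.l 𝓑.coring.r_mul
            𝓑.coring.counit 𝓑.coring.counit_l w) := by
        intro w
        induction w using BT.ind with
        | ht y y' =>
          rw [kappaAux_t, BT.contrR_t, BT.contrR_t, counitAH_t, one_mul, bimodAH_r_η]
        | hadd x y hx hy => simp only [map_add, hx, hy]
      rw [h1, 𝓑.coring.comul_counit]
    | hadd x y hx hy => simp only [map_add, hx, hy]

end ComoduleAlgebra
end ComoduleAlgebras

section CleftExtensions

variable {k L R H A : Type u} [CommRing k] [Ring L] [Algebra k L] [Ring R] [Algebra k R]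
  [Ring H] [Algebra k H] [Ring A] [Algebra k A]

namespace ComoduleAlgebra

section Extension

variable {𝓗 : HopfAlgebroid k L R H} (𝓐 : ComoduleAlgebra 𝓗.right A)

/-- The right `L`-action `(a ⊗ h) l = a ⊗ t_L(l) h` on `A ⊗_R H`. -/
noncomputable def ractL : L →ₗ[k] 𝓐.AH →ₗ[k] 𝓐.AH :=
  BT.ract 𝓐.comodule.ract 𝓗.bimodRL

theorem ractL_t (l : L) (a : A) (h : H) :
    𝓐.ractL l (BT.t _ _ a h) = BT.t _ _ a (𝓗.left.coring.r l h) :=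
  BT.ract_t 𝓐.comodule.ract 𝓗.bimodRL l a h

theorem lr_AH (a : A) (l : L) (z : 𝓐.AH) :
    𝓐.coring.l a (𝓐.ractL l z) = 𝓐.ractL l (𝓐.coring.l a z) := by
  induction z using BT.ind with
  | ht b h => rw [ractL_t, bimodAH_l_t, bimodAH_l_t, ractL_t]
  | hadd x y hx hy => simp only [map_add, hx, hy]

theorem ractL_one (z : 𝓐.AH) : 𝓐.ractL (1 : L) z = z := by
  induction z using BT.ind with
  | ht b h => rw [ractL_t, 𝓗.left.coring.r_one]
  | hadd x y hx hy => rw [map_add, hx, hy]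

theorem ractL_mul (l l' : L) (z : 𝓐.AH) : 𝓐.ractL (l * l') z = 𝓐.ractL l' (𝓐.ractL l z) := by
  induction z using BT.ind with
  | ht b h => rw [ractL_t, ractL_t, ractL_t, 𝓗.left.coring.r_mul]
  | hadd x y hx hy => rw [map_add, hx, hy, map_add, map_add]

/-- The `A`-`L` bimodule `A ⊗_R H`. -/
@[reducible] noncomputable def bimodL : Bimod k A L 𝓐.AH :=
  ⟨𝓐.coring.l, 𝓐.ractL, 𝓐.coring.l_one, 𝓐.coring.l_mul, 𝓐.ractL_one, 𝓐.ractL_mul, 𝓐.lr_AH⟩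

theorem tau_bal (a : A) (l : L) (y : H) :
    BT.t 𝓐.comodule.ract 𝓗.right.coring.l a (𝓗.left.coring.r l y)
      = 𝓐.ractL l (BT.t 𝓐.comodule.ract 𝓗.right.coring.l a y) := by
  rw [ractL_t]

/-- The map `y ⊗ y' ↦ (a ⊗ y) ⊗ y'`. -/
noncomputable def tauAux (a : A) :
    BT 𝓗.left.coring.r 𝓗.left.coring.l →ₗ[k] BT 𝓐.ractL 𝓗.left.coring.l :=
  BT.map (BT.t 𝓐.comodule.ract 𝓗.right.coring.l a) LinearMap.id (𝓐.tau_bal a) (fun _ _ => rfl)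

theorem tauAux_t (a : A) (y y' : H) :
    𝓐.tauAux a (BT.t _ _ y y') = BT.t 𝓐.ractL 𝓗.left.coring.l (BT.t _ _ a y) y' := by
  rw [tauAux, BT.map_t]; rfl

theorem tauAux_bal (r : R) (a : A) (z : BT 𝓗.left.coring.r 𝓗.left.coring.l) :
    𝓐.tauAux (𝓐.comodule.ract r a) z
      = 𝓐.tauAux a (BT.lact 𝓗.bimodRL 𝓗.left.coring.l r z) := by
  induction z using BT.ind with
  | ht y y' =>
    rw [tauAux_t, BT.t_bal]
    refine Eq.trans ?_ (congrArg _ (BT.lact_t 𝓗.bimodRL 𝓗.left.coring.l r y y')).symm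
    rw [tauAux_t]
  | hadd x y hx hy => rw [map_add, hx, hy, map_add, map_add]

/-- The right coaction `a ⊗ h ↦ (a ⊗ h_(1)) ⊗ h_(2)` on `A ⊗_R H`. -/
noncomputable def tau : 𝓐.AH →ₗ[k] BT 𝓐.ractL 𝓗.left.coring.l :=
  BT.lift (LinearMap.mk₂ k (fun a h => 𝓐.tauAux a (𝓗.left.coring.comul h))
    (fun a a' h => by
      rw [← LinearMap.add_apply]; congr 1; exact BT.ext (by simp [tauAux_t]))
    (fun c a h => by
      rw [← LinearMap.smul_apply]; congr 1; exact BT.ext (by simp [tauAux_t]))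
    (by simp) (by simp)) (by
      intro r a h
      simp only [LinearMap.mk₂_apply]
      rw [tauAux_bal, 𝓗.comulL_l])

theorem tau_t (a : A) (h : H) :
    𝓐.tau (BT.t _ _ a h) = 𝓐.tauAux a (𝓗.left.coring.comul h) := by
  exact BT.lift_t _ _ a h

theorem tau_r (l : L) (z : 𝓐.AH) :
    𝓐.tau (𝓐.ractL l z) = BT.ract 𝓐.ractL 𝓗.left.coring.toBimod l (𝓐.tau z) := by
  induction z using BT.ind with
  | ht a h =>
    rw [ractL_t, tau_t, tau_t, 𝓗.left.coring.comul_r]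
    generalize 𝓗.left.coring.comul h = w
    induction w using BT.ind with
    | ht y y' => rw [BT.ract_t, tauAux_t, tauAux_t, BT.ract_t]
    | hadd x y hx hy => simp only [map_add, hx, hy]
  | hadd x y hx hy => simp only [map_add, hx, hy]

theorem tau_l (a : A) (z : 𝓐.AH) :
    𝓐.tau (𝓐.coring.l a z) = BT.lact 𝓐.bimodL 𝓗.left.coring.l a (𝓐.tau z) := by
  induction z using BT.ind with
  | ht b h =>
    rw [bimodAH_l_t, tau_t, tau_t]
    generalize 𝓗.left.coring.comul h = w
    induction w using BT.ind with
    | ht y y' =>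
      rw [tauAux_t, tauAux_t]
      refine ((BT.lact_t 𝓐.bimodL 𝓗.left.coring.l a _ y').trans ?_).symm
      rw [bimodAH_l_t]
    | hadd x y hx hy => simp only [map_add, hx, hy]
  | hadd x y hx hy => simp only [map_add, hx, hy]

/-- The map `y ⊗ z ↦ (a ⊗ y) ⊗ z`. -/
noncomputable def tau3 (a : A) :
    BT 𝓗.left.coring.r (BT.lact 𝓗.left.coring.toBimod 𝓗.left.coring.l)
      →ₗ[k] BT 𝓐.ractL (BT.lact 𝓗.left.coring.toBimod 𝓗.left.coring.l) :=
  BT.map (BT.t 𝓐.comodule.ract 𝓗.right.coring.l a) LinearMap.id (𝓐.tau_bal a) (fun _ _ => rfl)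

theorem tau3_t (a : A) (y : H) (z : BT 𝓗.left.coring.r 𝓗.left.coring.l) :
    𝓐.tau3 a (BT.t _ _ y z)
      = BT.t 𝓐.ractL (BT.lact 𝓗.left.coring.toBimod 𝓗.left.coring.l) (BT.t _ _ a y) z := by
  rw [tau3, BT.map_t]; rfl

theorem tau_coassoc (z : 𝓐.AH) :
    BT.assoc 𝓐.ractL 𝓗.left.coring.toBimod 𝓗.left.coring.l
      (BT.map 𝓐.tau LinearMap.id 𝓐.tau_r (fun _ _ => rfl) (𝓐.tau z))
    = BT.map LinearMap.id 𝓗.left.coring.comul (fun _ _ => rfl) 𝓗.left.coring.comul_l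
        (𝓐.tau z) := by
  induction z using BT.ind with
  | ht a h =>
    have h1 : ∀ w, BT.assoc 𝓐.ractL 𝓗.left.coring.toBimod 𝓗.left.coring.l
        (BT.map 𝓐.tau LinearMap.id 𝓐.tau_r (fun _ _ => rfl) (𝓐.tauAux a w))
        = 𝓐.tau3 a (BT.assoc 𝓗.left.coring.r 𝓗.left.coring.toBimod 𝓗.left.coring.l
          (BT.map 𝓗.left.coring.comul LinearMap.id 𝓗.left.coring.comul_r (fun _ _ => rfl) w)) := by
      intro w
      induction w using BT.ind with
      | ht y y' =>
        rw [tauAux_t, BT.map_t, BT.map_t, tau_t]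
        generalize 𝓗.left.coring.comul y = v
        induction v using BT.ind with
        | ht x x' => rw [tauAux_t, BT.assoc_t, BT.assoc_t, tau3_t]
        | hadd x y hx hy => simp only [map_add, LinearMap.add_apply, hx, hy]
      | hadd x y hx hy => simp only [map_add, hx, hy]
    have h2 : ∀ w, BT.map LinearMap.id 𝓗.left.coring.comul (fun _ _ => rfl)
        𝓗.left.coring.comul_l (𝓐.tauAux a w)
        = 𝓐.tau3 a (BT.map LinearMap.id 𝓗.left.coring.comul (fun _ _ => rfl)
          𝓗.left.coring.comul_l w) := by
      intro w
      induction w using BT.ind with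
      | ht y y' => rw [tauAux_t, BT.map_t, BT.map_t, tau3_t]; rfl
      | hadd x y hx hy => simp only [map_add, hx, hy]
    rw [tau_t, h1, h2, 𝓗.left.coring.coassoc]
  | hadd x y hx hy => simp only [map_add, hx, hy]

theorem tau_counit (z : 𝓐.AH) :
    BT.contrR 𝓐.ractL 𝓗.left.coring.l 𝓐.ractL_mul 𝓗.left.coring.counit
      𝓗.left.coring.counit_l (𝓐.tau z) = z := by
  induction z using BT.ind with
  | ht a h =>
    have h1 : ∀ w, BT.contrR 𝓐.ractL 𝓗.left.coring.l 𝓐.ractL_mul 𝓗.left.coring.counit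
        𝓗.left.coring.counit_l (𝓐.tauAux a w)
        = BT.t _ _ a (BT.contrR 𝓗.left.coring.r 𝓗.left.coring.l 𝓗.left.coring.r_mul
          𝓗.left.coring.counit 𝓗.left.coring.counit_l w) := by
      intro w
      induction w using BT.ind with
      | ht y y' => rw [tauAux_t, BT.contrR_t, BT.contrR_t, ractL_t]
      | hadd x y hx hy => simp only [map_add, hx, hy]
    rw [tau_t, h1, 𝓗.left.coring.comul_counit]
  | hadd x y hx hy => simp only [map_add, hx, hy]

theorem comulAH_ractL (l : L) (z : 𝓐.AH) :
    𝓐.coring.comul (𝓐.ractL l z) = BT.ract 𝓐.coring.r 𝓐.bimodL l (𝓐.coring.comul z) := by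
  induction z using BT.ind with
  | ht a h =>
    rw [ractL_t, comulAH_t, comulAH_t, 𝓗.comulR_r]
    generalize 𝓗.right.coring.comul h = w
    induction w using BT.ind with
    | ht y y' =>
      refine (congrArg _ (BT.ract_t 𝓗.right.coring.r 𝓗.bimodRL l y y')).trans ?_
      rw [kappaAux_t, kappaAux_t]
      refine ((BT.ract_t 𝓐.coring.r 𝓐.bimodL l _ _).trans ?_).symm
      rw [ractL_t]
    | hadd x y hx hy => simp only [map_add, hx, hy]
  | hadd x y hx hy => simp only [map_add, hx, hy]

theorem kappaTau_bal (a : A) (r : R) (x : H) (z : BT 𝓗.left.coring.r 𝓗.left.coring.l) :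
    BT.t 𝓐.coring.r (BT.lact 𝓐.bimodL 𝓗.left.coring.l)
        (BT.t 𝓐.comodule.ract 𝓗.right.coring.l a (𝓗.right.coring.r r x)) (𝓐.tauAux 1 z)
      = BT.t 𝓐.coring.r (BT.lact 𝓐.bimodL 𝓗.left.coring.l)
        (BT.t 𝓐.comodule.ract 𝓗.right.coring.l a x)
        (𝓐.tauAux 1 (BT.lact 𝓗.bimodRL 𝓗.left.coring.l r z)) := by
  rw [← bimodAH_r_η, BT.t_bal, ← tauAux_bal]
  congr 1
  induction z using BT.ind with
  | ht y y' =>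
    rw [tauAux_t, tauAux_t, 𝓐.ract_eq, one_mul]
    refine (BT.lact_t 𝓐.bimodL 𝓗.left.coring.l _ _ y').trans ?_
    rw [bimodAH_l_t, mul_one]
  | hadd x y hx hy => simp only [map_add, hx, hy]

/-- The map `x ⊗ y ⊗ y' ↦ (a ⊗ x) ⊗ (1 ⊗ y) ⊗ y'`. -/
noncomputable def kappaTau (a : A) : BT 𝓗.right.coring.r (BT.lact 𝓗.bimodRL 𝓗.left.coring.l)
    →ₗ[k] BT 𝓐.coring.r (BT.lact 𝓐.bimodL 𝓗.left.coring.l) :=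
  BT.lift ((BT.t 𝓐.coring.r (BT.lact 𝓐.bimodL 𝓗.left.coring.l)).compl₁₂
    (BT.t 𝓐.comodule.ract 𝓗.right.coring.l a) (𝓐.tauAux 1)) (by
      intro r x z
      simp only [LinearMap.compl₁₂_apply]
      exact 𝓐.kappaTau_bal a r x z)

theorem kappaTau_t (a : A) (x : H) (z : BT 𝓗.left.coring.r 𝓗.left.coring.l) :
    𝓐.kappaTau a (BT.t _ (BT.lact 𝓗.bimodRL 𝓗.left.coring.l) x z)
      = BT.t 𝓐.coring.r (BT.lact 𝓐.bimodL 𝓗.left.coring.l) (BT.t _ _ a x) (𝓐.tauAux 1 z) := by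
  exact BT.lift_t _ _ x z

theorem tau_colinear (z : 𝓐.AH) :
    BT.assoc 𝓐.coring.r 𝓐.bimodL 𝓗.left.coring.l
      (BT.map 𝓐.coring.comul LinearMap.id 𝓐.comulAH_ractL (fun _ _ => rfl) (𝓐.tau z))
    = BT.map LinearMap.id 𝓐.tau (fun _ _ => rfl) 𝓐.tau_l (𝓐.coring.comul z) := by
  induction z using BT.ind with
  | ht a h =>
    have h1 : ∀ w, BT.assoc 𝓐.coring.r 𝓐.bimodL 𝓗.left.coring.l
        (BT.map 𝓐.coring.comul LinearMap.id 𝓐.comulAH_ractL (fun _ _ => rfl) (𝓐.tauAux a w))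
        = 𝓐.kappaTau a (BT.assoc 𝓗.right.coring.r 𝓗.bimodRL 𝓗.left.coring.l
          (BT.map 𝓗.right.coring.comul LinearMap.id 𝓗.comulR_r (fun _ _ => rfl) w)) := by
      intro w
      induction w using BT.ind with
      | ht y y' =>
        rw [tauAux_t, BT.map_t, BT.map_t, comulAH_t]
        generalize 𝓗.right.coring.comul y = v
        induction v using BT.ind with
        | ht x x' =>
          rw [kappaAux_t]
          refine (BT.assoc_t 𝓐.coring.r 𝓐.bimodL 𝓗.left.coring.l _ _ _).trans ?_
          refine Eq.trans ?_ (congrArg _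
            (BT.assoc_t 𝓗.right.coring.r 𝓗.bimodRL 𝓗.left.coring.l x x' _)).symm
          rw [kappaTau_t, tauAux_t]
        | hadd x y hx hy => simp only [map_add, LinearMap.add_apply, hx, hy]
      | hadd x y hx hy => simp only [map_add, hx, hy]
    have h2 : ∀ w, BT.map LinearMap.id 𝓐.tau (fun _ _ => rfl) 𝓐.tau_l (𝓐.kappaAux a w)
        = 𝓐.kappaTau a (BT.map LinearMap.id 𝓗.left.coring.comul (fun _ _ => rfl)
          𝓗.comulL_l w) := by
      intro w
      induction w using BT.ind with
      | ht y y' => rw [kappaAux_t, BT.map_t, BT.map_t, tau_t, kappaTau_t]; rfl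
      | hadd x y hx hy => simp only [map_add, hx, hy]
    rw [tau_t, h1, comulAH_t, h2, 𝓗.coassoc_RL]
  | hadd x y hx hy => simp only [map_add, hx, hy]

/-- The `L`-coring underlying the left bialgebroid of a Hopf algebroid is a right extension of the
`A`-coring `A ⊗_R H`, via the coaction `a ⊗ h ↦ a ⊗ h_(1) ⊗ h_(2)`. -/
@[reducible] noncomputable def extension : RightExtension 𝓐.coring 𝓗.left.coring where
  ract := 𝓐.ractL
  ract_one := 𝓐.ractL_one
  ract_mul := 𝓐.ractL_mul
  coact := 𝓐.tau
  coact_r := 𝓐.tau_r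
  coassoc := 𝓐.tau_coassoc
  counit := 𝓐.tau_counit
  lr := 𝓐.lr_AH
  coact_l := 𝓐.tau_l
  comul_ract := 𝓐.comulAH_ractL
  colinear := 𝓐.tau_colinear

end Extension

section Regular

variable {𝓑 : RightBialgebroid k R H} (𝓐 : ComoduleAlgebra 𝓑 A)

/-- The coinvariant subalgebra `{t ∈ A | t^[0] ⊗ t^[1] = t ⊗ 1}`. -/
def coinvariants : Subalgebra k A where
  carrier := {a | 𝓐.comodule.coact a = BT.t _ _ a 1}
  mul_mem' {a b} ha hb := by
    refine (𝓐.coact_mul a b (a ⊗ₜ[k] 1) (b ⊗ₜ[k] 1) ?_ ?_).trans ?_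
    · exact Eq.symm ha
    · exact Eq.symm hb
    · rw [Algebra.TensorProduct.tmul_mul_tmul, mul_one]; rfl
  add_mem' {a b} ha hb := by
    change 𝓐.comodule.coact (a + b) = BT.t _ _ (a + b) 1
    rw [map_add, map_add, LinearMap.add_apply]
    exact congrArg₂ (· + ·) ha hb
  algebraMap_mem' c := by
    change 𝓐.comodule.coact (algebraMap k A c) = BT.t _ _ (algebraMap k A c) 1
    rw [Algebra.algebraMap_eq_smul_one, map_smul, 𝓐.coact_one, map_smul, LinearMap.smul_apply]

/-- The right regular `A`-module structure of `A`. -/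
noncomputable def ractA (A : Type u) [Ring A] [Algebra k A] : A →ₗ[k] A →ₗ[k] A :=
  (LinearMap.mul k A).flip

theorem ractA_apply (a b : A) : ractA (k := k) A a b = b * a := rfl

/-- The algebra `A`, with the right regular `A`-module structure and the coaction
`A → A ⊗_R H ≅ A ⊗_A (A ⊗_R H)`, as a right comodule over the `A`-coring `A ⊗_R H`. -/
@[reducible] noncomputable def regular : RightComodule 𝓐.coring A where
  ract := ractA A
  ract_one m := by rw [ractA_apply, mul_one]
  ract_mul a a' m := by rw [ractA_apply, ractA_apply, ractA_apply, mul_assoc]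
  coact := (BT.t _ _ 1).comp 𝓐.comodule.coact
  coact_r a b := by
    rw [ractA_apply, LinearMap.comp_apply, coact_mul', LinearMap.comp_apply]
    exact (BT.ract_t (ractA A) 𝓐.bimodAH a 1 _).symm
  coassoc a := by
    have h1 : ∀ w : 𝓐.AH, BT.assoc (ractA A) 𝓐.bimodAH 𝓐.bimodAH.l
        (BT.t (BT.ract (ractA A) 𝓐.bimodAH) 𝓐.bimodAH.l
          (BT.t (ractA A) 𝓐.bimodAH.l 1 (𝓐.comodule.coact 1)) w)
        = BT.t (ractA A) (BT.lact 𝓐.bimodAH 𝓐.bimodAH.l) 1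
          (BT.t 𝓐.bimodAH.r 𝓐.bimodAH.l (BT.t _ _ 1 1) w) := by
      intro w
      rw [BT.assoc_t, 𝓐.coact_one]
    have h2 : ∀ w : 𝓐.AH, BT.t 𝓐.bimodAH.r 𝓐.bimodAH.l (BT.t _ _ 1 1) w
        = 𝓐.kappa (BT.assoc _ 𝓑.coring.toBimod 𝓑.coring.l
          (BT.map 𝓐.comodule.coact LinearMap.id 𝓐.comodule.coact_r (fun _ _ => rfl) w)) := by
      intro w
      induction w using BT.ind with
      | ht x y =>
        rw [BT.map_t, LinearMap.id_apply, kappa_assoc]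
        have h3 : BT.t 𝓐.comodule.ract 𝓑.coring.l x y
            = 𝓐.bimodAH.l x (BT.t _ _ 1 y) := by rw [bimodAH_l_t, mul_one]
        have h4 : 𝓐.bimodAH.r x (BT.t _ _ 1 1) = 𝓐.comodule.coact x := by
          refine (𝓐.ractAH_t x 1 1).trans ?_
          generalize 𝓐.comodule.coact x = v
          induction v using BT.ind with
          | ht b h => rw [mulAH_t, one_mul, one_mul]
          | hadd x y hx hy => rw [map_add, hx, hy]
        rw [h3, ← BT.t_bal, h4]
      | hadd x y hx hy => simp only [map_add, hx, hy]
    rw [LinearMap.comp_apply, BT.map_t, BT.map_t, LinearMap.comp_apply, LinearMap.id_apply]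
    refine (h1 _).trans ?_
    rw [h2, 𝓐.comodule.coassoc]
    rfl
  counit a := by
    rw [LinearMap.comp_apply, BT.contrR_t, ractA_apply, one_mul]
    exact 𝓐.counitAH_coact a

end Regular

section Cleft

variable {𝓗 : HopfAlgebroid k L R H} (𝓐 : ComoduleAlgebra 𝓗.right A)

/-- Left `L`-linearity of the coaction of the right comodule algebra `A`, for an `L`-ring structure
`ηL : L → A`. -/
def IsLeftLinear (ηL : L →ₐ[k] A) : Prop :=
  ∀ l a, 𝓐.comodule.coact (ηL l * a) = 𝓐.bimodAH.l (ηL l) (𝓐.comodule.coact a)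

/-- The left `L`-action `l a = ηL(l) a` on an `L`-ring `A`. -/
noncomputable def lactA (ηL : L →ₐ[k] A) : L →ₗ[k] A →ₗ[k] A :=
  (LinearMap.mul k A).comp ηL.toLinearMap

theorem lactA_apply (ηL : L →ₐ[k] A) (l : L) (a : A) : lactA ηL l a = ηL l * a := rfl

/-- The `L`-`A` bimodule structure of an `L`-ring `A`. -/
@[reducible] noncomputable def bimodA (ηL : L →ₐ[k] A) : Bimod k L A A where
  l := lactA ηL
  r := ractA A
  l_one m := by rw [lactA_apply, map_one, one_mul]
  l_mul l l' m := by rw [lactA_apply, lactA_apply, lactA_apply, map_mul, mul_assoc]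
  r_one m := by rw [ractA_apply, mul_one]
  r_mul a a' m := by rw [ractA_apply, ractA_apply, ractA_apply, mul_assoc]
  lr l a m := by rw [lactA_apply, ractA_apply, ractA_apply, lactA_apply, mul_assoc]

/-- If `A` is an `L`-ring with left `L`-linear coaction, then `A` is an `L`-`(A ⊗_R H)`
bicomodule. -/
@[reducible] noncomputable def bicomodule (ηL : L →ₐ[k] A) (h : 𝓐.IsLeftLinear ηL) :
    Bicomodule k L 𝓐.coring A where
  toRightComodule := 𝓐.regular
  lact := lactA ηL
  lact_one := (bimodA ηL).l_one
  lact_mul := (bimodA ηL).l_mul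
  lr := (bimodA ηL).lr
  coact_lact l a := by
    have h1 : BT.t (ractA A) 𝓐.bimodAH.l 1 (𝓐.bimodAH.l (ηL l) (𝓐.comodule.coact a))
        = BT.lact (bimodA ηL) 𝓐.bimodAH.l l (BT.t (ractA A) 𝓐.bimodAH.l 1 (𝓐.comodule.coact a)) := by
      rw [BT.lact_t, ← BT.t_bal, ractA_apply, one_mul, lactA_apply, mul_one]
    rw [← h l a] at h1
    exact h1

/-- A cleaving: a left `L`-linear right `H_R`-colinear map `λ : H → A`, together with a left
`R`-linear right `L`-linear map `λ' : H → A` such that `μ_A (λ ⊗_R λ') γ_R = η_L π_L` and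
`μ_A (λ' ⊗_L λ) γ_L = η_R π_R`. -/
structure Cleaving (ηL : L →ₐ[k] A) where
  toFun : H →ₗ[k] A
  map_l : ∀ l h, toFun (𝓗.left.coring.l l h) = ηL l * toFun h
  map_r : ∀ r h, toFun (𝓗.right.coring.r r h) = 𝓐.comodule.ract r (toFun h)
  colinear : ∀ h, 𝓐.comodule.coact (toFun h)
    = BT.map toFun LinearMap.id map_r (fun _ _ => rfl) (𝓗.right.coring.comul h)
  inv : H →ₗ[k] A
  inv_l : ∀ r h, inv (𝓗.right.coring.l r h) = 𝓐.η r * inv h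
  inv_r : ∀ l h, inv (𝓗.left.coring.r l h) = inv h * ηL l
  mul_inv : ∀ h, BT.lift ((LinearMap.mul k A).compl₁₂ toFun inv)
      (by
        intro r x y
        simp only [LinearMap.compl₁₂_apply, LinearMap.mul_apply']
        rw [map_r, inv_l, 𝓐.ract_eq, mul_assoc])
      (𝓗.right.coring.comul h) = ηL (𝓗.left.coring.counit h)
  inv_mul : ∀ h, BT.lift ((LinearMap.mul k A).compl₁₂ inv toFun)
      (by
        intro l x y
        simp only [LinearMap.compl₁₂_apply, LinearMap.mul_apply']
        rw [map_l, inv_r, mul_assoc])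
      (𝓗.left.coring.comul h) = 𝓐.η (𝓗.right.coring.counit h)

/-- The `H_R`-comodule algebra `A`, with the `L`-ring structure `ηL`, is an `H`-cleft extension of
its coinvariant subalgebra `T`: `T` is an `L`-subring of `A`, and there is a cleaving. -/
def IsCleftVia (ηL : L →ₐ[k] A) : Prop :=
  (∀ l, ηL l ∈ 𝓐.coinvariants) ∧ Nonempty (𝓐.Cleaving ηL)

/-- The `H_R`-comodule algebra `A` is an `H`-cleft extension of its coinvariant subalgebra: this
holds for some `L`-ring structure of `A`. -/
def IsCleftExtension : Prop := ∃ ηL : L →ₐ[k] A, 𝓐.IsCleftVia ηL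

/-- The algebra `A`, with the left `L`-module structure given by `ηL`, the right regular `A`-module
structure and the given coaction, is an `L`-`(A ⊗_R H)` bicomodule which is cleft for the coring
extension `H_L` of `A ⊗_R H`. -/
def IsCleftBicomodule (ηL : L →ₐ[k] A) : Prop :=
  ∃ h : 𝓐.IsLeftLinear ηL, (𝓐.bicomodule ηL h).IsCleft 𝓐.extension

end Cleft

end ComoduleAlgebra
end CleftExtensions

end NC

/-!
The data of the two notions correspond to each other: `j = λ` and `q(a ⊗ h)(x) = a λ'(h) x`, where
`λ'(h) = q(1 ⊗ h)(1)`. The first identity of a cleft bicomodule is then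
`λ'(h_(1)) λ(h_(2)) = η_R(π_R(h))`, and the second one is `λ(h)^[0] λ'(λ(h)^[1]) = η_L(π_L(h))`,
which is `λ(h^(1)) λ'(h^(2)) = η_L(π_L(h))` as soon as `λ` is `H_R`-colinear.

It remains to compare colinearity over `H_R` and over `H_L`. The `H_L`-coaction `τ_A` which purity
gives on `A` is characterised by `(ϱ ⊗ H) τ_A = (A ⊗ γ_L) ϱ`, where `ϱ` is the `H_R`-coaction. Hence
`H_R`-colinear maps are `H_L`-colinear because `γ_L` and `γ_R` coassociate. Conversely, the first
identity makes `a ⊗ x ⊗ y ↦ a λ'(x) λ(y^(1)) ⊗ y^(2)` a left inverse of `A ⊗ γ_L`; applied to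
`H_L`-colinearity of `λ`, it yields `H_R`-colinearity by means of the second identity. The map `q`
defined by `λ'` belongs to `Q̃` because `λ'(h^(2))^[0] ⊗ h^(1) λ'(h^(2))^[1] = λ'(h) ⊗ 1`.

The extension `H_L` of `A ⊗_R H` is pure if the extension `H_L` of `H_R` is: the isomorphisms
`M ⊗_A (A ⊗_R H) ≅ M ⊗_R H` identify the equaliser of a comodule `M` over `A ⊗_R H` with that of the
underlying `H_R`-comodule.
-/

namespace NC
namespace BT

section Balanced

variable {k C M M₁ M₂ M₃ N N₁ : Type u} [CommRing k] [Ring C] [Algebra k C]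
  [AddCommGroup M] [Module k M] [AddCommGroup M₁] [Module k M₁] [AddCommGroup M₂] [Module k M₂]
  [AddCommGroup M₃] [Module k M₃] [AddCommGroup N] [Module k N] [AddCommGroup N₁] [Module k N₁]
  {ρ : C →ₗ[k] M →ₗ[k] M} {ρ₁ : C →ₗ[k] M₁ →ₗ[k] M₁} {ρ₂ : C →ₗ[k] M₂ →ₗ[k] M₂}
  {ρ₃ : C →ₗ[k] M₃ →ₗ[k] M₃} {lam : C →ₗ[k] N →ₗ[k] N}

theorem map_id_comm {f : M →ₗ[k] M₁} {f' : M₁ →ₗ[k] M₃} {g : M →ₗ[k] M₂} {g' : M₂ →ₗ[k] M₃}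
    (hf : ∀ c m, f (ρ c m) = ρ₁ c (f m)) (hf' : ∀ c m, f' (ρ₁ c m) = ρ₃ c (f' m))
    (hg : ∀ c m, g (ρ c m) = ρ₂ c (g m)) (hg' : ∀ c m, g' (ρ₂ c m) = ρ₃ c (g' m))
    (h : ∀ m, f' (f m) = g' (g m)) (z : BT ρ lam) :
    map f' LinearMap.id hf' (fun _ _ => rfl) (map f LinearMap.id hf (fun _ _ => rfl) z)
      = map g' LinearMap.id hg' (fun _ _ => rfl)
          (map (lam' := lam) g LinearMap.id hg (fun _ _ => rfl) z) := by
  induction z using BT.ind with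
  | ht m n => simp only [map_t, h]
  | hadd x y hx hy => simp only [map_add, hx, hy]

theorem map_id_leftInverse {f : M →ₗ[k] M₁} {g : M₁ →ₗ[k] M}
    (hf : ∀ c m, f (ρ c m) = ρ₁ c (f m)) (hg : ∀ c m, g (ρ₁ c m) = ρ c (g m))
    (h : Function.LeftInverse g f) :
    Function.LeftInverse (map (lam' := lam) g LinearMap.id hg (fun _ _ => rfl))
      (map f LinearMap.id hf (fun _ _ => rfl)) := by
  intro z
  induction z using BT.ind with
  | ht m n => simp only [map_t, h m, LinearMap.id_apply]
  | hadd x y hx hy => simp only [map_add, hx, hy]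

/-- The isomorphism `e ⊗_C N`, for an isomorphism `e` of right `C`-modules. -/
noncomputable def congrLeft (e : M ≃ₗ[k] M₁) (he : ∀ c m, e (ρ c m) = ρ₁ c (e m))
    (lam : C →ₗ[k] N →ₗ[k] N) : BT ρ lam ≃ₗ[k] BT ρ₁ lam :=
  have he' : ∀ c m, e.symm (ρ₁ c m) = ρ c (e.symm m) := fun c m => by
    rw [e.symm_apply_eq, he, e.apply_symm_apply]
  { map e.toLinearMap LinearMap.id he (fun _ _ => rfl) with
    invFun := map e.symm.toLinearMap LinearMap.id he' (fun _ _ => rfl)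
    left_inv := map_id_leftInverse he he' e.symm_apply_apply
    right_inv := map_id_leftInverse he' he e.apply_symm_apply }

theorem ind_right {D P : Type u} [Ring D] [Algebra k D] [AddCommGroup P] [Module k P]
    {σ : D →ₗ[k] N →ₗ[k] N} {mu : D →ₗ[k] P →ₗ[k] P} {lam : C →ₗ[k] BT σ mu →ₗ[k] BT σ mu}
    {motive : BT ρ lam → Prop} (z : BT ρ lam) (ht : ∀ m n p, motive (t ρ lam m (t σ mu n p)))
    (hadd : ∀ x y, motive x → motive y → motive (x + y)) : motive z := by
  induction z using BT.ind with
  | ht m w =>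
    induction w using BT.ind with
    | ht n p => exact ht m n p
    | hadd x y hx hy => rw [map_add]; exact hadd _ _ hx hy
  | hadd x y hx hy => exact hadd x y hx hy

end Balanced

end BT

section Corings

variable {k A L C D M : Type u} [CommRing k] [Ring A] [Algebra k A] [Ring L] [Algebra k L]
  [AddCommGroup C] [Module k C] [AddCommGroup D] [Module k D] [AddCommGroup M] [Module k M]
  {𝒞 : Coring k A C} {𝒟 : Coring k L D}

theorem RightComodule.coact_injective (S : RightComodule 𝒞 M) : Function.Injective S.coact :=
  Function.LeftInverse.injective S.counit

namespace RightExtension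

variable {A' C' D' N : Type u} [Ring A'] [Algebra k A'] [AddCommGroup C'] [Module k C']
  [AddCommGroup D'] [Module k D'] [AddCommGroup N] [Module k N]
  {𝒞' : Coring k A' C'} {𝒟' : Coring k L D'}

/-- The functor `- ⊗_L N` preserves the equaliser `M → M ⊗_A 𝒞 ⇉ M ⊗_A 𝒞 ⊗_A 𝒞` of right
`L`-modules attached to the right `𝒞`-comodule `M`. -/
def PreservesEqualiser (E : RightExtension 𝒞 𝒟) (S : RightComodule 𝒞 M)
    (lam : L →ₗ[k] N →ₗ[k] N) : Prop :=
  Function.Injective (E.coactMap S lam) ∧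
    ∀ z, E.coactTensorMap S lam z = E.tensorComulMap S lam z → ∃ w, E.coactMap S lam w = z

theorem PreservesEqualiser.of_equiv {E : RightExtension 𝒞 𝒟} {E' : RightExtension 𝒞' 𝒟'}
    {S : RightComodule 𝒞 M} {S' : RightComodule 𝒞' M} {lam : L →ₗ[k] N →ₗ[k] N}
    (α : BT S.ract 𝒞.l ≃ₗ[k] BT S'.ract 𝒞'.l)
    (hα : ∀ l z, α (BT.ract S.ract E.bimod l z) = BT.ract S'.ract E'.bimod l (α z))
    (hα_coact : ∀ m, α (S.coact m) = S'.coact m)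
    (β : BT S.ract (BT.lact 𝒞.toBimod 𝒞.l) →ₗ[k] BT S'.ract (BT.lact 𝒞'.toBimod 𝒞'.l))
    (hβ : ∀ l z, β (BT.ract S.ract (𝒞.toBimod.tensor E.bimod) l z)
      = BT.ract S'.ract (𝒞'.toBimod.tensor E'.bimod) l (β z))
    (hβ_coact : ∀ z, β (coactTensor S z) = coactTensor S' (α z))
    (hβ_comul : ∀ z, β (tensorComul S z) = tensorComul S' (α z))
    (h : E'.PreservesEqualiser S' lam) : E.PreservesEqualiser S lam := by
  have indAct_eq : ∀ l m, E.indAct S l m = E'.indAct S' l m := fun l m =>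
    S'.coact_injective <| by
      rw [← hα_coact, E.coact_indAct, hα, hα_coact, E'.coact_indAct]
  let ι : BT (E.indAct S) lam ≃ₗ[k] BT (E'.indAct S') lam :=
    BT.congrLeft (LinearEquiv.refl k M) indAct_eq lam
  let α' := BT.congrLeft α hα lam
  have coact_comm : ∀ z, E'.coactMap S' lam (ι z) = α' (E.coactMap S lam z) :=
    BT.map_id_comm indAct_eq (E'.coact_indAct S') (E.coact_indAct S) hα
      fun m => (hα_coact m).symm
  have coactTensor_comm : ∀ z, BT.map β LinearMap.id hβ (fun _ _ => rfl)
      (E.coactTensorMap S lam z) = E'.coactTensorMap S' lam (α' z) :=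
    BT.map_id_comm (E.coactTensor_ract S) hβ hα (E'.coactTensor_ract S') hβ_coact
  have tensorComul_comm : ∀ z, BT.map β LinearMap.id hβ (fun _ _ => rfl)
      (E.tensorComulMap S lam z) = E'.tensorComulMap S' lam (α' z) :=
    BT.map_id_comm (E.tensorComul_ract S) hβ hα (E'.tensorComul_ract S') hβ_comul
  refine ⟨fun z w hzw => ι.injective (h.1 ?_), fun z hz => ?_⟩
  · rw [coact_comm, coact_comm, hzw]
  · obtain ⟨w, hw⟩ := h.2 (α' z) (by rw [← coactTensor_comm, ← tensorComul_comm, hz])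
    exact ⟨ι.symm w, α'.injective (by rw [← coact_comm, ι.apply_symm_apply, hw])⟩

end RightExtension
end Corings

/-! ### Purity of the extension `H_L` of `A ⊗_R H` -/

namespace ComoduleAlgebra

section Contraction

variable {k R H A X : Type u} [CommRing k] [Ring R] [Algebra k R] [Ring H] [Algebra k H]
  [Ring A] [Algebra k A] [AddCommGroup X] [Module k X] {𝓑 : RightBialgebroid k R H}
  (𝓐 : ComoduleAlgebra 𝓑 A)

/-- Restriction of a right `A`-action along the unit map `η : R → A`. -/
noncomputable def restrict (ρ : A →ₗ[k] X →ₗ[k] X) : R →ₗ[k] X →ₗ[k] X :=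
  ρ.comp 𝓐.η.toLinearMap

theorem restrict_apply (ρ : A →ₗ[k] X →ₗ[k] X) (r : R) (x : X) :
    𝓐.restrict ρ r x = ρ (𝓐.η r) x := rfl

theorem t_η_mul (r : R) (a : A) (h : H) :
    BT.t 𝓐.comodule.ract 𝓑.coring.l (a * 𝓐.η r) h = BT.t _ _ a (𝓑.coring.l r h) := by
  rw [← 𝓐.ract_eq, BT.t_bal]

variable {ρ : A →ₗ[k] X →ₗ[k] X}

theorem flip_ract (hρ : ∀ a a' x, ρ (a * a') x = ρ a' (ρ a x)) (x : X) (r : R) (a : A) :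
    ρ.flip x (𝓐.comodule.ract r a) = 𝓐.restrict ρ r (ρ.flip x a) := by
  rw [LinearMap.flip_apply, LinearMap.flip_apply, 𝓐.ract_eq, hρ, restrict_apply]

variable (hρ : ∀ a a' x, ρ (a * a') x = ρ a' (ρ a x))

/-- The map `X ⊗_A (A ⊗_R H) → X ⊗_R H`, `x ⊗ a ⊗ h ↦ x a ⊗ h`. -/
noncomputable def contract : BT ρ 𝓐.bimodAH.l →ₗ[k] BT (𝓐.restrict ρ) 𝓑.coring.l :=
  BT.lift
    { toFun := fun x => BT.map (ρ.flip x) LinearMap.id (𝓐.flip_ract hρ x) (fun _ _ => rfl)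
      map_add' := fun x x' => BT.ext (by simp)
      map_smul' := fun c x => BT.ext (by simp) }
    (by
      intro a x z
      simp only [LinearMap.coe_mk, AddHom.coe_mk]
      induction z using BT.ind with
      | ht b h => rw [bimodAH_l_t, BT.map_t, BT.map_t, LinearMap.flip_apply, ← hρ]; rfl
      | hadd x y hx hy => simp only [map_add, hx, hy])

theorem contract_t (x : X) (a : A) (h : H) :
    𝓐.contract hρ (BT.t _ _ x (BT.t _ _ a h)) = BT.t _ _ (ρ a x) h :=
  (BT.lift_t _ _ x _).trans
    (BT.map_t (ρ.flip x) LinearMap.id (𝓐.flip_ract hρ x) (fun _ _ => rfl) a h)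

variable (ρ) in
/-- The map `X ⊗_R H → X ⊗_A (A ⊗_R H)`, `x ⊗ h ↦ x ⊗ 1 ⊗ h`. -/
noncomputable def expand : BT (𝓐.restrict ρ) 𝓑.coring.l →ₗ[k] BT ρ 𝓐.bimodAH.l :=
  BT.lift ((BT.t ρ 𝓐.bimodAH.l).compl₂ (BT.t 𝓐.comodule.ract 𝓑.coring.l 1)) (by
    intro r x h
    simp only [LinearMap.compl₂_apply]
    rw [restrict_apply, BT.t_bal, bimodAH_l_t, mul_one, ← t_η_mul, one_mul])

theorem expand_t (x : X) (h : H) :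
    𝓐.expand ρ (BT.t _ _ x h) = BT.t _ _ x (BT.t _ _ 1 h) := by
  rw [expand, BT.lift_t]; rfl

/-- The isomorphism `X ⊗_A (A ⊗_R H) ≅ X ⊗_R H` given by `contract`. -/
noncomputable def contractEquiv (hone : ∀ x, ρ 1 x = x) :
    BT ρ 𝓐.bimodAH.l ≃ₗ[k] BT (𝓐.restrict ρ) 𝓑.coring.l :=
  LinearEquiv.ofLinearMap (𝓐.contract hρ) (𝓐.expand ρ)
    (BT.ext fun x h => by
      rw [LinearMap.comp_apply, expand_t, contract_t, hone, LinearMap.id_apply])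
    (LinearMap.ext fun z => by
      rw [LinearMap.comp_apply, LinearMap.id_apply]
      induction z using BT.ind_right with
      | ht x a h => rw [contract_t, expand_t, BT.t_bal, bimodAH_l_t, mul_one]
      | hadd x y hx hy => simp only [map_add, hx, hy])

theorem contract_ract (r : R) (z : BT ρ 𝓐.bimodAH.l) :
    𝓐.contract hρ (𝓐.restrict (BT.ract ρ 𝓐.bimodAH) r z)
      = BT.ract (𝓐.restrict ρ) 𝓑.coring.toBimod r (𝓐.contract hρ z) := by
  induction z using BT.ind_right with
  | ht x a h => rw [restrict_apply, BT.ract_t, bimodAH_r_η, contract_t, contract_t, BT.ract_t]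
  | hadd x y hx hy => simp only [map_add, hx, hy]

theorem ract_bimodAH_mul (a a' : A) (z : BT ρ 𝓐.bimodAH.l) :
    BT.ract ρ 𝓐.bimodAH (a * a') z = BT.ract ρ 𝓐.bimodAH a' (BT.ract ρ 𝓐.bimodAH a z) := by
  induction z using BT.ind with
  | ht x w => simp only [BT.ract_t, 𝓐.bimodAH.r_mul]
  | hadd x y hx hy => simp only [map_add, hx, hy]

/-- The map `X ⊗_A (A ⊗_R H) ⊗_A (A ⊗_R H) → X ⊗_R H ⊗_R H` contracting the factors `A` from right
to left. -/
noncomputable def contractTwo : BT ρ (BT.lact 𝓐.bimodAH 𝓐.bimodAH.l)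
    →ₗ[k] BT (𝓐.restrict ρ) (BT.lact 𝓑.coring.toBimod 𝓑.coring.l) :=
  BT.assoc (𝓐.restrict ρ) 𝓑.coring.toBimod 𝓑.coring.l
    ∘ₗ BT.map (𝓐.contract hρ) LinearMap.id (𝓐.contract_ract hρ) (fun _ _ => rfl)
    ∘ₗ 𝓐.contract 𝓐.ract_bimodAH_mul
    ∘ₗ BT.assocInv ρ 𝓐.bimodAH 𝓐.bimodAH.l

theorem contractTwo_assoc (w : BT ρ 𝓐.bimodAH.l) (b : A) (h : H) :
    𝓐.contractTwo hρ (BT.assoc ρ 𝓐.bimodAH 𝓐.bimodAH.l (BT.t _ _ w (BT.t _ _ b h)))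
      = BT.assoc (𝓐.restrict ρ) 𝓑.coring.toBimod 𝓑.coring.l
          (BT.t _ _ (𝓐.contract hρ (BT.ract ρ 𝓐.bimodAH b w)) h) := by
  simp only [contractTwo, LinearMap.comp_apply]
  rw [BT.assocInv_assoc, contract_t, BT.map_t, LinearMap.id_apply]

theorem contractTwo_kappaAux (x : X) (b : A) (z : BT 𝓑.coring.r 𝓑.coring.l) :
    𝓐.contractTwo hρ (BT.t _ _ x (𝓐.kappaAux b z)) = BT.t _ _ (ρ b x) z := by
  induction z using BT.ind with
  | ht y y' =>
    rw [kappaAux_t, ← BT.assoc_t, contractTwo_assoc, BT.ract_t, 𝓐.bimodAH.r_one, contract_t,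
      BT.assoc_t]
  | hadd x y hx hy => simp only [map_add, hx, hy]

end Contraction

section RestrictComodule

variable {k R H A M : Type u} [CommRing k] [Ring R] [Algebra k R] [Ring H] [Algebra k H]
  [Ring A] [Algebra k A] [AddCommGroup M] [Module k M] {𝓑 : RightBialgebroid k R H}
  (𝓐 : ComoduleAlgebra 𝓑 A) (S : RightComodule 𝓐.coring M)

/-- The coaction `M → M ⊗_A (A ⊗_R H) ≅ M ⊗_R H` of the `R`-coring `H` on a right comodule over the
`A`-coring `A ⊗_R H`. -/
noncomputable def restrictCoact : M →ₗ[k] BT (𝓐.restrict S.ract) 𝓑.coring.l :=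
  (𝓐.contract S.ract_mul).comp S.coact

theorem restrictCoact_r (r : R) (m : M) :
    𝓐.restrictCoact S (𝓐.restrict S.ract r m)
      = BT.ract (𝓐.restrict S.ract) 𝓑.coring.toBimod r (𝓐.restrictCoact S m) := by
  simp only [restrictCoact, LinearMap.comp_apply]
  rw [restrict_apply, S.coact_r, ← contract_ract]
  rfl

theorem contractTwo_coactTensor (z : BT S.ract 𝓐.coring.l) :
    𝓐.contractTwo S.ract_mul (RightExtension.coactTensor S z)
      = BT.assoc (𝓐.restrict S.ract) 𝓑.coring.toBimod 𝓑.coring.l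
          (BT.map (𝓐.restrictCoact S) LinearMap.id (𝓐.restrictCoact_r S) (fun _ _ => rfl)
            (𝓐.contract S.ract_mul z)) := by
  induction z using BT.ind_right with
  | ht m b h =>
    rw [contract_t, BT.map_t, restrictCoact, LinearMap.comp_apply, S.coact_r,
      RightExtension.coactTensor, LinearMap.comp_apply, BT.map_t]
    exact 𝓐.contractTwo_assoc S.ract_mul (S.coact m) b h
  | hadd x y hx hy => simp only [map_add, hx, hy]

theorem contractTwo_tensorComul (z : BT S.ract 𝓐.coring.l) :
    𝓐.contractTwo S.ract_mul (RightExtension.tensorComul S z)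
      = BT.map LinearMap.id 𝓑.coring.comul (fun _ _ => rfl) 𝓑.coring.comul_l
            (𝓐.contract S.ract_mul z) := by
  induction z using BT.ind_right with
  | ht m b h =>
    rw [contract_t, BT.map_t, RightExtension.tensorComul, BT.map_t, comulAH_t]
    exact 𝓐.contractTwo_kappaAux S.ract_mul m b _
  | hadd x y hx hy => simp only [map_add, hx, hy]

theorem contrR_contract (z : BT S.ract 𝓐.coring.l)
    (hρ : ∀ r r' m, 𝓐.restrict S.ract (r * r') m = 𝓐.restrict S.ract r' (𝓐.restrict S.ract r m)) :
    BT.contrR (𝓐.restrict S.ract) 𝓑.coring.l hρ 𝓑.coring.counit 𝓑.coring.counit_l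
        (𝓐.contract S.ract_mul z)
      = BT.contrR S.ract 𝓐.coring.l S.ract_mul 𝓐.coring.counit 𝓐.coring.counit_l z := by
  induction z using BT.ind_right with
  | ht m b h =>
    rw [contract_t, BT.contrR_t, BT.contrR_t, counitAH_t, S.ract_mul, restrict_apply]
  | hadd x y hx hy => simp only [map_add, hx, hy]

/-- The right comodule over the `R`-coring `H` underlying a right comodule over the `A`-coring
`A ⊗_R H`. -/
@[reducible] noncomputable def restrictComodule : RightComodule 𝓑.coring M where
  ract := 𝓐.restrict S.ract
  ract_one m := by rw [restrict_apply, map_one, S.ract_one]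
  ract_mul r r' m := by
    rw [restrict_apply, restrict_apply, restrict_apply, map_mul, S.ract_mul]
  coact := 𝓐.restrictCoact S
  coact_r := 𝓐.restrictCoact_r S
  coassoc m := calc
    _ = 𝓐.contractTwo S.ract_mul (RightExtension.coactTensor S (S.coact m)) :=
      (𝓐.contractTwo_coactTensor S (S.coact m)).symm
    _ = 𝓐.contractTwo S.ract_mul (RightExtension.tensorComul S (S.coact m)) :=
      congrArg _ (S.coassoc m)
    _ = _ := 𝓐.contractTwo_tensorComul S (S.coact m)
  counit m := (𝓐.contrR_contract S _ _).trans (S.counit m)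

end RestrictComodule

section Purity

variable {k L R H A M : Type u} [CommRing k] [Ring L] [Algebra k L] [Ring R] [Algebra k R]
  [Ring H] [Algebra k H] [Ring A] [Algebra k A] [AddCommGroup M] [Module k M]
  {𝓗 : HopfAlgebroid k L R H} (𝓐 : ComoduleAlgebra 𝓗.right A)

theorem contract_ractL {S : RightComodule 𝓐.coring M} (l : L) (z : BT S.ract 𝓐.coring.l) :
    𝓐.contract S.ract_mul (BT.ract S.ract 𝓐.extension.bimod l z)
      = BT.ract (𝓐.restrict S.ract) 𝓗.extensionL.bimod l (𝓐.contract S.ract_mul z) := by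
  induction z using BT.ind_right with
  | ht m b h =>
    rw [BT.ract_t, ractL_t, contract_t, contract_t]
    exact (BT.ract_t (𝓐.restrict S.ract) 𝓗.extensionL.bimod l _ h).symm
  | hadd x y hx hy => simp only [map_add, hx, hy]

theorem contractTwo_ractL {S : RightComodule 𝓐.coring M} (l : L)
    (z : BT S.ract (BT.lact 𝓐.coring.toBimod 𝓐.coring.l)) :
    𝓐.contractTwo S.ract_mul
        (BT.ract S.ract (𝓐.coring.toBimod.tensor 𝓐.extension.bimod) l z)
      = BT.ract (𝓐.restrict S.ract) (𝓗.right.coring.toBimod.tensor 𝓗.extensionL.bimod) l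
          (𝓐.contractTwo S.ract_mul z) := by
  rw [← BT.assoc_assocInv S.ract 𝓐.coring.toBimod 𝓐.coring.l z]
  induction BT.assocInv S.ract 𝓐.coring.toBimod 𝓐.coring.l z using BT.ind_right with
  | ht w b h =>
    rw [← RightExtension.assoc_t_ract, ractL_t, contractTwo_assoc, contractTwo_assoc]
    exact 𝓗.extensionL.assoc_t_ract (𝓐.restrictComodule S) _ l h
  | hadd x y hx hy => simp only [map_add, hx, hy]

theorem extension_isPure (h : 𝓗.extensionL.IsPure) : 𝓐.extension.IsPure := fun M _ _ S =>
  RightExtension.PreservesEqualiser.of_equiv (S' := 𝓐.restrictComodule S)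
    (𝓐.contractEquiv S.ract_mul S.ract_one) 𝓐.contract_ractL (fun _ => rfl)
    (𝓐.contractTwo S.ract_mul) 𝓐.contractTwo_ractL (𝓐.contractTwo_coactTensor S)
    (𝓐.contractTwo_tensorComul S) (h M (𝓐.restrictComodule S))

end Purity

end ComoduleAlgebra

theorem BT.assocInv_t_eq_assocInvAux {k C D M N P : Type u} [CommRing k] [Ring C] [Algebra k C]
    [Ring D] [Algebra k D] [AddCommGroup M] [Module k M] [AddCommGroup N] [Module k N]
    [AddCommGroup P] [Module k P] (ρ : C →ₗ[k] M →ₗ[k] M) (Y : Bimod k C D N)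
    (mu : D →ₗ[k] P →ₗ[k] P) (m : M) (z : BT Y.r mu) :
    BT.assocInv ρ Y mu (BT.t ρ (BT.lact Y mu) m z) = BT.assocInvAux ρ Y mu m z := by
  rw [BT.assocInv, BT.lift_t]
  rfl

theorem Coring.contrR_comul_eq_self_iff {k A C : Type u} [CommRing k] [Ring A] [Algebra k A]
    [AddCommGroup C] [Module k C] (𝒞 : Coring k A C) (f : C →ₗ[k] A)
    (hf : ∀ a c, f (𝒞.l a c) = a * f c) :
    (∀ c, BT.contrR 𝒞.r 𝒞.l 𝒞.r_mul f hf (𝒞.comul c) = c) ↔ ∀ c, f c = 𝒞.counit c := by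
  refine ⟨fun h c => ?_, fun h => ?_⟩
  · have counit_contrR : ∀ z : BT 𝒞.r 𝒞.l,
        𝒞.counit (BT.contrR 𝒞.r 𝒞.l 𝒞.r_mul f hf z)
          = f (BT.contrL 𝒞.r 𝒞.l 𝒞.l_mul 𝒞.counit 𝒞.counit_r z) := fun z => by
      induction z using BT.ind with
      | ht x y => rw [BT.contrR_t, BT.contrL_t, 𝒞.counit_r, hf]
      | hadd x y hx hy => simp only [map_add, hx, hy]
    rw [← h c, counit_contrR, 𝒞.counit_comul, h]
  · obtain rfl : f = 𝒞.counit := LinearMap.ext h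
    exact 𝒞.comul_counit

theorem RightExtension.IsPure.coaction_eq_iff {k A L C D M : Type u} [CommRing k] [Ring A]
    [Algebra k A] [Ring L] [Algebra k L] [AddCommGroup C] [Module k C] [AddCommGroup D] [Module k D]
    [AddCommGroup M] [Module k M] {𝒞 : Coring k A C} {𝒟 : Coring k L D} {E : RightExtension 𝒞 𝒟}
    (hE : E.IsPure) (S : RightComodule 𝒞 M) (m : M) (w : BT (E.indAct S) 𝒟.l) :
    hE.coaction S m = w ↔ E.coactCoact S m = E.coactMap S 𝒟.l w := by
  rw [← hE.coactMap_coaction S m, (hE.injective S).eq_iff]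

namespace Bimod

open ComoduleAlgebra (ractA ractA_apply)

variable {k A D X P : Type u} [CommRing k] [Ring A] [Algebra k A] [Ring D] [Algebra k D]
  [AddCommGroup X] [Module k X] [AddCommGroup P] [Module k P] (Y : Bimod k A D X)

/-- The isomorphism `A ⊗_A Y → Y`, `a ⊗ y ↦ a y`. -/
noncomputable def leftUnitor : BT (ractA (k := k) A) Y.l →ₗ[k] X :=
  BT.contrL (ractA A) Y.l Y.l_mul LinearMap.id fun _ _ => rfl

theorem leftUnitor_t (a : A) (x : X) : Y.leftUnitor (BT.t (ractA A) Y.l a x) = Y.l a x :=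
  BT.contrL_t (ractA A) Y.l Y.l_mul LinearMap.id _ a x

theorem leftUnitor_leftInverse :
    Function.LeftInverse Y.leftUnitor (BT.t (ractA A) Y.l 1) := fun x => by
  rw [leftUnitor_t, Y.l_one]

theorem leftUnitor_ract (d : D) (z : BT (ractA (k := k) A) Y.l) :
    Y.leftUnitor (BT.ract (ractA A) Y d z) = Y.r d (Y.leftUnitor z) := by
  induction z using BT.ind with
  | ht a x => rw [BT.ract_t, leftUnitor_t, leftUnitor_t, Y.lr]
  | hadd x y hx hy => simp only [map_add, hx, hy]

theorem assocInvAux_one_injective (mu : D →ₗ[k] P →ₗ[k] P) :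
    Function.Injective (BT.assocInvAux (ractA A) Y mu 1) :=
  (BT.map_id_leftInverse (fun d x => (BT.ract_t (ractA A) Y d 1 x).symm) Y.leftUnitor_ract
    Y.leftUnitor_leftInverse).injective

end Bimod

namespace HopfAlgebroid

variable {k L R H X : Type u} [CommRing k] [Ring L] [Algebra k L] [Ring R] [Algebra k R]
  [Ring H] [Algebra k H] [AddCommGroup X] [Module k X] (𝓗 : HopfAlgebroid k L R H)

theorem lactLR_t (l : L) (x y : H) : BT.lact 𝓗.bimodLR 𝓗.right.coring.l l
      (BT.t 𝓗.right.coring.r 𝓗.right.coring.l x y) = BT.t _ _ (𝓗.left.coring.l l x) y :=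
  BT.lact_t 𝓗.bimodLR 𝓗.right.coring.l l x y

theorem ractLR_t (ρ : L →ₗ[k] X →ₗ[k] X) (r : R) (x : X) (h : H) :
    BT.ract ρ 𝓗.bimodLR r (BT.t ρ 𝓗.left.coring.l x h)
      = BT.t _ _ x (𝓗.right.coring.r r h) :=
  BT.ract_t ρ 𝓗.bimodLR r x h

theorem ractRL_t (ρ : R →ₗ[k] X →ₗ[k] X) (l : L) (x : X) (h : H) :
    BT.ract ρ 𝓗.bimodRL l (BT.t ρ 𝓗.right.coring.l x h)
      = BT.t _ _ x (𝓗.left.coring.r l h) :=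
  BT.ract_t ρ 𝓗.bimodRL l x h

theorem assocLR_t (x y z : H) : BT.assoc 𝓗.left.coring.r 𝓗.bimodLR 𝓗.right.coring.l
      (BT.t _ _ (BT.t 𝓗.left.coring.r 𝓗.left.coring.l x y) z)
      = BT.t _ _ x (BT.t 𝓗.right.coring.r 𝓗.right.coring.l y z) :=
  BT.assoc_t 𝓗.left.coring.r 𝓗.bimodLR 𝓗.right.coring.l x y z

theorem assocRL_t (x y z : H) : BT.assoc 𝓗.right.coring.r 𝓗.bimodRL 𝓗.left.coring.l
      (BT.t _ _ (BT.t 𝓗.right.coring.r 𝓗.right.coring.l x y) z)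
      = BT.t _ _ x (BT.t 𝓗.left.coring.r 𝓗.left.coring.l y z) :=
  BT.assoc_t 𝓗.right.coring.r 𝓗.bimodRL 𝓗.left.coring.l x y z

end HopfAlgebroid

namespace ComoduleAlgebra

variable {k L R H A : Type u} [CommRing k] [Ring L] [Algebra k L] [Ring R] [Algebra k R]
  [Ring H] [Algebra k H] [Ring A] [Algebra k A]

section Coaction

variable {𝓑 : RightBialgebroid k R H} (𝓐 : ComoduleAlgebra 𝓑 A)

theorem coact_injective : Function.Injective 𝓐.comodule.coact :=
  Function.LeftInverse.injective (g := 𝓐.counitAH) 𝓐.counitAH_coact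

theorem t_eq_bimodAH_l (a : A) (h : H) :
    BT.t 𝓐.comodule.ract 𝓑.coring.l a h = 𝓐.bimodAH.l a (BT.t _ _ 1 h) := by
  rw [bimodAH_l_t, mul_one]

theorem bimodAH_r_t_one (a b : A) :
    𝓐.bimodAH.r a (BT.t _ _ b 1) = 𝓐.bimodAH.l b (𝓐.comodule.coact a) :=
  𝓐.ractAH_t a b 1

theorem bimodAH_r_coinvariant {t : A} (ht : t ∈ 𝓐.coinvariants) (b : A) (h : H) :
    𝓐.bimodAH.r t (BT.t _ _ b h) = BT.t _ _ (b * t) h := by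
  have coact_t : 𝓐.comodule.coact t = BT.t _ _ t 1 := ht
  refine (𝓐.ractAH_t t b h).trans ?_
  rw [coact_t, mulAH_t, mul_one]

end Coaction

variable {𝓗 : HopfAlgebroid k L R H} (𝓐 : ComoduleAlgebra 𝓗.right A)

theorem tau_injective : Function.Injective 𝓐.tau :=
  Function.LeftInverse.injective 𝓐.tau_counit

theorem tau_ract (r : R) (z : 𝓐.AH) :
    𝓐.tau (BT.ract 𝓐.comodule.ract 𝓗.right.coring.toBimod r z)
      = BT.ract 𝓐.ractL 𝓗.bimodLR r (𝓐.tau z) := by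
  induction z using BT.ind with
  | ht a h =>
    rw [BT.ract_t, tau_t, tau_t, 𝓗.comulL_r]
    generalize 𝓗.left.coring.comul h = w
    induction w using BT.ind with
    | ht x y => rw [𝓗.ractLR_t, tauAux_t, tauAux_t, 𝓗.ractLR_t]
    | hadd x y hx hy => simp only [map_add, hx, hy]
  | hadd x y hx hy => simp only [map_add, hx, hy]

theorem coact_indAct_regular (l : L) (a : A) :
    𝓐.comodule.coact (𝓐.extension.indAct 𝓐.regular l a) = 𝓐.ractL l (𝓐.comodule.coact a) := by
  refine 𝓐.bimodAH.leftUnitor_leftInverse.injective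
    ((𝓐.extension.coact_indAct 𝓐.regular l a).trans ?_)
  exact BT.ract_t (ractA A) 𝓐.extension.bimod l 1 (𝓐.comodule.coact a)

theorem indAct_regular_eq_iff {l : L} {a b : A} :
    𝓐.extension.indAct 𝓐.regular l a = b ↔ 𝓐.ractL l (𝓐.comodule.coact a) = 𝓐.comodule.coact b := by
  rw [← coact_indAct_regular, 𝓐.coact_injective.eq_iff]

/-- The map `a ⊗ h ↦ a^[0] ⊗ a^[1] ⊗ h`. -/
noncomputable def coactLeft : BT (𝓐.extension.indAct 𝓐.regular) 𝓗.left.coring.l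
    →ₗ[k] BT 𝓐.ractL 𝓗.left.coring.l :=
  BT.map 𝓐.comodule.coact LinearMap.id 𝓐.coact_indAct_regular (fun _ _ => rfl)

theorem coactLeft_t (a : A) (h : H) :
    𝓐.coactLeft (BT.t _ _ a h) = BT.t _ _ (𝓐.comodule.coact a) h := by
  rw [coactLeft, BT.map_t, LinearMap.id_apply]

theorem coactMap_regular (z : BT (𝓐.extension.indAct 𝓐.regular) 𝓗.left.coring.l) :
    𝓐.extension.coactMap 𝓐.regular 𝓗.left.coring.l z
      = BT.assocInvAux (ractA A) 𝓐.extension.bimod 𝓗.left.coring.l 1 (𝓐.coactLeft z) := by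
  induction z using BT.ind with
  | ht a h =>
    rw [RightExtension.coactMap, BT.map_t, coactLeft_t]
    exact (BT.assocInvAux_t (ractA A) 𝓐.extension.bimod 𝓗.left.coring.l 1 _ h).symm
  | hadd x y hx hy => simp only [map_add, hx, hy]

theorem coactCoact_regular (a : A) :
    𝓐.extension.coactCoact 𝓐.regular a
      = BT.assocInvAux (ractA A) 𝓐.extension.bimod 𝓗.left.coring.l 1
          (𝓐.tau (𝓐.comodule.coact a)) := by
  rw [RightExtension.coactCoact, LinearMap.comp_apply, LinearMap.comp_apply, LinearMap.comp_apply,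
    BT.map_t]
  exact BT.assocInv_t_eq_assocInvAux (ractA A) 𝓐.extension.bimod 𝓗.left.coring.l 1 _

theorem coaction_regular_eq_iff (hE : 𝓐.extension.IsPure) {a : A}
    {w : BT (𝓐.extension.indAct 𝓐.regular) 𝓗.left.coring.l} :
    hE.coaction 𝓐.regular a = w ↔ 𝓐.tau (𝓐.comodule.coact a) = 𝓐.coactLeft w := by
  rw [hE.coaction_eq_iff, coactCoact_regular, coactMap_regular,
    (𝓐.extension.bimod.assocInvAux_one_injective 𝓗.left.coring.l).eq_iff]

theorem isLeftLinear_iff {ηL : L →ₐ[k] A} :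
    𝓐.IsLeftLinear ηL ↔ ∀ l, ηL l ∈ 𝓐.coinvariants := by
  refine ⟨fun h l => ?_, fun h l a => ?_⟩
  · have coact_mul_one := h l 1
    rwa [mul_one, 𝓐.coact_one, bimodAH_l_t, mul_one] at coact_mul_one
  · have coact_ηL : 𝓐.comodule.coact (ηL l) = BT.t _ _ (ηL l) 1 := h l
    rw [coact_mul', coact_ηL, ractAH_t]
    rfl

end ComoduleAlgebra

namespace ComoduleAlgebra

variable {k L R H A : Type u} [CommRing k] [Ring L] [Algebra k L] [Ring R] [Algebra k R]
  [Ring H] [Algebra k H] [Ring A] [Algebra k A] {𝓗 : HopfAlgebroid k L R H}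

/-- A pair of maps `λ, λ' : H → A` with the linearity properties of a cleaving, which make the
convolution products `μ_A (λ ⊗_R λ') γ_R` and `μ_A (λ' ⊗_L λ) γ_L` meaningful; neither colinearity
of `λ` nor any value of these products is imposed. -/
structure PreCleaving (𝓐 : ComoduleAlgebra 𝓗.right A) (ηL : L →ₐ[k] A) where
  toFun : H →ₗ[k] A
  map_l : ∀ l h, toFun (𝓗.left.coring.l l h) = ηL l * toFun h
  map_r : ∀ r h, toFun (𝓗.right.coring.r r h) = 𝓐.comodule.ract r (toFun h)
  inv : H →ₗ[k] A
  inv_l : ∀ r h, inv (𝓗.right.coring.l r h) = 𝓐.η r * inv h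
  inv_r : ∀ l h, inv (𝓗.left.coring.r l h) = inv h * ηL l

variable {𝓐 : ComoduleAlgebra 𝓗.right A} {ηL : L →ₐ[k] A}

namespace PreCleaving

variable (c : 𝓐.PreCleaving ηL)

/-- The map `A ⊗_R H → A`, `a ⊗ h ↦ a λ'(h)`. -/
noncomputable def invExt : 𝓐.AH →ₗ[k] A :=
  BT.lift ((LinearMap.mul k A).compl₂ c.inv) fun r a h => by
    simp only [LinearMap.compl₂_apply, LinearMap.mul_apply', 𝓐.ract_eq, c.inv_l, mul_assoc]

theorem invExt_t (a : A) (h : H) : c.invExt (BT.t _ _ a h) = a * c.inv h := by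
  rw [invExt, BT.lift_t]; rfl

theorem invExt_l (a : A) (z : 𝓐.AH) : c.invExt (𝓐.bimodAH.l a z) = a * c.invExt z := by
  induction z using BT.ind with
  | ht b h => rw [bimodAH_l_t, invExt_t, invExt_t, mul_assoc]
  | hadd x y hx hy => simp only [map_add, hx, hy, mul_add]

theorem invExt_ractL (l : L) (z : 𝓐.AH) : c.invExt (𝓐.ractL l z) = c.invExt z * ηL l := by
  induction z using BT.ind with
  | ht b h => rw [ractL_t, invExt_t, invExt_t, c.inv_r, mul_assoc]
  | hadd x y hx hy => simp only [map_add, hx, hy, add_mul]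

/-- The map `H ⊗_L H → A`, `x ⊗ y ↦ λ'(x) λ(y)`. -/
noncomputable def invMul : BT 𝓗.left.coring.r 𝓗.left.coring.l →ₗ[k] A :=
  BT.lift ((LinearMap.mul k A).compl₁₂ c.inv c.toFun) fun l x y => by
    simp only [LinearMap.compl₁₂_apply, LinearMap.mul_apply', c.map_l, c.inv_r, mul_assoc]

theorem invMul_t (x y : H) : c.invMul (BT.t _ _ x y) = c.inv x * c.toFun y := by
  rw [invMul, BT.lift_t]; rfl

/-- The map `H ⊗_R H → A`, `x ⊗ y ↦ λ(x) λ'(y)`. -/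
noncomputable def mulInv : BT 𝓗.right.coring.r 𝓗.right.coring.l →ₗ[k] A :=
  BT.lift ((LinearMap.mul k A).compl₁₂ c.toFun c.inv) fun r x y => by
    simp only [LinearMap.compl₁₂_apply, LinearMap.mul_apply', c.map_r, c.inv_l, 𝓐.ract_eq,
      mul_assoc]

theorem mulInv_t (x y : H) : c.mulInv (BT.t _ _ x y) = c.toFun x * c.inv y := by
  rw [mulInv, BT.lift_t]; rfl

theorem mulInv_lact (l : L) (z : BT 𝓗.right.coring.r 𝓗.right.coring.l) :
    c.mulInv (BT.lact 𝓗.bimodLR 𝓗.right.coring.l l z) = ηL l * c.mulInv z := by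
  induction z using BT.ind with
  | ht x y => rw [𝓗.lactLR_t, mulInv_t, mulInv_t, c.map_l, mul_assoc]
  | hadd x y hx hy => simp only [map_add, hx, hy, mul_add]

/-- The map `H ⊗_R H → A ⊗_R H`, `x ⊗ y ↦ λ(x) ⊗ y`. -/
noncomputable def tensorRight : BT 𝓗.right.coring.r 𝓗.right.coring.l →ₗ[k] 𝓐.AH :=
  BT.map c.toFun LinearMap.id c.map_r fun _ _ => rfl

theorem tensorRight_t (x y : H) : c.tensorRight (BT.t _ _ x y) = BT.t _ _ (c.toFun x) y := by
  rw [tensorRight, BT.map_t]; rfl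

theorem tensorRight_lact (l : L) (z : BT 𝓗.right.coring.r 𝓗.right.coring.l) :
    c.tensorRight (BT.lact 𝓗.bimodLR 𝓗.right.coring.l l z)
      = 𝓐.bimodAH.l (ηL l) (c.tensorRight z) := by
  induction z using BT.ind with
  | ht x y => rw [𝓗.lactLR_t, tensorRight_t, tensorRight_t, c.map_l, bimodAH_l_t]
  | hadd x y hx hy => simp only [map_add, hx, hy]

theorem tensorRight_ract (l : L) (z : BT 𝓗.right.coring.r 𝓗.right.coring.l) :
    c.tensorRight (BT.ract 𝓗.right.coring.r 𝓗.bimodRL l z) = 𝓐.ractL l (c.tensorRight z) := by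
  induction z using BT.ind with
  | ht x y => rw [𝓗.ractRL_t, tensorRight_t, tensorRight_t, ractL_t]
  | hadd x y hx hy => simp only [map_add, hx, hy]

theorem invExt_tensorRight (z : BT 𝓗.right.coring.r 𝓗.right.coring.l) :
    c.invExt (c.tensorRight z) = c.mulInv z := by
  induction z using BT.ind with
  | ht x y => rw [tensorRight_t, invExt_t, mulInv_t]
  | hadd x y hx hy => simp only [map_add, hx, hy]

/-- The map `H ⊗_L H ⊗_R H → A ⊗_R H`, `x ⊗ y ⊗ z ↦ λ'(x) λ(y) ⊗ z`. -/
noncomputable def invMulTensor :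
    BT 𝓗.left.coring.r (BT.lact 𝓗.bimodLR 𝓗.right.coring.l) →ₗ[k] 𝓐.AH :=
  BT.lift ((𝓐.bimodAH.l.comp c.inv).compl₂ c.tensorRight) fun l x z => by
    simp only [LinearMap.compl₂_apply, LinearMap.comp_apply, c.inv_r, 𝓐.bimodAH.l_mul]
    rw [tensorRight_lact]

theorem invMulTensor_t (x : H) (z : BT 𝓗.right.coring.r 𝓗.right.coring.l) :
    c.invMulTensor (BT.t _ _ x z) = 𝓐.bimodAH.l (c.inv x) (c.tensorRight z) := by
  rw [invMulTensor, BT.lift_t]; rfl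

theorem invMulTensor_assoc (z : BT 𝓗.left.coring.r 𝓗.left.coring.l) (y : H) :
    c.invMulTensor (BT.assoc 𝓗.left.coring.r 𝓗.bimodLR 𝓗.right.coring.l (BT.t _ _ z y))
      = BT.t _ _ (c.invMul z) y := by
  induction z using BT.ind with
  | ht x x' => rw [𝓗.assocLR_t, invMulTensor_t, tensorRight_t, bimodAH_l_t, invMul_t]
  | hadd x y hx hy => simp only [map_add, LinearMap.add_apply, hx, hy]

variable {c}

theorem invMulTensor_comul
    (invMul_comul : ∀ h, c.invMul (𝓗.left.coring.comul h) = 𝓐.η (𝓗.right.coring.counit h)) (h : H) :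
    c.invMulTensor (BT.map LinearMap.id 𝓗.right.coring.comul (fun _ _ => rfl) 𝓗.comulR_l
      (𝓗.left.coring.comul h)) = BT.t _ _ 1 h := by
  rw [← 𝓗.coassoc_LR]
  refine Eq.trans ?_ (congrArg (BT.t 𝓐.comodule.ract 𝓗.right.coring.l 1)
    (𝓗.right.coring.counit_comul h))
  generalize 𝓗.right.coring.comul h = w
  induction w using BT.ind with
  | ht x y =>
    rw [BT.map_t, invMulTensor_assoc, invMul_comul, BT.contrL_t, ← BT.t_bal, 𝓐.ract_eq, one_mul]
    rfl
  | hadd x y hx hy => simp only [map_add, hx, hy]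

section Cleft

open Bicomodule

variable {hE : 𝓐.extension.IsPure} {hη : 𝓐.IsLeftLinear ηL}
  {j : HomD hE (𝓐.bicomodule ηL hη)} {q : Q 𝓐.extension (𝓐.bicomodule ηL hη)}

theorem evalCoact_t (hj : ∀ h, j.toFun h = c.toFun h) (hq : ∀ z x, q.toFun z x = c.invExt z * x)
    (a : A) (h : H) : evalCoact q j (BT.t _ _ a h) = a * c.invMul (𝓗.left.coring.comul h) := by
  rw [evalCoact, LinearMap.comp_apply, tau_t]
  generalize 𝓗.left.coring.comul h = w
  induction w using BT.ind with
  | ht x y =>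
    rw [tauAux_t, BT.lift_t, LinearMap.compl₂_apply, hq, hj, invExt_t, invMul_t, mul_assoc]
  | hadd x y hx hy => simp only [map_add, hx, hy, mul_add]

theorem blackDiamond_eq_self_iff (hj : ∀ h, j.toFun h = c.toFun h)
    (hq : ∀ z x, q.toFun z x = c.invExt z * x) :
    (∀ z, blackDiamond q j z = z)
      ↔ ∀ h, c.invMul (𝓗.left.coring.comul h) = 𝓐.η (𝓗.right.coring.counit h) := by
  refine (𝓐.coring.contrR_comul_eq_self_iff _ (evalCoact_l q j)).trans
    ⟨fun heq h => ?_, fun heq z => ?_⟩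
  · simpa only [evalCoact_t hj hq, counitAH_t, one_mul] using heq (BT.t _ _ 1 h)
  · induction z using BT.ind with
    | ht a h => rw [evalCoact_t hj hq, heq, counitAH_t]
    | hadd x y hx hy => rw [map_add, map_add, hx, hy]

theorem diamond_apply (hj : ∀ h, j.toFun h = c.toFun h) (hq : ∀ z x, q.toFun z x = c.invExt z * x)
    (h : H) (x : A) : diamond j q h x = c.invExt (𝓐.comodule.coact (c.toFun h)) * x := by
  refine (BT.contrR_t (ractA A) 𝓐.bimodAH.l _ _ _ 1 _).trans ?_
  rw [ractA_apply, one_mul, LinearMap.flip_apply, hq, hj]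

theorem diamond_eq_counit_iff (hj : ∀ h, j.toFun h = c.toFun h)
    (hq : ∀ z x, q.toFun z x = c.invExt z * x) :
    (∀ h x, diamond j q h x = (𝓐.bicomodule ηL hη).lact (𝓗.left.coring.counit h) x)
      ↔ ∀ h, c.invExt (𝓐.comodule.coact (c.toFun h)) = ηL (𝓗.left.coring.counit h) := by
  simp only [diamond_apply hj hq, lactA_apply]
  exact forall_congr' fun h => ⟨fun heq => by simpa only [mul_one] using heq 1,
    fun heq x => by rw [heq]⟩

end Cleft

end PreCleaving

/-! ### From cleavings to cleft bicomodules -/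

namespace Cleaving

variable (c : 𝓐.Cleaving ηL)

/-- The pair `λ, λ'` of maps of a cleaving. -/
@[reducible] def toPreCleaving : 𝓐.PreCleaving ηL where
  toFun := c.toFun
  map_l := c.map_l
  map_r := c.map_r
  inv := c.inv
  inv_l := c.inv_l
  inv_r := c.inv_r

theorem coact_toFun (h : H) :
    𝓐.comodule.coact (c.toFun h) = c.toPreCleaving.tensorRight (𝓗.right.coring.comul h) :=
  c.colinear h

theorem mulInv_comul (h : H) :
    c.toPreCleaving.mulInv (𝓗.right.coring.comul h) = ηL (𝓗.left.coring.counit h) :=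
  c.mul_inv h

theorem invMul_comul (h : H) :
    c.toPreCleaving.invMul (𝓗.left.coring.comul h) = 𝓐.η (𝓗.right.coring.counit h) :=
  c.inv_mul h

section Colinear

theorem map_ractL (l : L) (h : H) : c.toFun (𝓗.left.coring.r l h)
    = 𝓐.extension.indAct 𝓐.regular l (c.toFun h) := by
  rw [eq_comm, indAct_regular_eq_iff, coact_toFun, coact_toFun, 𝓗.comulR_r,
    PreCleaving.tensorRight_ract]

/-- The map `H ⊗_R H ⊗_L H → (A ⊗_R H) ⊗_L H`, `x ⊗ y ⊗ z ↦ (λ(x) ⊗ y) ⊗ z`. -/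
noncomputable def tensorTwo : BT 𝓗.right.coring.r (BT.lact 𝓗.bimodRL 𝓗.left.coring.l)
    →ₗ[k] BT 𝓐.ractL 𝓗.left.coring.l :=
  (BT.assocInv 𝓐.comodule.ract 𝓗.bimodRL 𝓗.left.coring.l).comp
    (BT.map c.toFun LinearMap.id c.map_r fun _ _ => rfl)

theorem tensorTwo_t (x : H) (z : BT 𝓗.left.coring.r 𝓗.left.coring.l) :
    c.tensorTwo (BT.t _ _ x z) = 𝓐.tauAux (c.toFun x) z := by
  refine (congrArg (BT.assocInv 𝓐.comodule.ract 𝓗.bimodRL 𝓗.left.coring.l)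
    (BT.map_t (lam := BT.lact 𝓗.bimodRL 𝓗.left.coring.l) c.toFun LinearMap.id c.map_r
      (fun _ _ => rfl) x z)).trans ?_
  exact BT.assocInv_t_eq_assocInvAux 𝓐.comodule.ract 𝓗.bimodRL 𝓗.left.coring.l (c.toFun x) z

theorem tensorTwo_assoc (z : BT 𝓗.right.coring.r 𝓗.right.coring.l) (y : H) :
    c.tensorTwo (BT.assoc 𝓗.right.coring.r 𝓗.bimodRL 𝓗.left.coring.l (BT.t _ _ z y))
      = BT.t _ _ (c.toPreCleaving.tensorRight z) y := by
  induction z using BT.ind with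
  | ht x x' => rw [𝓗.assocRL_t, tensorTwo_t, PreCleaving.tensorRight_t, tauAux_t]
  | hadd x y hx hy => simp only [map_add, LinearMap.add_apply, hx, hy]

theorem tau_tensorRight (z : BT 𝓗.right.coring.r 𝓗.right.coring.l) :
    𝓐.tau (c.toPreCleaving.tensorRight z)
      = c.tensorTwo (BT.map LinearMap.id 𝓗.left.coring.comul (fun _ _ => rfl) 𝓗.comulL_l z) := by
  induction z using BT.ind with
  | ht x y => rw [PreCleaving.tensorRight_t, tau_t, BT.map_t, tensorTwo_t, LinearMap.id_apply]
  | hadd x y hx hy => simp only [map_add, hx, hy]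

theorem coaction_toFun (hE : 𝓐.extension.IsPure) (h : H) :
    hE.coaction 𝓐.regular (c.toFun h)
      = BT.map c.toFun LinearMap.id c.map_ractL (fun _ _ => rfl) (𝓗.left.coring.comul h) := by
  rw [coaction_regular_eq_iff, coact_toFun, tau_tensorRight, ← 𝓗.coassoc_RL]
  generalize 𝓗.left.coring.comul h = z
  induction z using BT.ind with
  | ht x y =>
    rw [BT.map_t, BT.map_t, tensorTwo_assoc, coactLeft_t, coact_toFun]
  | hadd x y hx hy => simp only [map_add, hx, hy]

/-- The map `λ` of a cleaving, as a left `L`-linear right `H_L`-colinear map. -/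
noncomputable def toHomD (hE : 𝓐.extension.IsPure) (hη : 𝓐.IsLeftLinear ηL) :
    Bicomodule.HomD hE (𝓐.bicomodule ηL hη) where
  toFun := c.toFun
  map_l := c.map_l
  map_r := c.map_ractL
  colinear := c.coaction_toFun hE

end Colinear

section Inverse

/-- The map `H ⊗_R H → A ⊗_R H`, `x ⊗ y ↦ (1 ⊗ x) λ'(y)`. -/
noncomputable def ractInv : BT 𝓗.right.coring.r 𝓗.right.coring.l →ₗ[k] 𝓐.AH :=
  BT.lift ((𝓐.bimodAH.r.comp c.inv).flip.comp (BT.t 𝓐.comodule.ract 𝓗.right.coring.l 1))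
    fun r x y => by
      simp only [LinearMap.comp_apply, LinearMap.flip_apply]
      rw [c.inv_l, 𝓐.bimodAH.r_mul, bimodAH_r_η]

theorem ractInv_t (x y : H) :
    c.ractInv (BT.t _ _ x y) = 𝓐.bimodAH.r (c.inv y) (BT.t _ _ 1 x) := by
  rw [ractInv, BT.lift_t]; rfl

/-- The map `H ⊗_L H ⊗_R H → A ⊗_R H`, `x ⊗ y ⊗ z ↦ (λ'(x) ⊗ 1) λ(y) λ'(z)`. -/
noncomputable def invMulInv (hη : ∀ l, ηL l ∈ 𝓐.coinvariants) :
    BT 𝓗.left.coring.r (BT.lact 𝓗.bimodLR 𝓗.right.coring.l) →ₗ[k] 𝓐.AH :=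
  BT.lift ((𝓐.bimodAH.r.comp c.toPreCleaving.mulInv).flip.comp
      (((BT.t 𝓐.comodule.ract 𝓗.right.coring.l).flip 1).comp c.inv)) fun l x z => by
    simp only [LinearMap.comp_apply, LinearMap.flip_apply]
    rw [c.inv_r, PreCleaving.mulInv_lact, 𝓐.bimodAH.r_mul, 𝓐.bimodAH_r_coinvariant (hη l)]

variable (hη : ∀ l, ηL l ∈ 𝓐.coinvariants)

theorem invMulInv_t (x : H) (z : BT 𝓗.right.coring.r 𝓗.right.coring.l) :
    c.invMulInv hη (BT.t _ _ x z)
      = 𝓐.bimodAH.r (c.toPreCleaving.mulInv z) (BT.t _ _ (c.inv x) 1) := by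
  rw [invMulInv, BT.lift_t]; rfl

theorem invMulInv_assoc (z : BT 𝓗.left.coring.r 𝓗.left.coring.l) (y : H) :
    c.invMulInv hη (BT.assoc 𝓗.left.coring.r 𝓗.bimodLR 𝓗.right.coring.l (BT.t _ _ z y))
      = 𝓐.bimodAH.r (c.inv y) (c.toPreCleaving.invMulTensor
          (BT.map LinearMap.id 𝓗.right.coring.comul (fun _ _ => rfl) 𝓗.comulR_l z)) := by
  induction z using BT.ind with
  | ht x x' =>
    rw [𝓗.assocLR_t, invMulInv_t, PreCleaving.mulInv_t, 𝓐.bimodAH.r_mul, bimodAH_r_t_one,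
      coact_toFun, BT.map_t, PreCleaving.invMulTensor_t, LinearMap.id_apply]
  | hadd x y hx hy => simp only [map_add, LinearMap.add_apply, hx, hy]

theorem invMulInv_comul (h : H) :
    c.invMulInv hη (BT.map LinearMap.id 𝓗.right.coring.comul (fun _ _ => rfl) 𝓗.comulR_l
      (𝓗.left.coring.comul h)) = BT.t _ _ (c.inv h) 1 := by
  refine Eq.trans ?_ (congrArg (fun x => BT.t 𝓐.comodule.ract 𝓗.right.coring.l (c.inv x) 1)
    (𝓗.left.coring.comul_counit h))
  generalize 𝓗.left.coring.comul h = z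
  induction z using BT.ind with
  | ht x y =>
    rw [BT.map_t, invMulInv_t, mulInv_comul, 𝓐.bimodAH_r_coinvariant (hη _), BT.contrR_t, c.inv_r,
      LinearMap.id_apply]
  | hadd x y hx hy => simp only [map_add, LinearMap.add_apply, hx, hy]

/- Both sides are equal to `(λ'(h_(1)) ⊗ 1) λ(h_(2)^(1)) λ'(h_(2)^(2))`, contracted by means of
`λ' * λ` on the left-hand side and of `λ * λ'` on the right-hand side. -/
theorem ractInv_comul (hη : ∀ l, ηL l ∈ 𝓐.coinvariants) (h : H) :
    c.ractInv (𝓗.right.coring.comul h) = BT.t _ _ (c.inv h) 1 := by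
  rw [← c.invMulInv_comul hη, ← 𝓗.coassoc_LR]
  generalize 𝓗.right.coring.comul h = z
  induction z using BT.ind with
  | ht x y =>
    rw [BT.map_t, invMulInv_assoc, PreCleaving.invMulTensor_comul c.invMul_comul, ractInv_t,
      LinearMap.id_apply]
  | hadd x y hx hy => simp only [map_add, hx, hy]

theorem contrR_kappaAux (a x : A) (w : BT 𝓗.right.coring.r 𝓗.right.coring.l) (hf) :
    BT.contrR 𝓐.bimodAH.r 𝓐.bimodAH.l 𝓐.bimodAH.r_mul
        (((LinearMap.mul k A).comp c.toPreCleaving.invExt).flip x) hf (𝓐.kappaAux a w)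
      = 𝓐.bimodAH.r x (𝓐.bimodAH.l a (c.ractInv w)) := by
  induction w using BT.ind with
  | ht y z =>
    rw [kappaAux_t, ractInv_t, BT.contrR_t, LinearMap.flip_apply, LinearMap.comp_apply,
      LinearMap.mul_apply', PreCleaving.invExt_t, one_mul, 𝓐.bimodAH.r_mul, 𝓐.bimodAH.lr,
      bimodAH_l_t, mul_one]
  | hadd x y hx hy => simp only [map_add, hx, hy]

/-- The map `a ⊗ h ↦ a λ'(h)`, as an element of `Q̃`. -/
noncomputable def toQ (hη : 𝓐.IsLeftLinear ηL) :
    Bicomodule.Q 𝓐.extension (𝓐.bicomodule ηL hη) where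
  toFun := (LinearMap.mul k A).comp c.toPreCleaving.invExt
  apply_r z a x := by
    simp only [LinearMap.comp_apply, LinearMap.mul_apply', ractA_apply, mul_assoc]
  map_l a z x := by
    simp only [LinearMap.comp_apply, LinearMap.mul_apply']
    rw [PreCleaving.invExt_l, mul_assoc]
  map_r l z x := by
    simp only [LinearMap.comp_apply, LinearMap.mul_apply']
    rw [PreCleaving.invExt_ractL, lactA_apply, mul_assoc]
  compat z x := by
    refine Eq.trans ?_ (BT.contrL_t (ractA A) 𝓐.bimodAH.l 𝓐.bimodAH.l_mul _ _ 1
      (𝓐.comodule.coact x)).symm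
    induction z using BT.ind with
    | ht a h =>
      rw [comulAH_t]
      refine (c.contrR_kappaAux a x (𝓗.right.coring.comul h) _).trans ?_
      rw [c.ractInv_comul (𝓐.isLeftLinear_iff.1 hη), bimodAH_l_t, bimodAH_r_t_one,
        LinearMap.comp_apply, LinearMap.mul_apply', mul_one, PreCleaving.invExt_t]
    | hadd x y hx hy => simp only [map_add, LinearMap.add_apply, hx, hy]

end Inverse

end Cleaving

theorem IsCleftVia.isCleftBicomodule (h : 𝓐.IsCleftVia ηL) (hE : 𝓐.extension.IsPure) :
    𝓐.IsCleftBicomodule ηL := by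
  obtain ⟨hη, ⟨c⟩⟩ := h
  have hl : 𝓐.IsLeftLinear ηL := 𝓐.isLeftLinear_iff.2 hη
  have mulInv_eq : ∀ h, c.toPreCleaving.invExt (𝓐.comodule.coact (c.toFun h))
      = ηL (𝓗.left.coring.counit h) := fun h => by
    rw [c.coact_toFun, PreCleaving.invExt_tensorRight, c.mulInv_comul]
  exact ⟨hl, hE, c.toHomD hE hl, c.toQ hl,
    (PreCleaving.blackDiamond_eq_self_iff (c := c.toPreCleaving) (fun _ => rfl)
      fun _ _ => rfl).2 c.invMul_comul,
    (PreCleaving.diamond_eq_counit_iff (c := c.toPreCleaving) (fun _ => rfl)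
      fun _ _ => rfl).2 mulInv_eq⟩

/-! ### From cleft bicomodules to cleavings -/

namespace PreCleaving

variable (c : 𝓐.PreCleaving ηL)

/-- The map `(A ⊗_R H) ⊗_L H → A ⊗_R H`, `(a ⊗ x) ⊗ y ↦ a λ'(x) λ(y^(1)) ⊗ y^(2)`. -/
noncomputable def invExtMulTensor : BT 𝓐.ractL 𝓗.left.coring.l →ₗ[k] 𝓐.AH :=
  BT.lift ((𝓐.bimodAH.l.comp c.invExt).compl₂ (c.tensorRight.comp 𝓗.right.coring.comul))
    fun l z h => by
      simp only [LinearMap.compl₂_apply, LinearMap.comp_apply]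
      rw [invExt_ractL, 𝓐.bimodAH.l_mul, 𝓗.comulR_l, tensorRight_lact]

theorem invExtMulTensor_t (z : 𝓐.AH) (h : H) : c.invExtMulTensor (BT.t _ _ z h)
    = 𝓐.bimodAH.l (c.invExt z) (c.tensorRight (𝓗.right.coring.comul h)) := by
  rw [invExtMulTensor, BT.lift_t]; rfl

theorem invExtMulTensor_tauAux (a : A) (w : BT 𝓗.left.coring.r 𝓗.left.coring.l) :
    c.invExtMulTensor (𝓐.tauAux a w) = 𝓐.bimodAH.l a (c.invMulTensor
      (BT.map LinearMap.id 𝓗.right.coring.comul (fun _ _ => rfl) 𝓗.comulR_l w)) := by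
  induction w using BT.ind with
  | ht x y =>
    rw [tauAux_t, invExtMulTensor_t, invExt_t, BT.map_t, invMulTensor_t, 𝓐.bimodAH.l_mul,
      LinearMap.id_apply]
  | hadd x y hx hy => simp only [map_add, hx, hy]

variable {c}

theorem invExtMulTensor_tau
    (invMul_comul : ∀ h, c.invMul (𝓗.left.coring.comul h) = 𝓐.η (𝓗.right.coring.counit h)) :
    Function.LeftInverse c.invExtMulTensor 𝓐.tau := fun z => by
  induction z using BT.ind with
  | ht a h =>
    rw [tau_t, invExtMulTensor_tauAux, invMulTensor_comul invMul_comul, ← t_eq_bimodAH_l]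
  | hadd x y hx hy => simp only [map_add, hx, hy]

theorem coact_toFun
    (map_ractL : ∀ l h, c.toFun (𝓗.left.coring.r l h)
      = 𝓐.extension.indAct 𝓐.regular l (c.toFun h))
    (tau_coact : ∀ h, 𝓐.tau (𝓐.comodule.coact (c.toFun h)) = 𝓐.coactLeft
      (BT.map c.toFun LinearMap.id map_ractL (fun _ _ => rfl) (𝓗.left.coring.comul h)))
    (invMul_comul : ∀ h, c.invMul (𝓗.left.coring.comul h) = 𝓐.η (𝓗.right.coring.counit h))
    (invExt_coact : ∀ h, c.invExt (𝓐.comodule.coact (c.toFun h)) = ηL (𝓗.left.coring.counit h))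
    (h : H) : 𝓐.comodule.coact (c.toFun h) = c.tensorRight (𝓗.right.coring.comul h) := by
  rw [← invExtMulTensor_tau invMul_comul (𝓐.comodule.coact (c.toFun h)), tau_coact]
  refine Eq.trans ?_ (congrArg (fun x => c.tensorRight (𝓗.right.coring.comul x))
    (𝓗.left.coring.counit_comul h))
  generalize 𝓗.left.coring.comul h = z
  induction z using BT.ind with
  | ht x y =>
    rw [BT.map_t, coactLeft_t, invExtMulTensor_t, invExt_coact, BT.contrL_t, 𝓗.comulR_l,
      tensorRight_lact, LinearMap.id_apply]
  | hadd x y hx hy => simp only [map_add, hx, hy]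

/-- The cleaving given by a pair of maps which satisfies the remaining conditions. The convolution
product of `λ` and `λ'` over `R` is expressed by means of `λ(h)^[0] ⊗ λ(h)^[1]`. -/
def toCleaving
    (colinear : ∀ h, 𝓐.comodule.coact (c.toFun h) = c.tensorRight (𝓗.right.coring.comul h))
    (invMul_comul : ∀ h, c.invMul (𝓗.left.coring.comul h) = 𝓐.η (𝓗.right.coring.counit h))
    (invExt_coact : ∀ h, c.invExt (𝓐.comodule.coact (c.toFun h)) = ηL (𝓗.left.coring.counit h)) :
    𝓐.Cleaving ηL where
  toFun := c.toFun
  map_l := c.map_l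
  map_r := c.map_r
  colinear := colinear
  inv := c.inv
  inv_l := c.inv_l
  inv_r := c.inv_r
  mul_inv h := by
    rw [← invExt_coact h, colinear, invExt_tensorRight]; rfl
  inv_mul := invMul_comul

end PreCleaving

section OfBicomodule

open Bicomodule

variable {hE : 𝓐.extension.IsPure} {hη : 𝓐.IsLeftLinear ηL}
  (j : HomD hE (𝓐.bicomodule ηL hη)) (q : Q 𝓐.extension (𝓐.bicomodule ηL hη))

theorem tau_coact_homD (h : H) : 𝓐.tau (𝓐.comodule.coact (j.toFun h)) = 𝓐.coactLeft
    (BT.map j.toFun LinearMap.id j.map_r (fun _ _ => rfl) (𝓗.left.coring.comul h)) :=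
  (𝓐.coaction_regular_eq_iff hE).1 (j.colinear h)

theorem homD_ract (r : R) (h : H) :
    j.toFun (𝓗.right.coring.r r h) = 𝓐.comodule.ract r (j.toFun h) := by
  apply 𝓐.coact_injective
  apply 𝓐.tau_injective
  rw [𝓐.comodule.coact_r, tau_ract, tau_coact_homD, tau_coact_homD, 𝓗.comulL_r]
  generalize 𝓗.left.coring.comul h = z
  induction z using BT.ind with
  | ht x y =>
    rw [𝓗.ractLR_t, BT.map_t, BT.map_t, coactLeft_t, coactLeft_t, 𝓗.ractLR_t]
    rfl
  | hadd x y hx hy => simp only [map_add, hx, hy]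

theorem q_apply (z : 𝓐.AH) (x : A) : q.toFun z x = q.toFun z 1 * x := by
  have apply_one_mul := q.apply_r z x 1
  rwa [ractA_apply, one_mul] at apply_one_mul

/-- The map `h ↦ q(1 ⊗ h)(1)`, which is the candidate for the convolution inverse. -/
noncomputable def qInv : H →ₗ[k] A :=
  (q.toFun.flip 1).comp (BT.t 𝓐.comodule.ract 𝓗.right.coring.l 1)

theorem q_t (a : A) (h : H) : q.toFun (BT.t _ _ a h) 1 = a * qInv q h := by
  rw [t_eq_bimodAH_l]
  exact q.map_l a _ 1

theorem qInv_l (r : R) (h : H) : qInv q (𝓗.right.coring.l r h) = 𝓐.η r * qInv q h := by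
  rw [← q_t, ← one_mul (𝓐.η r), ← 𝓐.ract_eq, BT.t_bal, q_t, one_mul]

theorem qInv_r (l : L) (h : H) : qInv q (𝓗.left.coring.r l h) = qInv q h * ηL l := by
  rw [← one_mul (qInv q _), ← q_t, ← ractL_t]
  refine (q.map_r l _ 1).trans ?_
  rw [lactA_apply, mul_one, q_apply, q_t, one_mul]

/-- The pair `j`, `h ↦ q(1 ⊗ h)(1)` given by data of a cleft bicomodule. -/
@[reducible] noncomputable def preCleavingOfBicomodule : 𝓐.PreCleaving ηL where
  toFun := j.toFun
  map_l := j.map_l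
  map_r := homD_ract j
  inv := qInv q
  inv_l := qInv_l q
  inv_r := qInv_r q

theorem q_eq_invExt_mul (z : 𝓐.AH) (x : A) :
    q.toFun z x = (preCleavingOfBicomodule j q).invExt z * x := by
  rw [q_apply]
  congr 1
  induction z using BT.ind with
  | ht a h => rw [PreCleaving.invExt_t, q_t]
  | hadd x y hx hy => simp only [map_add, LinearMap.add_apply, hx, hy]

end OfBicomodule

theorem IsCleftBicomodule.isCleftVia (h : 𝓐.IsCleftBicomodule ηL) : 𝓐.IsCleftVia ηL := by
  obtain ⟨hη, hE, j, q, blackDiamond_eq, diamond_eq⟩ := h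
  have q_eq := q_eq_invExt_mul j q
  have invMul_comul := (PreCleaving.blackDiamond_eq_self_iff (fun _ => rfl) q_eq).1 blackDiamond_eq
  have invExt_coact := (PreCleaving.diamond_eq_counit_iff (fun _ => rfl) q_eq).1 diamond_eq
  have colinear := PreCleaving.coact_toFun j.map_r (tau_coact_homD j) invMul_comul invExt_coact
  exact ⟨𝓐.isLeftLinear_iff.1 hη, ⟨PreCleaving.toCleaving colinear invMul_comul invExt_coact⟩⟩

theorem isCleftVia_iff (h : 𝓗.extensionL.IsPure) (ηL : L →ₐ[k] A) :
    𝓐.IsCleftVia ηL ↔ 𝓐.IsCleftBicomodule ηL :=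
  ⟨fun hc => hc.isCleftBicomodule (𝓐.extension_isPure h), fun hc => hc.isCleftVia⟩

end ComoduleAlgebra
end NC

theorem mainTheorem11_general {k L R H A : Type u} [CommRing k] [Ring L] [Algebra k L]
    [Ring R] [Algebra k R] [Ring H] [Algebra k H] [Ring A] [Algebra k A]
    (𝓗 : NC.HopfAlgebroid k L R H) (h : 𝓗.extensionL.IsPure)
    (𝓐 : NC.ComoduleAlgebra 𝓗.right A) :
    (𝓐.IsCleftExtension ↔ ∃ ηL : L →ₐ[k] A, 𝓐.IsCleftBicomodule ηL) ∧
      ∀ ηL : L →ₐ[k] A, 𝓐.IsCleftVia ηL ↔ 𝓐.IsCleftBicomodule ηL :=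
  ⟨exists_congr (NC.ComoduleAlgebra.isCleftVia_iff h), NC.ComoduleAlgebra.isCleftVia_iff h⟩

theorem mainTheorem11 {k L R H A : Type u} [CommRing k] [Ring L] [Algebra k L]
    [Ring R] [Algebra k R] [Ring H] [Algebra k H] [Ring A] [Algebra k A]
    (𝓗 : NC.HopfAlgebroid k L R H) (hpure : 𝓗.IsPure)
    (𝓐 : NC.ComoduleAlgebra 𝓗.right A) :
    (𝓐.IsCleftExtension ↔ ∃ ηL : L →ₐ[k] A, 𝓐.IsCleftBicomodule ηL) ∧
      ∀ ηL : L →ₐ[k] A, 𝓐.IsCleftVia ηL ↔ 𝓐.IsCleftBicomodule ηL :=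
  mainTheorem11_general 𝓗 hpure.1 𝓐
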